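/- **Theorem 3.7.** Let $n,p\ge 0$, let $M$ be an $n$-dimensional smooth manifold (Hausdorff, second countable, without boundary), let $x:M\to\mathbb R^{n+p}$ be a smooth immersion, and let $x_0\in\mathbb R^{n+p}$, $t_0>0$. Equip $M$ with the induced metric, with volume measure $d\mu$; let $H$ be the mean curvature vector (the trace of the second fundamental form), let $(\cdot)^\perp$ be the projection onto the normal space, and put $$\mathcal F_{x_0,t_0}(M)=(4\pi t_0)^{-n/2}\int_M e^{-\frac{|x-x_0|^2}{4t_0}}\,d\mu .$$ Call $M$ a *critical point* of $\mathcal F_{x_0,t_0}$ if for every smooth one-parameter family of immersions $X_s:M\to\mathbb R^{n+p}$, $|s|<\varepsilon$, with $X_0=x$, with $X_s=x$ for all $s$ outside one compact subset of $M$, and with $\frac{\partial}{\partial s}\big|_{s=0}X_s$ normal to $M$, and for all smooth curves $x_s\in\mathbb R^{n+p}$ and $t_s>0$, $|s|<\varepsilon$, starting at $x_0$ and $t_0$ for $s=0$, the value $\mathcal F_{x_s,t_s}(X_s(M))$ (the integral being taken over $M$ with the metric induced by $X_s$) is finite for all $s$ near $0$, is differentiable at $s=0$, and satisfies $\frac{d}{ds}\big|_{s=0}\mathcal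 F_{x_s,t_s}(X_s(M))=0$. 1. If $M$ is a critical point of $\mathcal F_{x_0,t_0}$, then $H=-\frac{(x-x_0)^\perp}{2t_0}$ on $M$. 2. Conversely, if $H=-\frac{(x-x_0)^\perp}{2t_0}$ on $M$, if $M$ is complete in the induced metric, and if $M$ has polynomial volume growth, that is, there are constants $C,d$ with $\mu(\{q\in M:|x(q)|<r\})\le C r^d$ for all $r\ge 1$, then $M$ is a critical point of $\mathcal F_{x_0,t_0}$. In particular, for complete $M$ with polynomial volume growth, $M$ is a critical point of $\mathcal F_{x_0,t_0}$ if and only if $H=-\frac{(x-x_0)^\perp}{2t_0}$. -/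

import Mathlib

open Set Filter Topology MeasureTheory
open scoped ContDiff Manifold

noncomputable section

namespace SelfShrinker

variable {n p : ℕ} {M : Type*} [TopologicalSpace M]
  [ChartedSpace (EuclideanSpace ℝ (Fin n)) M]

/-- A smooth map `X : M → ℝ^{n+p}` with injective differential at every point. -/
structure IsSmoothImmersion (X : M → EuclideanSpace ℝ (Fin (n + p))) : Prop where
  smooth : ContMDiff (𝓡 n) 𝓘(ℝ, EuclideanSpace ℝ (Fin (n + p))) ∞ X
  injective_mfderiv : ∀ q : M,
    Function.Injective (mfderiv (𝓡 n) 𝓘(ℝ, EuclideanSpace ℝ (Fin (n + p))) X q)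

/-- The tangent space of the immersed submanifold at `q`, as a subspace of `ℝ^{n+p}`. -/
def tangentSpan (X : M → EuclideanSpace ℝ (Fin (n + p))) (q : M) :
    Submodule ℝ (EuclideanSpace ℝ (Fin (n + p))) :=
  LinearMap.range
    (mfderiv (𝓡 n) 𝓘(ℝ, EuclideanSpace ℝ (Fin (n + p))) X q).toLinearMap

/-- The orthogonal projection `w ↦ w^⊥` onto the normal space at `q`. -/
def normalPart (X : M → EuclideanSpace ℝ (Fin (n + p))) (q : M)
    (w : EuclideanSpace ℝ (Fin (n + p))) : EuclideanSpace ℝ (Fin (n + p)) :=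
  (tangentSpan X q)ᗮ.starProjection w

/-- The coordinate derivative `∂_i (X ∘ e⁻¹)` at the point `u` of the chart `e`. -/
def partialDeriv (X : M → EuclideanSpace ℝ (Fin (n + p)))
    (e : OpenPartialHomeomorph M (EuclideanSpace ℝ (Fin n)))
    (u : EuclideanSpace ℝ (Fin n)) (i : Fin n) : EuclideanSpace ℝ (Fin (n + p)) :=
  fderiv ℝ (X ∘ e.symm) u (EuclideanSpace.single i 1)

/-- The second coordinate derivative `∂_i ∂_j (X ∘ e⁻¹)` at the point `u` of the chart `e`. -/
def partialDeriv₂ (X : M → EuclideanSpace ℝ (Fin (n + p)))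
    (e : OpenPartialHomeomorph M (EuclideanSpace ℝ (Fin n)))
    (u : EuclideanSpace ℝ (Fin n)) (i j : Fin n) : EuclideanSpace ℝ (Fin (n + p)) :=
  fderiv ℝ (fderiv ℝ (X ∘ e.symm)) u (EuclideanSpace.single i 1) (EuclideanSpace.single j 1)

/-- The matrix `g_{ij} = ⟨∂_i X, ∂_j X⟩` of the induced metric in the chart `e`. -/
def gram (X : M → EuclideanSpace ℝ (Fin (n + p)))
    (e : OpenPartialHomeomorph M (EuclideanSpace ℝ (Fin n)))
    (u : EuclideanSpace ℝ (Fin n)) : Matrix (Fin n) (Fin n) ℝ :=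
  Matrix.of fun i j => inner ℝ (partialDeriv X e u i) (partialDeriv X e u j)

/-- The mean curvature vector `H = ∑_{i,j} g^{ij} (∂_i ∂_j X)^⊥`, the trace of the second
fundamental form, computed at `q` in the preferred chart at `q`. -/
def meanCurvature (X : M → EuclideanSpace ℝ (Fin (n + p))) (q : M) :
    EuclideanSpace ℝ (Fin (n + p)) :=
  let e := chartAt (EuclideanSpace ℝ (Fin n)) q
  ∑ i, ∑ j, (gram X e (e q))⁻¹ i j • normalPart X q (partialDeriv₂ X e (e q) i j)

/-- The part over the domain of the chart `e` of the volume measure: the measure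
`√(det g) du` on the target of `e`, carried over to `M`. -/
def chartVolume [MeasurableSpace M] (X : M → EuclideanSpace ℝ (Fin (n + p)))
    (e : OpenPartialHomeomorph M (EuclideanSpace ℝ (Fin n))) : Measure M :=
  (((volume : Measure (EuclideanSpace ℝ (Fin n))).restrict e.target).withDensity
    fun u => ENNReal.ofReal (Real.sqrt (gram X e u).det)).map e.symm

/-- The volume measure `dμ` on `M` of the metric induced by `X`. Any two of the measures
`chartVolume X e` agree over the intersection of the two chart domains, so that their
supremum is the measure on `M` which equals `√(det g) du` in every chart. -/
def volumeMeasure [MeasurableSpace M] (X : M → EuclideanSpace ℝ (Fin (n + p))) : Measure M :=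
  ⨆ e ∈ atlas (EuclideanSpace ℝ (Fin n)) M, chartVolume X e

/-- The Gaussian weight `exp(-|x - x₀|² / (4 t₀))` on `M`. -/
def gaussianWeight (X : M → EuclideanSpace ℝ (Fin (n + p)))
    (x₀ : EuclideanSpace ℝ (Fin (n + p))) (t₀ : ℝ) (q : M) : ℝ :=
  Real.exp (-‖X q - x₀‖ ^ 2 / (4 * t₀))

/-- `𝓕_{x₀,t₀}(M) = (4 π t₀)^{-n/2} ∫_M exp(-|x - x₀|² / (4 t₀)) dμ`. -/
def functionalF [MeasurableSpace M] (X : M → EuclideanSpace ℝ (Fin (n + p)))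
    (x₀ : EuclideanSpace ℝ (Fin (n + p))) (t₀ : ℝ) : ℝ :=
  (4 * Real.pi * t₀) ^ (-(n : ℝ) / 2) * ∫ q, gaussianWeight X x₀ t₀ q ∂(volumeMeasure X)

/-- `Y s` (for `|s| < ε`) is a smooth compactly supported one-parameter family of immersions
with `Y 0 = X` whose variation vector field at `s = 0` is normal, and `ξ`, `τ` are smooth
curves through `x₀` and `t₀`, with `τ` positive. -/
structure IsNormalVariation (X : M → EuclideanSpace ℝ (Fin (n + p)))
    (x₀ : EuclideanSpace ℝ (Fin (n + p))) (t₀ : ℝ) (ε : ℝ)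
    (Y : ℝ → M → EuclideanSpace ℝ (Fin (n + p)))
    (ξ : ℝ → EuclideanSpace ℝ (Fin (n + p))) (τ : ℝ → ℝ) : Prop where
  pos : 0 < ε
  smooth : ContMDiffOn (𝓘(ℝ, ℝ).prod (𝓡 n)) 𝓘(ℝ, EuclideanSpace ℝ (Fin (n + p))) ∞
    (fun z : ℝ × M => Y z.1 z.2) (Ioo (-ε) ε ×ˢ univ)
  immersion : ∀ s ∈ Ioo (-ε) ε, IsSmoothImmersion (Y s)
  zero : Y 0 = X
  compact_support : ∃ K : Set M, IsCompact K ∧ ∀ s ∈ Ioo (-ε) ε, ∀ q ∉ K, Y s q = X q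
  normal : ∀ q, deriv (fun s => Y s q) 0 ∈ (tangentSpan X q)ᗮ
  smooth_center : ContDiffOn ℝ ∞ ξ (Ioo (-ε) ε)
  center_zero : ξ 0 = x₀
  smooth_scale : ContDiffOn ℝ ∞ τ (Ioo (-ε) ε)
  scale_zero : τ 0 = t₀
  scale_pos : ∀ s ∈ Ioo (-ε) ε, 0 < τ s

/-- `M` is a critical point of `𝓕_{x₀,t₀}`: along every compactly supported normal variation
of `M` and all variations of `x₀` and `t₀`, the functional is finite for small `s` and its
derivative at `s = 0` exists and vanishes. -/
def IsCriticalPoint [MeasurableSpace M] (X : M → EuclideanSpace ℝ (Fin (n + p)))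
    (x₀ : EuclideanSpace ℝ (Fin (n + p))) (t₀ : ℝ) : Prop :=
  ∀ (ε : ℝ) (Y : ℝ → M → EuclideanSpace ℝ (Fin (n + p)))
    (ξ : ℝ → EuclideanSpace ℝ (Fin (n + p))) (τ : ℝ → ℝ),
    IsNormalVariation X x₀ t₀ ε Y ξ τ →
      (∀ᶠ s in 𝓝 (0 : ℝ),
        Integrable (gaussianWeight (Y s) (ξ s) (τ s)) (volumeMeasure (Y s))) ∧
      HasDerivAt (fun s => functionalF (Y s) (ξ s) (τ s)) 0 0

/-- The distance on `M` of the induced metric: the infimum of the lengths of the `C¹` curves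
from `q` to `q'` (infinite between different components). -/
def inducedEDist (X : M → EuclideanSpace ℝ (Fin (n + p))) (q q' : M) : ENNReal :=
  ⨅ (γ : ℝ → M) (_ : ContMDiffOn 𝓘(ℝ, ℝ) (𝓡 n) 1 γ (Icc 0 1)) (_ : γ 0 = q) (_ : γ 1 = q'),
    ∫⁻ t in Icc (0 : ℝ) 1, ‖derivWithin (X ∘ γ) (Icc 0 1) t‖ₑ

/-- Completeness of `M` with the induced metric: every Cauchy sequence converges. -/
def IsCompleteImmersion (X : M → EuclideanSpace ℝ (Fin (n + p))) : Prop :=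
  ∀ u : ℕ → M,
    (∀ δ : ENNReal, 0 < δ → ∃ N, ∀ k ≥ N, ∀ l ≥ N, inducedEDist X (u k) (u l) < δ) →
      ∃ q, Tendsto u atTop (𝓝 q)

/-- Polynomial volume growth: `Vol(B_r ∩ M) ≤ C r^d` for all `r ≥ 1`. -/
def HasPolynomialVolumeGrowth [MeasurableSpace M]
    (X : M → EuclideanSpace ℝ (Fin (n + p))) : Prop :=
  ∃ C d : ℝ, ∀ r : ℝ, 1 ≤ r →
    volumeMeasure X (X ⁻¹' Metric.ball 0 r) ≤ ENNReal.ofReal (C * r ^ d)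

/-- The self-shrinker equation `H = -(x - x₀)^⊥ / (2 t₀)` on all of `M`. -/
def IsSelfShrinker (X : M → EuclideanSpace ℝ (Fin (n + p)))
    (x₀ : EuclideanSpace ℝ (Fin (n + p))) (t₀ : ℝ) : Prop :=
  ∀ q : M, meanCurvature X q = -((2 * t₀)⁻¹ • normalPart X q (X q - x₀))

end SelfShrinker

end

/-!
The criticality of `X` is decided by the first variation formula. Along a normal variation `Y s` of
`X` with velocity `V`, with centre `ξ s` and scale `τ s`, the functional is an integral over the
fixed measure `volumeMeasure X` of the Gaussian of `Y s` times the ratio of the volume elements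
(`volumeMeasure_eq_withDensity`), and Jacobi's formula (`hasDerivAt_sqrt_det_crossGram`) shows that
this ratio has derivative `div V`, the tangential divergence
(`IsNormalVariation.hasDerivAt_volumeRatio`). Since `V` is normal, `div V = -⟨H, V⟩`
(`tangentialDivergence_of_normal`). Off the support of `V` only the Gaussian moves; on a compact set
the integrand is smooth in all variables, so it is Lipschitz in `s` with an integrable constant as
soon as the Gaussian itself is, and one may differentiate under the integral
(`IsNormalVariation.first_variation`).

If `X` is critical, test it with a fixed centre and scale and with the affine variation
`X + s ψ N`, where `N` is the normal projection of the constant vector `w`, the value at a point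
`q₀` of `H + (x - x₀)^⊥ / (2t₀)`, and `ψ` is a bump function at `q₀`. Near `q₀` the integrand
is `-ψ` times a function close to `|w|²`, up to the Gaussian factor, so its integral can vanish only
if `w = 0`.

If `X` is a self-shrinker, the contribution of `V` vanishes pointwise, and what remains of the
derivative is the integral of the divergence of the tangential part of the field
`exp(-|x - x₀|² / (4t₀)) (α (x - x₀) + y)` with `α = -τ' / (2t₀)` and `y = -ξ'`
(`IsSelfShrinker.tangentialDivergence_weightedField`). Polynomial volume growth makes
`exp(-|x|)` integrable, which dominates this field and the Lipschitz constants of the Gaussian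
(`HasPolynomialVolumeGrowth.integrable_exp_neg_norm`, `exists_gaussianKernel_lipschitz`).

The integral of such a divergence is zero on a complete `M`
(`integral_tangentialDivergence_eq_zero`). The proof uses cutoff functions which tend to one
and whose Lipschitz constants for the induced distance tend to zero
(`IsCompleteImmersion.exists_cutoff`). They have compact support by the Hopf–Rinow theorem
(`IsCompleteImmersion.hasCompactBall`), and as they are only Lipschitz, the integration by parts in
charts relies on Rademacher's theorem. Since `M` may have countably many components, the cutoff
functions are built from the distances to finitely many members of a dense sequence instead of
one base point.
-/

noncomputable section

namespace SelfShrinker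

set_option linter.unusedSectionVars false

/-! ### Gram matrices, tangential traces and coordinates -/

section LinearAlgebra

variable {n : ℕ} {F : Type*} [NormedAddCommGroup F] [InnerProductSpace ℝ F]

/-- The matrix `⟨A eᵢ, B eⱼ⟩` of scalar products of the columns of two linear maps. -/
def crossGram (A B : EuclideanSpace ℝ (Fin n) →L[ℝ] F) : Matrix (Fin n) (Fin n) ℝ :=
  Matrix.of fun i j => inner ℝ (A (EuclideanSpace.single i 1)) (B (EuclideanSpace.single j 1))

/-- The trace of `B` along the range of `A`: the number `∑ gⁱʲ ⟨A eᵢ, B eⱼ⟩` where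
`g = ⟨A eᵢ, A eⱼ⟩`. For the differentials `A` of an immersion and `B` of a vector field along
it, this is the tangential divergence of the vector field. -/
def tangentialTrace (A B : EuclideanSpace ℝ (Fin n) →L[ℝ] F) : ℝ :=
  ((crossGram A A)⁻¹ * crossGram A B).trace

/-- The matrix of an endomorphism of `ℝⁿ` in the standard basis. -/
def coordMatrix (T : EuclideanSpace ℝ (Fin n) →L[ℝ] EuclideanSpace ℝ (Fin n)) :
    Matrix (Fin n) (Fin n) ℝ :=
  Matrix.of fun i j => T (EuclideanSpace.single j 1) i

lemma sum_coord_single (v : EuclideanSpace ℝ (Fin n)) :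
    v = ∑ k, v k • EuclideanSpace.single k (1 : ℝ) := by
  ext i
  simp [Finset.sum_apply, Pi.single_apply]

lemma apply_eq_sum_coord (A : EuclideanSpace ℝ (Fin n) →L[ℝ] F) (v : EuclideanSpace ℝ (Fin n)) :
    A v = ∑ k, v k • A (EuclideanSpace.single k (1 : ℝ)) := by
  conv_lhs => rw [sum_coord_single v]
  simp

lemma coordMatrix_det (T : EuclideanSpace ℝ (Fin n) →L[ℝ] EuclideanSpace ℝ (Fin n)) :
    (coordMatrix T).det = T.det := by
  rw [ContinuousLinearMap.det, ← LinearMap.det_toMatrix (EuclideanSpace.basisFun (Fin n) ℝ).toBasis]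
  congr 1

lemma crossGram_comp (A B : EuclideanSpace ℝ (Fin n) →L[ℝ] F)
    (S T : EuclideanSpace ℝ (Fin n) →L[ℝ] EuclideanSpace ℝ (Fin n)) :
    crossGram (A ∘L S) (B ∘L T) = (coordMatrix S).transpose * crossGram A B * coordMatrix T := by
  ext i j
  simp only [crossGram, Matrix.of_apply, ContinuousLinearMap.comp_apply, Matrix.mul_apply,
    Matrix.transpose_apply, coordMatrix]
  rw [apply_eq_sum_coord A, apply_eq_sum_coord B, inner_sum]
  refine Finset.sum_congr rfl fun k _ => ?_
  rw [inner_smul_right, sum_inner, mul_comm]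
  simp [inner_smul_left]

lemma crossGram_comp_right (A B : EuclideanSpace ℝ (Fin n) →L[ℝ] F)
    (T : EuclideanSpace ℝ (Fin n) →L[ℝ] EuclideanSpace ℝ (Fin n)) :
    crossGram A (B ∘L T) = crossGram A B * coordMatrix T := by
  have h := crossGram_comp A B (ContinuousLinearMap.id ℝ _) T
  have h1 : coordMatrix (ContinuousLinearMap.id ℝ (EuclideanSpace ℝ (Fin n))) = 1 := by
    ext i j
    simp [coordMatrix, Matrix.one_apply]
  simpa [h1] using h

lemma crossGram_transpose (A B : EuclideanSpace ℝ (Fin n) →L[ℝ] F) :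
    (crossGram A B).transpose = crossGram B A := by
  ext i j
  simp [crossGram, real_inner_comm]

lemma linearIndependent_columns {A : EuclideanSpace ℝ (Fin n) →L[ℝ] F}
    (hA : Function.Injective A) :
    LinearIndependent ℝ (fun i => A (EuclideanSpace.single i (1 : ℝ))) := by
  have h := (EuclideanSpace.basisFun (Fin n) ℝ).toBasis.linearIndependent
  have h2 := h.map' (A : EuclideanSpace ℝ (Fin n) →ₗ[ℝ] F) (LinearMap.ker_eq_bot.2 hA)
  convert! h2 using 1
  ext i
  simp

lemma crossGram_self_det_pos {A : EuclideanSpace ℝ (Fin n) →L[ℝ] F}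
    (hA : Function.Injective A) : 0 < (crossGram A A).det :=
  (Matrix.posDef_gram_of_linearIndependent (linearIndependent_columns hA)).det_pos

lemma injective_of_crossGram_self_det_ne_zero {A : EuclideanSpace ℝ (Fin n) →L[ℝ] F}
    (hA : (crossGram A A).det ≠ 0) : Function.Injective A := by
  have h : LinearIndependent ℝ (fun i => A (EuclideanSpace.single i (1 : ℝ))) :=
    Matrix.det_gram_ne_zero_iff_linearIndependent.1 hA
  rw [injective_iff_map_eq_zero]
  intro v hv
  rw [apply_eq_sum_coord] at hv
  have := Fintype.linearIndependent_iff.1 h v hv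
  ext i
  simpa using this i

lemma isUnit_crossGram_det {A : EuclideanSpace ℝ (Fin n) →L[ℝ] F}
    (hA : Function.Injective A) : IsUnit (crossGram A A).det :=
  (crossGram_self_det_pos hA).ne'.isUnit

lemma det_crossGram_comp (A : EuclideanSpace ℝ (Fin n) →L[ℝ] F)
    (T : EuclideanSpace ℝ (Fin n) →L[ℝ] EuclideanSpace ℝ (Fin n)) :
    (crossGram (A ∘L T) (A ∘L T)).det = T.det ^ 2 * (crossGram A A).det := by
  rw [crossGram_comp, Matrix.det_mul, Matrix.det_mul, Matrix.det_transpose, coordMatrix_det]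
  ring

lemma sqrt_det_crossGram_comp (A : EuclideanSpace ℝ (Fin n) →L[ℝ] F)
    (T : EuclideanSpace ℝ (Fin n) →L[ℝ] EuclideanSpace ℝ (Fin n)) :
    √(crossGram (A ∘L T) (A ∘L T)).det = |T.det| * √(crossGram A A).det := by
  rw [det_crossGram_comp, Real.sqrt_mul (sq_nonneg _), Real.sqrt_sq_eq_abs]

/-- The tangential trace does not depend on the coordinates of the parameter space. -/
lemma tangentialTrace_comp (A B : EuclideanSpace ℝ (Fin n) →L[ℝ] F)
    (T : EuclideanSpace ℝ (Fin n) →L[ℝ] EuclideanSpace ℝ (Fin n)) (hT : T.det ≠ 0) :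
    tangentialTrace (A ∘L T) (B ∘L T) = tangentialTrace A B := by
  have hu : IsUnit (coordMatrix T).det := by rw [coordMatrix_det]; exact hT.isUnit
  have hu' : IsUnit (coordMatrix T).transpose.det := by rwa [Matrix.det_transpose]
  rw [tangentialTrace, crossGram_comp, crossGram_comp, Matrix.mul_inv_rev, Matrix.mul_inv_rev,
    tangentialTrace]
  have : (coordMatrix T)⁻¹ * ((crossGram A A)⁻¹ * (coordMatrix T).transpose⁻¹) *
      ((coordMatrix T).transpose * crossGram A B * coordMatrix T)
      = (coordMatrix T)⁻¹ * ((crossGram A A)⁻¹ * crossGram A B * coordMatrix T) := by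
    have h1 := Matrix.nonsing_inv_mul _ hu'
    calc _ = (coordMatrix T)⁻¹ * ((crossGram A A)⁻¹ *
        ((coordMatrix T).transpose⁻¹ * (coordMatrix T).transpose) *
          (crossGram A B * coordMatrix T)) := by simp only [Matrix.mul_assoc]
      _ = _ := by rw [h1, Matrix.mul_one, Matrix.mul_assoc]
  rw [this, Matrix.trace_mul_comm, Matrix.mul_assoc, Matrix.mul_nonsing_inv _ hu, Matrix.mul_one]

lemma tangentialTrace_self_comp {A : EuclideanSpace ℝ (Fin n) →L[ℝ] F}
    (hA : Function.Injective A)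
    (T : EuclideanSpace ℝ (Fin n) →L[ℝ] EuclideanSpace ℝ (Fin n)) :
    tangentialTrace A (A ∘L T) = ∑ i, T (EuclideanSpace.single i 1) i := by
  rw [tangentialTrace, crossGram_comp_right, ← Matrix.mul_assoc,
    Matrix.nonsing_inv_mul _ (isUnit_crossGram_det hA), Matrix.one_mul]
  rfl

lemma tangentialTrace_self {A : EuclideanSpace ℝ (Fin n) →L[ℝ] F}
    (hA : Function.Injective A) : tangentialTrace A A = n := by
  have := tangentialTrace_self_comp hA (ContinuousLinearMap.id ℝ _)
  simpa using this

lemma tangentialTrace_add (A B C : EuclideanSpace ℝ (Fin n) →L[ℝ] F) :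
    tangentialTrace A (B + C) = tangentialTrace A B + tangentialTrace A C := by
  have : crossGram A (B + C) = crossGram A B + crossGram A C := by
    ext i j; simp [crossGram, inner_add_right]
  rw [tangentialTrace, this, Matrix.mul_add, Matrix.trace_add]; rfl

lemma tangentialTrace_smul (A B : EuclideanSpace ℝ (Fin n) →L[ℝ] F) (c : ℝ) :
    tangentialTrace A (c • B) = c * tangentialTrace A B := by
  have : crossGram A (c • B) = c • crossGram A B := by
    ext i j; simp [crossGram, inner_smul_right]
  rw [tangentialTrace, this, Matrix.mul_smul, Matrix.trace_smul]; rfl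

lemma tangentialTrace_zero (A : EuclideanSpace ℝ (Fin n) →L[ℝ] F) :
    tangentialTrace A 0 = 0 := by
  simpa using tangentialTrace_smul A 0 0

/-- The coordinates, with respect to the basis `A eᵢ` of the range of `A`, of the orthogonal
projection of `w` onto that range. -/
def projCoord (A : EuclideanSpace ℝ (Fin n) →L[ℝ] F) (w : F) : EuclideanSpace ℝ (Fin n) :=
  WithLp.toLp 2 ((crossGram A A)⁻¹.mulVec
    fun j => inner ℝ (A (EuclideanSpace.single j 1)) w)

lemma inner_apply_apply (A : EuclideanSpace ℝ (Fin n) →L[ℝ] F) (v : EuclideanSpace ℝ (Fin n))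
    (i : Fin n) :
    inner ℝ (A (EuclideanSpace.single i 1)) (A v) = ((crossGram A A).mulVec v) i := by
  rw [apply_eq_sum_coord A v, inner_sum]
  simp [Matrix.mulVec, dotProduct, crossGram, inner_smul_right, mul_comm]

lemma projCoord_apply_self {A : EuclideanSpace ℝ (Fin n) →L[ℝ] F}
    (hA : Function.Injective A) (v : EuclideanSpace ℝ (Fin n)) : projCoord A (A v) = v := by
  have : (fun j => inner ℝ (A (EuclideanSpace.single j 1)) (A v))
      = (crossGram A A).mulVec v := funext fun j => inner_apply_apply A v j
  rw [projCoord, this, Matrix.mulVec_mulVec,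
    Matrix.nonsing_inv_mul _ (isUnit_crossGram_det hA), Matrix.one_mulVec]

lemma inner_sub_projCoord {A : EuclideanSpace ℝ (Fin n) →L[ℝ] F}
    (hA : Function.Injective A) (w : F) (v : EuclideanSpace ℝ (Fin n)) :
    inner ℝ (A v) (w - A (projCoord A w)) = 0 := by
  rw [apply_eq_sum_coord A v, sum_inner]
  refine Finset.sum_eq_zero fun i _ => ?_
  rw [inner_smul_left, inner_sub_right, inner_apply_apply, projCoord]
  simp only [Matrix.mulVec_mulVec]
  rw [Matrix.mul_nonsing_inv _ (isUnit_crossGram_det hA)]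
  simp

/-- For `B = c ⊗ y` of rank one, with `c` a linear form, the tangential trace pairs `c` with
the coordinates of the tangential part of `y`. -/
lemma tangentialTrace_smulRight {A : EuclideanSpace ℝ (Fin n) →L[ℝ] F}
    (c : EuclideanSpace ℝ (Fin n) →L[ℝ] ℝ) (y : F) :
    tangentialTrace A (c.smulRight y) = c (projCoord A y) := by
  have h : c (projCoord A y) = ∑ k, projCoord A y k * c (EuclideanSpace.single k 1) := by
    rw [apply_eq_sum_coord c]; simp
  rw [h, tangentialTrace, Matrix.trace]
  refine Finset.sum_congr rfl fun k _ => ?_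
  simp only [Matrix.diag_apply, Matrix.mul_apply, crossGram, Matrix.of_apply, projCoord,
    Matrix.mulVec, dotProduct, ContinuousLinearMap.smulRight_apply, inner_smul_right]
  rw [Finset.sum_mul]
  exact Finset.sum_congr rfl fun j _ => by ring

lemma hasDerivAt_det {G : ℝ → Matrix (Fin n) (Fin n) ℝ} {G' : Matrix (Fin n) (Fin n) ℝ} {t : ℝ}
    (hG : ∀ i j, HasDerivAt (fun s => G s i j) (G' i j) t) :
    HasDerivAt (fun s => (G s).det) ((G t).adjugate * G').trace t := by
  have h : HasDerivAt (fun s => (G s).det) (∑ σ : Equiv.Perm (Fin n), (Equiv.Perm.sign σ : ℝ) *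
      ∑ i, (∏ j ∈ Finset.univ.erase i, G t (σ j) j) • G' (σ i) i) t := by
    simp only [Matrix.det_apply']
    exact HasDerivAt.fun_sum fun σ _ =>
      (HasDerivAt.fun_finsetProd fun i _ => hG (σ i) i).const_mul _
  convert! h using 1
  have h2 : ∀ i, ((G t).adjugate * G') i i = ((G t).updateCol i (fun k => G' k i)).det := by
    intro i
    rw [← Matrix.cramer_apply, Matrix.cramer_eq_adjugate_mulVec]
    simp [Matrix.mul_apply, Matrix.mulVec, dotProduct]
  simp only [Matrix.trace, Matrix.diag_apply, h2, Matrix.det_apply', Finset.mul_sum]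
  rw [Finset.sum_comm]
  refine Finset.sum_congr rfl fun σ _ => Finset.sum_congr rfl fun i _ => ?_
  rw [← Finset.mul_prod_erase Finset.univ _ (Finset.mem_univ i), Matrix.updateCol_self,
    smul_eq_mul, mul_comm (G' (σ i) i)]
  congr 2
  refine Finset.prod_congr rfl fun j hj => ?_
  rw [Matrix.updateCol_ne (Finset.ne_of_mem_erase hj)]

/-- Jacobi's formula for the volume element `√(det g)` of a moving linear map. -/
lemma hasDerivAt_sqrt_det_crossGram {A : ℝ → EuclideanSpace ℝ (Fin n) →L[ℝ] F}
    {A' : EuclideanSpace ℝ (Fin n) →L[ℝ] F} {t : ℝ} (hA : HasDerivAt A A' t)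
    (hinj : Function.Injective (A t)) :
    HasDerivAt (fun s => √(crossGram (A s) (A s)).det)
      (√(crossGram (A t) (A t)).det * tangentialTrace (A t) A') t := by
  have hcol : ∀ i, HasDerivAt (fun s => A s (EuclideanSpace.single i 1))
      (A' (EuclideanSpace.single i 1)) t := fun i =>
    HasFDerivAt.comp_hasDerivAt t
      (ContinuousLinearMap.apply ℝ F (EuclideanSpace.single i (1 : ℝ))).hasFDerivAt hA
  have hG : ∀ i j, HasDerivAt (fun s => crossGram (A s) (A s) i j)
      ((crossGram (A t) A' + (crossGram (A t) A').transpose) i j) t := by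
    intro i j
    have := (hcol i).inner ℝ (hcol j)
    convert! this using 1
    simp [crossGram, real_inner_comm]
  have hpos := crossGram_self_det_pos hinj
  have hd := (hasDerivAt_det hG).sqrt hpos.ne'
  convert! hd using 1
  have h1 : (crossGram (A t) (A t)).adjugate
      = (crossGram (A t) (A t)).det • (crossGram (A t) (A t))⁻¹ := by
    rw [Matrix.inv_def, smul_smul, Ring.inverse_eq_inv', mul_inv_cancel₀ hpos.ne', one_smul]
  have h2 : ((crossGram (A t) (A t))⁻¹ * (crossGram (A t) A').transpose).trace
      = tangentialTrace (A t) A' := by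
    rw [← Matrix.trace_transpose, Matrix.transpose_mul, Matrix.transpose_transpose,
      Matrix.transpose_nonsing_inv, crossGram_transpose, Matrix.trace_mul_comm]
    rfl
  rw [h1, Matrix.smul_mul, Matrix.trace_smul, Matrix.mul_add, Matrix.trace_add, h2,
    show ((crossGram (A t) (A t))⁻¹ * crossGram (A t) A').trace = tangentialTrace (A t) A'
      from rfl]
  have hs := Real.mul_self_sqrt hpos.le
  have hsp : 0 < √(crossGram (A t) (A t)).det := Real.sqrt_pos.2 hpos
  field_simp
  simp only [smul_eq_mul]
  rw [pow_two, hs]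
  ring

end LinearAlgebra

/-! ### Smooth dependence of traces and determinants on a parameter -/

section Smoothness

variable {n : ℕ} {F : Type*} [NormedAddCommGroup F] [InnerProductSpace ℝ F]
  {P : Type*} [NormedAddCommGroup P] [NormedSpace ℝ P] {r : WithTop ℕ∞}
  {A B : P → EuclideanSpace ℝ (Fin n) →L[ℝ] F} {w : P → F} {a : P}

lemma contDiffAt_matrix_det {G : P → Matrix (Fin n) (Fin n) ℝ}
    (hG : ∀ i j, ContDiffAt ℝ r (fun z => G z i j) a) : ContDiffAt ℝ r (fun z => (G z).det) a := by
  simp only [Matrix.det_apply']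
  exact ContDiffAt.sum fun σ _ => contDiffAt_const.mul (contDiffAt_prod fun i _ => hG _ _)

lemma contDiffAt_matrix_inv {G : P → Matrix (Fin n) (Fin n) ℝ}
    (hG : ∀ i j, ContDiffAt ℝ r (fun z => G z i j) a) (hdet : (G a).det ≠ 0) (i j : Fin n) :
    ContDiffAt ℝ r (fun z => (G z)⁻¹ i j) a := by
  simp only [Matrix.inv_def, Ring.inverse_eq_inv', Matrix.smul_apply, smul_eq_mul,
    Matrix.adjugate_apply]
  refine ((contDiffAt_matrix_det hG).inv hdet).mul (contDiffAt_matrix_det fun k l => ?_)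
  by_cases hk : k = j
  · subst hk; simpa using contDiffAt_const
  · simpa [Matrix.updateRow_ne hk] using hG k l

lemma contDiffAt_crossGram (hA : ContDiffAt ℝ r A a) (hB : ContDiffAt ℝ r B a) (i j : Fin n) :
    ContDiffAt ℝ r (fun z => crossGram (A z) (B z) i j) a :=
  (hA.clm_apply contDiffAt_const).inner ℝ (hB.clm_apply contDiffAt_const)

lemma contDiffAt_sqrt_det_crossGram (hA : ContDiffAt ℝ r A a) (hinj : Function.Injective (A a)) :
    ContDiffAt ℝ r (fun z => √(crossGram (A z) (A z)).det) a :=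
  (contDiffAt_matrix_det fun i j => contDiffAt_crossGram hA hA i j).sqrt
    (crossGram_self_det_pos hinj).ne'

lemma contDiffAt_projCoord (hA : ContDiffAt ℝ r A a) (hw : ContDiffAt ℝ r w a)
    (hinj : Function.Injective (A a)) : ContDiffAt ℝ r (fun z => projCoord (A z) (w z)) a := by
  rw [contDiffAt_euclidean]
  intro i
  simp only [projCoord, Matrix.mulVec, dotProduct]
  exact ContDiffAt.sum fun j _ => (contDiffAt_matrix_inv (fun k l => contDiffAt_crossGram hA hA k l)
    (crossGram_self_det_pos hinj).ne' i j).mul ((hA.clm_apply contDiffAt_const).inner ℝ hw)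

lemma contDiffAt_tangentialTrace (hA : ContDiffAt ℝ r A a) (hB : ContDiffAt ℝ r B a)
    (hinj : Function.Injective (A a)) :
    ContDiffAt ℝ r (fun z => tangentialTrace (A z) (B z)) a := by
  simp only [tangentialTrace, Matrix.trace, Matrix.diag_apply, Matrix.mul_apply]
  exact ContDiffAt.sum fun i _ => ContDiffAt.sum fun j _ =>
    (contDiffAt_matrix_inv (fun k l => contDiffAt_crossGram hA hA k l)
      (crossGram_self_det_pos hinj).ne' i j).mul (contDiffAt_crossGram hA hB j i)

end Smoothness

/-! ### Differentials in charts -/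

section Charts

variable {n : ℕ} {M : Type*} [TopologicalSpace M] [ChartedSpace (EuclideanSpace ℝ (Fin n)) M]
  {F : Type*} [NormedAddCommGroup F] [NormedSpace ℝ F]
  {e e' : OpenPartialHomeomorph M (EuclideanSpace ℝ (Fin n))}

/-- The differential of a vector valued map at a point of `M`, as a linear map on `ℝⁿ` (which is
the tangent space, identified by the preferred chart). -/
def diff (n : ℕ) {M : Type*} [TopologicalSpace M]
    [ChartedSpace (EuclideanSpace ℝ (Fin n)) M] {F : Type*} [NormedAddCommGroup F] [NormedSpace ℝ F]
    (f : M → F) (q : M) : EuclideanSpace ℝ (Fin n) →L[ℝ] F :=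
  mfderiv (𝓡 n) 𝓘(ℝ, F) f q

/-- The differential of the inverse of the chart `e`. -/
def chartFrame (e : OpenPartialHomeomorph M (EuclideanSpace ℝ (Fin n)))
    (u : EuclideanSpace ℝ (Fin n)) : EuclideanSpace ℝ (Fin n) →L[ℝ] EuclideanSpace ℝ (Fin n) :=
  mfderiv (𝓡 n) (𝓡 n) e.symm u

lemma diff_chartAt_center {f : M → F} {q : M} (hf : MDifferentiableAt (𝓡 n) 𝓘(ℝ, F) f q) :
    diff n f q = fderiv ℝ (f ∘ (chartAt (EuclideanSpace ℝ (Fin n)) q).symm)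
      (chartAt (EuclideanSpace ℝ (Fin n)) q q) := by
  rw [diff, hf.mfderiv]
  simp [writtenInExtChartAt, extChartAt, fderivWithin_univ]
  rfl

lemma diff_add {f g : M → F} {q : M} (hf : MDifferentiableAt (𝓡 n) 𝓘(ℝ, F) f q)
    (hg : MDifferentiableAt (𝓡 n) 𝓘(ℝ, F) g q) :
    diff n (fun z => f z + g z) q = diff n f q + diff n g q :=
  mfderiv_add hf hg

lemma diff_congr {f g : M → F} {q : M} (h : f =ᶠ[𝓝 q] g) : diff n f q = diff n g q :=
  h.mfderiv_eq

lemma diff_comp {G : Type*} [NormedAddCommGroup G] [NormedSpace ℝ G] {f : M → F} {g : F → G}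
    {q : M} (hf : MDifferentiableAt (𝓡 n) 𝓘(ℝ, F) f q) (hg : DifferentiableAt ℝ g (f q)) :
    diff n (fun z => g (f z)) q = fderiv ℝ g (f q) ∘L diff n f q := by
  have := mfderiv_comp q hg.mdifferentiableAt hf
  rw [mfderiv_eq_fderiv] at this
  exact this

variable [IsManifold (𝓡 n) ∞ M]

lemma chartFrame_bijective (he : e ∈ atlas (EuclideanSpace ℝ (Fin n)) M)
    {u : EuclideanSpace ℝ (Fin n)} (hu : u ∈ e.target) :
    Function.Bijective (chartFrame e u) :=
  have : IsManifold (𝓡 n) 1 M := IsManifold.of_le (n := ∞) (by simp)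
  (mdifferentiable_of_mem_atlas (I := 𝓡 n) he).symm.mfderiv_bijective hu

lemma chartFrame_det_ne_zero (he : e ∈ atlas (EuclideanSpace ℝ (Fin n)) M)
    {u : EuclideanSpace ℝ (Fin n)} (hu : u ∈ e.target) : (chartFrame e u).det ≠ 0 := by
  exact (LinearEquiv.isUnit_det'
    (LinearEquiv.ofBijective (chartFrame e u).toLinearMap (chartFrame_bijective he hu))).ne_zero

lemma fderiv_comp_chart_symm (he : e ∈ atlas (EuclideanSpace ℝ (Fin n)) M)
    {u : EuclideanSpace ℝ (Fin n)} (hu : u ∈ e.target) {f : M → F}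
    (hf : MDifferentiableAt (𝓡 n) 𝓘(ℝ, F) f (e.symm u)) :
    fderiv ℝ (f ∘ e.symm) u = diff n f (e.symm u) ∘L chartFrame e u := by
  have : IsManifold (𝓡 n) 1 M := IsManifold.of_le (n := ∞) (by simp)
  have h := mfderiv_comp u hf (mdifferentiableAt_atlas_symm (I := 𝓡 n) he hu)
  rw [← mfderiv_eq_fderiv]
  exact h

lemma contDiffAt_comp_chart_symm (he : e ∈ atlas (EuclideanSpace ℝ (Fin n)) M)
    {u : EuclideanSpace ℝ (Fin n)} (hu : u ∈ e.target) {f : M → F}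
    (hf : ContMDiffAt (𝓡 n) 𝓘(ℝ, F) ∞ f (e.symm u)) : ContDiffAt ℝ ∞ (f ∘ e.symm) u := by
  rw [← contMDiffAt_iff_contDiffAt]
  exact hf.comp u (contMDiffAt_symm_of_mem_maximalAtlas (IsManifold.subset_maximalAtlas he) hu)

lemma differentiableAt_comp_chart_symm (he : e ∈ atlas (EuclideanSpace ℝ (Fin n)) M)
    {u : EuclideanSpace ℝ (Fin n)} (hu : u ∈ e.target) {f : M → F}
    (hf : MDifferentiableAt (𝓡 n) 𝓘(ℝ, F) f (e.symm u)) :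
    DifferentiableAt ℝ (f ∘ e.symm) u := by
  have : IsManifold (𝓡 n) 1 M := IsManifold.of_le (n := ∞) (by simp)
  rw [← mdifferentiableAt_iff_differentiableAt]
  exact hf.comp u (mdifferentiableAt_atlas_symm (I := 𝓡 n) he hu)

lemma contMDiffAt_of_comp_chart_symm (he : e ∈ atlas (EuclideanSpace ℝ (Fin n)) M)
    {q : M} (hq : q ∈ e.source) {f : M → F}
    (hf : ContDiffAt ℝ ∞ (f ∘ e.symm) (e q)) : ContMDiffAt (𝓡 n) 𝓘(ℝ, F) ∞ f q := by
  have h1 := (contMDiffAt_iff_contDiffAt.2 hf).comp q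
    (contMDiffAt_of_mem_maximalAtlas (IsManifold.subset_maximalAtlas he) hq)
  refine h1.congr_of_eventuallyEq ?_
  filter_upwards [e.open_source.mem_nhds hq] with z hz
  simp [e.left_inv hz]

lemma diff_injective_iff (he : e ∈ atlas (EuclideanSpace ℝ (Fin n)) M)
    {u : EuclideanSpace ℝ (Fin n)} (hu : u ∈ e.target) {f : M → F}
    (hf : MDifferentiableAt (𝓡 n) 𝓘(ℝ, F) f (e.symm u)) :
    Function.Injective (fderiv ℝ (f ∘ e.symm) u) ↔ Function.Injective (diff n f (e.symm u)) := by
  rw [fderiv_comp_chart_symm he hu hf, ContinuousLinearMap.coe_comp]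
  exact Function.Injective.of_comp_iff' _ (chartFrame_bijective he hu)

lemma range_fderiv_comp_chart_symm (he : e ∈ atlas (EuclideanSpace ℝ (Fin n)) M)
    {u : EuclideanSpace ℝ (Fin n)} (hu : u ∈ e.target) {f : M → F}
    (hf : MDifferentiableAt (𝓡 n) 𝓘(ℝ, F) f (e.symm u)) :
    LinearMap.range (fderiv ℝ (f ∘ e.symm) u).toLinearMap
      = LinearMap.range (diff n f (e.symm u)).toLinearMap := by
  rw [fderiv_comp_chart_symm he hu hf]
  exact LinearMap.range_comp_of_range_eq_top _
    (LinearMap.range_eq_top.2 (chartFrame_bijective he hu).surjective)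

lemma diff_smul {φ : M → ℝ} {f : M → F} {q : M} (hφ : MDifferentiableAt (𝓡 n) 𝓘(ℝ, ℝ) φ q)
    (hf : MDifferentiableAt (𝓡 n) 𝓘(ℝ, F) f q) :
    diff n (fun z => φ z • f z) q = φ q • diff n f q + (diff n φ q).smulRight (f q) := by
  set e := chartAt (EuclideanSpace ℝ (Fin n)) q with he
  have hq : e.symm (e q) = q := e.left_inv (mem_chart_source _ q)
  have hu : e q ∈ e.target := e.map_source (mem_chart_source _ q)
  have hmem := chart_mem_atlas (EuclideanSpace ℝ (Fin n)) q
  have h1 := differentiableAt_comp_chart_symm hmem hu (f := φ) (by rwa [← he, hq])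
  have h2 := differentiableAt_comp_chart_symm hmem hu (f := f) (by rwa [← he, hq])
  have h3 := differentiableAt_comp_chart_symm hmem hu (f := fun z => φ z • f z)
    (by rw [← he, hq]; exact hφ.smul hf)
  rw [diff_chartAt_center hφ, diff_chartAt_center hf,
    diff_chartAt_center (f := fun z => φ z • f z) (hφ.smul hf)]
  have := fderiv_fun_smul h1 h2
  simp only [Function.comp_apply, ← he, hq] at this
  exact this

end Charts

/-! ### The volume measure -/

section Volume

variable {n p : ℕ} {M : Type*} [TopologicalSpace M] [ChartedSpace (EuclideanSpace ℝ (Fin n)) M]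
  {e e' : OpenPartialHomeomorph M (EuclideanSpace ℝ (Fin n))}
  {X Y : M → EuclideanSpace ℝ (Fin (n + p))}

lemma measure_ext_of_restrict_chart (n : ℕ) {M : Type*} [TopologicalSpace M]
    [ChartedSpace (EuclideanSpace ℝ (Fin n)) M] [MeasurableSpace M] [SecondCountableTopology M]
    {μ ν : Measure M}
    (h : ∀ e ∈ atlas (EuclideanSpace ℝ (Fin n)) M, μ.restrict e.source = ν.restrict e.source) :
    μ = ν := by
  obtain ⟨s, hs, hsu⟩ := TopologicalSpace.countable_cover_nhds
    (fun q : M => chart_source_mem_nhds (EuclideanSpace ℝ (Fin n)) q)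
  exact (Measure.ext_iff_of_biUnion_eq_univ hs hsu).2 fun q _ => h _ (chart_mem_atlas _ q)

lemma gram_eq_crossGram (X : M → EuclideanSpace ℝ (Fin (n + p)))
    (e : OpenPartialHomeomorph M (EuclideanSpace ℝ (Fin n))) (u : EuclideanSpace ℝ (Fin n)) :
    gram X e u = crossGram (fderiv ℝ (X ∘ e.symm) u) (fderiv ℝ (X ∘ e.symm) u) := rfl

/-- The density of the volume measure with respect to Lebesgue measure in the chart `e`. -/
def volumeDensity (X : M → EuclideanSpace ℝ (Fin (n + p)))
    (e : OpenPartialHomeomorph M (EuclideanSpace ℝ (Fin n))) (u : EuclideanSpace ℝ (Fin n)) : ℝ :=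
  √(gram X e u).det

/-- The ratio of the volume elements induced by `Y` and by `X`. -/
def volumeRatio (X Y : M → EuclideanSpace ℝ (Fin (n + p))) (q : M) : ℝ :=
  √(crossGram (diff n Y q) (diff n Y q)).det / √(crossGram (diff n X q) (diff n X q)).det

lemma volumeRatio_nonneg (q : M) : 0 ≤ volumeRatio X Y q := by
  unfold volumeRatio; positivity

lemma volumeDensity_nonneg (u : EuclideanSpace ℝ (Fin n)) : 0 ≤ volumeDensity X e u :=
  Real.sqrt_nonneg _

lemma IsSmoothImmersion.injective_diff (hX : IsSmoothImmersion X) (q : M) :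
    Function.Injective (diff n X q) := hX.injective_mfderiv q

lemma IsSmoothImmersion.mdifferentiableAt (hX : IsSmoothImmersion X) (q : M) :
    MDifferentiableAt (𝓡 n) 𝓘(ℝ, EuclideanSpace ℝ (Fin (n + p))) X q :=
  (hX.smooth q).mdifferentiableAt (by simp)

lemma volumeRatio_self (hX : IsSmoothImmersion X) (q : M) : volumeRatio X X q = 1 :=
  div_self (Real.sqrt_pos.2 (crossGram_self_det_pos (hX.injective_diff q))).ne'

variable [IsManifold (𝓡 n) ∞ M]

lemma IsSmoothImmersion.contDiffAt_comp_chart_symm (hX : IsSmoothImmersion X)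
    (he : e ∈ atlas (EuclideanSpace ℝ (Fin n)) M) {u : EuclideanSpace ℝ (Fin n)}
    (hu : u ∈ e.target) : ContDiffAt ℝ ∞ (X ∘ e.symm) u :=
  SelfShrinker.contDiffAt_comp_chart_symm he hu (hX.smooth _)

lemma IsSmoothImmersion.injective_fderiv (hX : IsSmoothImmersion X)
    (he : e ∈ atlas (EuclideanSpace ℝ (Fin n)) M) {u : EuclideanSpace ℝ (Fin n)}
    (hu : u ∈ e.target) : Function.Injective (fderiv ℝ (X ∘ e.symm) u) :=
  (diff_injective_iff he hu (hX.mdifferentiableAt _)).2 (hX.injective_diff _)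

lemma IsSmoothImmersion.contDiffAt_fderiv (hX : IsSmoothImmersion X)
    (he : e ∈ atlas (EuclideanSpace ℝ (Fin n)) M) {u : EuclideanSpace ℝ (Fin n)}
    (hu : u ∈ e.target) : ContDiffAt ℝ ∞ (fderiv ℝ (X ∘ e.symm)) u :=
  (hX.contDiffAt_comp_chart_symm he hu).fderiv_right (by simp)

lemma volumeDensity_pos (hX : IsSmoothImmersion X)
    (he : e ∈ atlas (EuclideanSpace ℝ (Fin n)) M) {u : EuclideanSpace ℝ (Fin n)}
    (hu : u ∈ e.target) : 0 < volumeDensity X e u :=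
  Real.sqrt_pos.2 (crossGram_self_det_pos (hX.injective_fderiv he hu))

lemma contDiffAt_volumeDensity (hX : IsSmoothImmersion X)
    (he : e ∈ atlas (EuclideanSpace ℝ (Fin n)) M) {u : EuclideanSpace ℝ (Fin n)}
    (hu : u ∈ e.target) : ContDiffAt ℝ ∞ (volumeDensity X e) u :=
  contDiffAt_sqrt_det_crossGram (hX.contDiffAt_fderiv he hu) (hX.injective_fderiv he hu)

lemma continuousOn_volumeDensity (hX : IsSmoothImmersion X)
    (he : e ∈ atlas (EuclideanSpace ℝ (Fin n)) M) : ContinuousOn (volumeDensity X e) e.target :=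
  fun _ hu => (contDiffAt_volumeDensity hX he hu).continuousAt.continuousWithinAt

lemma volumeDensity_eq_mul_of_mem (hX : IsSmoothImmersion X)
    (he : e ∈ atlas (EuclideanSpace ℝ (Fin n)) M) (he' : e' ∈ atlas (EuclideanSpace ℝ (Fin n)) M)
    {u : EuclideanSpace ℝ (Fin n)} (hu : u ∈ e.target) (hu' : e.symm u ∈ e'.source) :
    DifferentiableAt ℝ (e' ∘ e.symm) u ∧
    volumeDensity X e u
      = |(fderiv ℝ (e' ∘ e.symm) u).det| * volumeDensity X e' (e' (e.symm u)) := by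
  have : IsManifold (𝓡 n) 1 M := IsManifold.of_le (n := ∞) (by simp)
  have hd : DifferentiableAt ℝ (e' ∘ e.symm) u := differentiableAt_comp_chart_symm he hu
    (mdifferentiableAt_atlas (I := 𝓡 n) he' hu')
  refine ⟨hd, ?_⟩
  have hu2 : e' (e.symm u) ∈ e'.target := e'.map_source hu'
  have h1 : X ∘ e.symm =ᶠ[𝓝 u] (X ∘ e'.symm) ∘ (e' ∘ e.symm) := by
    filter_upwards [(e.continuousAt_symm hu).preimage_mem_nhds (e'.open_source.mem_nhds hu')]
      with v hv
    simp [e'.left_inv hv]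
  have h2 : fderiv ℝ (X ∘ e.symm) u
      = fderiv ℝ (X ∘ e'.symm) (e' (e.symm u)) ∘L fderiv ℝ (e' ∘ e.symm) u := by
    rw [h1.fderiv_eq]
    exact fderiv_comp u ((hX.contDiffAt_comp_chart_symm he' hu2).differentiableAt (by simp)) hd
  rw [volumeDensity, gram_eq_crossGram, h2, sqrt_det_crossGram_comp]
  rfl

lemma volumeDensity_eq_volumeRatio_mul (hX : IsSmoothImmersion X) (hY : IsSmoothImmersion Y)
    (he : e ∈ atlas (EuclideanSpace ℝ (Fin n)) M) {u : EuclideanSpace ℝ (Fin n)}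
    (hu : u ∈ e.target) :
    volumeDensity Y e u = volumeDensity X e u * volumeRatio X Y (e.symm u) := by
  rw [volumeDensity, volumeDensity, gram_eq_crossGram, gram_eq_crossGram,
    fderiv_comp_chart_symm he hu (hX.mdifferentiableAt _),
    fderiv_comp_chart_symm he hu (hY.mdifferentiableAt _), sqrt_det_crossGram_comp,
    sqrt_det_crossGram_comp, volumeRatio]
  have := Real.sqrt_pos.2 (crossGram_self_det_pos (hX.injective_diff (e.symm u)))
  field_simp

lemma volumeRatio_comp_chart_symm (hX : IsSmoothImmersion X) (hY : IsSmoothImmersion Y)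
    (he : e ∈ atlas (EuclideanSpace ℝ (Fin n)) M) {u : EuclideanSpace ℝ (Fin n)}
    (hu : u ∈ e.target) :
    volumeRatio X Y (e.symm u) = volumeDensity Y e u / volumeDensity X e u := by
  rw [volumeDensity_eq_volumeRatio_mul hX hY he hu,
    mul_div_cancel_left₀ _ (volumeDensity_pos hX he hu).ne']

lemma continuous_volumeRatio (hX : IsSmoothImmersion X) (hY : IsSmoothImmersion Y) :
    Continuous (volumeRatio X Y) := by
  rw [continuous_iff_continuousAt]
  intro q
  have he := chart_mem_atlas (EuclideanSpace ℝ (Fin n)) q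
  have hq := mem_chart_source (EuclideanSpace ℝ (Fin n)) q
  have hu := (chartAt (EuclideanSpace ℝ (Fin n)) q).map_source hq
  refine ContMDiffAt.continuousAt (I := 𝓡 n) (I' := 𝓘(ℝ, ℝ)) (n := ∞)
    (contMDiffAt_of_comp_chart_symm he hq ?_)
  refine ((contDiffAt_volumeDensity hY he hu).div (contDiffAt_volumeDensity hX he hu)
    (volumeDensity_pos hX he hu).ne').congr_of_eventuallyEq ?_
  filter_upwards [(chartAt (EuclideanSpace ℝ (Fin n)) q).open_target.mem_nhds hu] with v hv
  exact volumeRatio_comp_chart_symm hX hY he hv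

variable [MeasurableSpace M] [BorelSpace M]

lemma aemeasurable_chart_symm (e : OpenPartialHomeomorph M (EuclideanSpace ℝ (Fin n))) :
    AEMeasurable e.symm ((volume : Measure (EuclideanSpace ℝ (Fin n))).restrict e.target) :=
  e.continuousOn_symm.aemeasurable e.open_target.measurableSet

lemma aemeasurable_volumeDensity (hX : IsSmoothImmersion X)
    (he : e ∈ atlas (EuclideanSpace ℝ (Fin n)) M) :
    AEMeasurable (fun u => ENNReal.ofReal (volumeDensity X e u))
      ((volume : Measure (EuclideanSpace ℝ (Fin n))).restrict e.target) :=
  ((continuousOn_volumeDensity hX he).aemeasurable e.open_target.measurableSet).ennreal_ofReal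

lemma lintegral_chartVolume (hX : IsSmoothImmersion X)
    (he : e ∈ atlas (EuclideanSpace ℝ (Fin n)) M) {f : M → ENNReal} (hf : Measurable f) :
    ∫⁻ q, f q ∂(chartVolume X e)
      = ∫⁻ u in e.target, ENNReal.ofReal (volumeDensity X e u) * f (e.symm u) := by
  have h := aemeasurable_chart_symm e
  rw [chartVolume,
    lintegral_map' hf.aemeasurable (h.mono_ac (withDensity_absolutelyContinuous _ _))]
  exact lintegral_withDensity_eq_lintegral_mul₀ (aemeasurable_volumeDensity hX he)
      (hf.comp_aemeasurable h)

lemma measurableSet_chart_preimage (e : OpenPartialHomeomorph M (EuclideanSpace ℝ (Fin n)))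
    {A : Set M} (hA : MeasurableSet A) : MeasurableSet (e.target ∩ e.symm ⁻¹' A) := by
  have h : Measurable (e.target.domRestrict e.symm) := e.continuousOn_symm.domRestrict.measurable
  have := MeasurableSet.subtype_image e.open_target.measurableSet (h hA)
  convert! this using 1
  ext u
  simp [and_comm]

lemma chartVolume_apply (hX : IsSmoothImmersion X)
    (he : e ∈ atlas (EuclideanSpace ℝ (Fin n)) M) {A : Set M} (hA : MeasurableSet A) :
    chartVolume X e A
      = ∫⁻ u in e.target ∩ e.symm ⁻¹' A, ENNReal.ofReal (volumeDensity X e u) := by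
  rw [← lintegral_indicator_one hA, lintegral_chartVolume hX he (measurable_one.indicator hA),
    ← lintegral_indicator (measurableSet_chart_preimage e hA),
    ← lintegral_indicator e.open_target.measurableSet]
  refine lintegral_congr fun u => ?_
  by_cases h1 : u ∈ e.target <;> by_cases h2 : e.symm u ∈ A <;> simp [h1, h2]

lemma chartVolume_restrict_comm (hX : IsSmoothImmersion X)
    (he : e ∈ atlas (EuclideanSpace ℝ (Fin n)) M)
    (he' : e' ∈ atlas (EuclideanSpace ℝ (Fin n)) M) :
    (chartVolume X e').restrict e.source = (chartVolume X e).restrict e'.source := by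
  ext A hA
  have hA1 := hA.inter e.open_source.measurableSet
  have hA2 := hA.inter e'.open_source.measurableSet
  rw [Measure.restrict_apply hA, Measure.restrict_apply hA, chartVolume_apply hX he' hA1,
    chartVolume_apply hX he hA2]
  set S := e.target ∩ e.symm ⁻¹' (A ∩ e'.source) with hS
  have himage : (e' ∘ e.symm) '' S = e'.target ∩ e'.symm ⁻¹' (A ∩ e.source) := by
    ext v
    constructor
    · rintro ⟨u, ⟨hu, huA, hu'⟩, rfl⟩
      refine ⟨e'.map_source hu', ?_⟩
      simp only [Function.comp_apply, mem_preimage, e'.left_inv hu']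
      exact ⟨huA, e.map_target hu⟩
    · rintro ⟨hv, hvA, hv'⟩
      refine ⟨e (e'.symm v), ⟨e.map_source hv', ?_⟩, ?_⟩
      · simp only [mem_preimage, e.left_inv hv']
        exact ⟨hvA, e'.map_target hv⟩
      · simp [e.left_inv hv', e'.right_inv hv]
  have hinj : InjOn (e' ∘ e.symm) S := by
    rintro u ⟨hu, -, hu'⟩ v ⟨hv, -, hv'⟩ huv
    exact e.symm.injOn hu hv (e'.injOn hu' hv' huv)
  rw [← himage, lintegral_image_eq_lintegral_abs_det_fderiv_mul volume
    (measurableSet_chart_preimage e hA2) (fun u hu =>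
      ((volumeDensity_eq_mul_of_mem hX he he' hu.1 hu.2.2).1.hasFDerivAt.hasFDerivWithinAt)) hinj]
  refine setLIntegral_congr_fun (measurableSet_chart_preimage e hA2) fun u hu => ?_
  rw [(volumeDensity_eq_mul_of_mem hX he he' hu.1 hu.2.2).2, ENNReal.ofReal_mul (abs_nonneg _)]
  rfl

lemma chartVolume_restrict_source (hX : IsSmoothImmersion X)
    (he : e ∈ atlas (EuclideanSpace ℝ (Fin n)) M) :
    (chartVolume X e).restrict e.source = chartVolume X e := by
  ext A hA
  rw [Measure.restrict_apply hA, chartVolume_apply hX he hA,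
    chartVolume_apply hX he (hA.inter e.open_source.measurableSet)]
  congr 2
  ext u
  simp only [mem_inter_iff, mem_preimage]
  exact ⟨fun h => ⟨h.1, h.2.1⟩, fun h => ⟨h.1, h.2, e.map_target h.1⟩⟩

/-- The volume measure is `√(det g) du` in every chart. -/
lemma volumeMeasure_restrict_source (hX : IsSmoothImmersion X)
    (he : e ∈ atlas (EuclideanSpace ℝ (Fin n)) M) :
    (volumeMeasure X).restrict e.source = chartVolume X e := by
  refine le_antisymm ?_ ?_
  · -- all the chart measures lie below the measure which is `chartVolume X e` on the domain
    -- of `e` and infinite outside.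
    have hle : volumeMeasure X ≤ chartVolume X e + (⊤ : Measure M).restrict e.sourceᶜ := by
      refine iSup₂_le fun e' he' => ?_
      have h1 := Measure.restrict_add_restrict_compl (μ := chartVolume X e')
        e.open_source.measurableSet
      rw [← h1, chartVolume_restrict_comm hX he he']
      exact add_le_add Measure.restrict_le_self (Measure.restrict_mono le_rfl le_top)
    refine (Measure.restrict_mono le_rfl hle).trans ?_
    rw [Measure.restrict_add, Measure.restrict_restrict e.open_source.measurableSet]
    simp [Measure.restrict_le_self]
  · rw [← chartVolume_restrict_source hX he]
    exact Measure.restrict_mono le_rfl (le_iSup₂_of_le e he le_rfl)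

lemma volumeMeasure_eq_withDensity [SecondCountableTopology M] (hX : IsSmoothImmersion X)
    (hY : IsSmoothImmersion Y) :
    volumeMeasure Y
      = (volumeMeasure X).withDensity (fun q => ENNReal.ofReal (volumeRatio X Y q)) := by
  have hm : Measurable fun q => ENNReal.ofReal (volumeRatio X Y q) :=
    (continuous_volumeRatio hX hY).measurable.ennreal_ofReal
  refine measure_ext_of_restrict_chart n fun e he => ?_
  rw [restrict_withDensity e.open_source.measurableSet, volumeMeasure_restrict_source hX he,
    volumeMeasure_restrict_source hY he]
  ext A hA
  rw [withDensity_apply _ hA, ← lintegral_indicator hA,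
    lintegral_chartVolume hX he (hm.indicator hA), chartVolume_apply hY he hA,
    ← lintegral_indicator (measurableSet_chart_preimage e hA),
    ← lintegral_indicator e.open_target.measurableSet]
  refine lintegral_congr fun u => ?_
  by_cases h1 : u ∈ e.target <;> by_cases h2 : e.symm u ∈ A <;>
    simp [h1, h2, volumeDensity_eq_volumeRatio_mul hX hY he, volumeDensity_nonneg,
      ENNReal.ofReal_mul]

/-- Integrals of functions supported in the domain of a chart, in coordinates. -/
lemma integral_volumeMeasure_chart (hX : IsSmoothImmersion X)
    (he : e ∈ atlas (EuclideanSpace ℝ (Fin n)) M) {f : M → ℝ} (hf : Measurable f)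
    (hsupp : ∀ q ∉ e.source, f q = 0) :
    ∫ q, f q ∂(volumeMeasure X) = ∫ u in e.target, volumeDensity X e u * f (e.symm u) := by
  have h := aemeasurable_chart_symm e
  rw [← setIntegral_eq_integral_of_forall_compl_eq_zero (s := e.source) hsupp,
    volumeMeasure_restrict_source hX he, chartVolume,
    integral_map (h.mono_ac (withDensity_absolutelyContinuous _ _)) hf.aestronglyMeasurable]
  have := integral_withDensity_eq_integral_toReal_smul₀ (aemeasurable_volumeDensity hX he)
    (Eventually.of_forall fun _ => ENNReal.ofReal_lt_top) (fun u => f (e.symm u))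
  refine this.trans (integral_congr_ae (Eventually.of_forall fun u => ?_))
  simp [ENNReal.toReal_ofReal (volumeDensity_nonneg _)]

lemma isLocallyFiniteMeasure_volumeMeasure (hX : IsSmoothImmersion X) :
    IsLocallyFiniteMeasure (volumeMeasure X) := by
  refine ⟨fun q => ?_⟩
  set e := chartAt (EuclideanSpace ℝ (Fin n)) q with he_def
  have he : e ∈ atlas (EuclideanSpace ℝ (Fin n)) M := chart_mem_atlas _ q
  have hq : q ∈ e.source := mem_chart_source _ q
  obtain ⟨r, hr, hrt⟩ := Metric.nhds_basis_closedBall.mem_iff.1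
    (e.open_target.mem_nhds (e.map_source hq))
  set U := e.source ∩ e ⁻¹' Metric.ball (e q) r
  have hU : IsOpen U := e.isOpen_inter_preimage Metric.isOpen_ball
  refine ⟨U, hU.mem_nhds ⟨hq, Metric.mem_ball_self hr⟩, ?_⟩
  have h1 : volumeMeasure X U = chartVolume X e U := by
    rw [← volumeMeasure_restrict_source hX he, Measure.restrict_apply hU.measurableSet,
      inter_eq_left.2 inter_subset_left]
  rw [h1, chartVolume_apply hX he hU.measurableSet]
  have hsub : e.target ∩ e.symm ⁻¹' U ⊆ Metric.closedBall (e q) r := by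
    rintro u ⟨hu, -, hu2⟩
    rw [mem_preimage, e.right_inv hu] at hu2
    exact Metric.ball_subset_closedBall hu2
  refine (lintegral_mono_set hsub).trans_lt ?_
  have hc : ContinuousOn (volumeDensity X e) (Metric.closedBall (e q) r) :=
    (continuousOn_volumeDensity hX he).mono hrt
  have := (hc.integrableOn_compact (μ := volume) (isCompact_closedBall _ _)).lintegral_lt_top
  exact this

lemma volumeMeasure_pos_of_isOpen (hX : IsSmoothImmersion X) {U : Set M} (hU : IsOpen U)
    (hne : U.Nonempty) : volumeMeasure X U ≠ 0 := by
  obtain ⟨q, hqU⟩ := hne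
  set e := chartAt (EuclideanSpace ℝ (Fin n)) q with he_def
  have he : e ∈ atlas (EuclideanSpace ℝ (Fin n)) M := chart_mem_atlas _ q
  have hq : q ∈ e.source := mem_chart_source _ q
  intro h0
  have h1 : chartVolume X e U = 0 := by
    rw [← volumeMeasure_restrict_source hX he]
    exact le_antisymm ((Measure.restrict_apply_le _ _).trans h0.le) zero_le
  rw [chartVolume_apply hX he hU.measurableSet] at h1
  have hS : IsOpen (e.target ∩ e.symm ⁻¹' U) := e.isOpen_inter_preimage_symm hU
  have h2 := (lintegral_eq_zero_iff' ((aemeasurable_volumeDensity hX he).mono_set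
    inter_subset_left)).1 h1
  rw [EventuallyEq, ae_restrict_iff' hS.measurableSet] at h2
  have h3 : volume (e.target ∩ e.symm ⁻¹' U) = 0 := by
    refine measure_mono_null (fun u hu => ?_) h2
    simpa [hu.1] using ⟨hu.2, volumeDensity_pos hX he hu.1⟩
  exact (hS.measure_pos volume
    ⟨e q, e.map_source hq, by simpa [e.left_inv hq] using hqU⟩).ne' h3

end Volume

/-! ### Tangential divergence and mean curvature -/

section Divergence

variable {n p : ℕ} {M : Type*} [TopologicalSpace M] [ChartedSpace (EuclideanSpace ℝ (Fin n)) M]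
  {e : OpenPartialHomeomorph M (EuclideanSpace ℝ (Fin n))}
  {X Z W : M → EuclideanSpace ℝ (Fin (n + p))} {q : M}

/-- The tangential divergence `∑ gⁱʲ ⟨∂ᵢ X, ∂ⱼ Z⟩` of a vector field `Z` along `X`, which need not
be tangent to `M`. -/
def tangentialDivergence (X Z : M → EuclideanSpace ℝ (Fin (n + p))) (q : M) : ℝ :=
  tangentialTrace (diff n X q) (diff n Z q)

lemma normalPart_eq_of_range {A : EuclideanSpace ℝ (Fin n) →L[ℝ] EuclideanSpace ℝ (Fin (n + p))}
    (hA : Function.Injective A) (hr : tangentSpan X q = LinearMap.range A.toLinearMap)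
    (w : EuclideanSpace ℝ (Fin (n + p))) : normalPart X q w = w - A (projCoord A w) := by
  have h : (tangentSpan X q).starProjection w = A (projCoord A w) := by
    refine Submodule.eq_starProjection_of_mem_orthogonal (by rw [hr]; exact ⟨_, rfl⟩) ?_
    rw [hr, Submodule.mem_orthogonal]
    rintro _ ⟨v, rfl⟩
    exact inner_sub_projCoord hA w v
  rw [normalPart, Submodule.starProjection_orthogonal', sub_apply, h]
  rfl

lemma normalPart_eq (hX : IsSmoothImmersion X) (w : EuclideanSpace ℝ (Fin (n + p))) :
    normalPart X q w = w - diff n X q (projCoord (diff n X q) w) :=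
  normalPart_eq_of_range (hX.injective_diff q) rfl w

lemma normalPart_mem (w : EuclideanSpace ℝ (Fin (n + p))) :
    normalPart X q w ∈ (tangentSpan X q)ᗮ :=
  Submodule.starProjection_apply_mem _ _

lemma sub_normalPart_mem (w : EuclideanSpace ℝ (Fin (n + p))) :
    w - normalPart X q w ∈ tangentSpan X q := by
  rw [normalPart, Submodule.starProjection_orthogonal', sub_apply]
  simp [Submodule.starProjection_apply_mem]

lemma inner_normalPart_left {w z : EuclideanSpace ℝ (Fin (n + p))}
    (hz : z ∈ (tangentSpan X q)ᗮ) : inner ℝ (normalPart X q w) z = inner ℝ w z := by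
  have := Submodule.inner_right_of_mem_orthogonal (sub_normalPart_mem (X := X) (q := q) w) hz
  rw [inner_sub_left] at this
  linarith

lemma norm_sub_normalPart_le (w : EuclideanSpace ℝ (Fin (n + p))) :
    ‖w - normalPart X q w‖ ≤ ‖w‖ := by
  have : w - normalPart X q w = (tangentSpan X q).starProjection w := by
    rw [normalPart, Submodule.starProjection_orthogonal', sub_apply]
    simp
  rw [this]
  exact Submodule.norm_starProjection_apply_le _ _

variable [IsManifold (𝓡 n) ∞ M]

lemma tangentialDivergence_chart (hX : IsSmoothImmersion X)
    (he : e ∈ atlas (EuclideanSpace ℝ (Fin n)) M) {u : EuclideanSpace ℝ (Fin n)}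
    (hu : u ∈ e.target)
    (hZ : MDifferentiableAt (𝓡 n) 𝓘(ℝ, EuclideanSpace ℝ (Fin (n + p))) Z (e.symm u)) :
    tangentialDivergence X Z (e.symm u)
      = tangentialTrace (fderiv ℝ (X ∘ e.symm) u) (fderiv ℝ (Z ∘ e.symm) u) := by
  rw [fderiv_comp_chart_symm he hu (hX.mdifferentiableAt _), fderiv_comp_chart_symm he hu hZ,
    tangentialTrace_comp _ _ _ (chartFrame_det_ne_zero he hu), tangentialDivergence]

lemma tangentSpan_chart (hX : IsSmoothImmersion X)
    (he : e ∈ atlas (EuclideanSpace ℝ (Fin n)) M) {u : EuclideanSpace ℝ (Fin n)}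
    (hu : u ∈ e.target) :
    tangentSpan X (e.symm u) = LinearMap.range (fderiv ℝ (X ∘ e.symm) u).toLinearMap :=
  (range_fderiv_comp_chart_symm he hu (hX.mdifferentiableAt _)).symm

lemma normalPart_chart (hX : IsSmoothImmersion X)
    (he : e ∈ atlas (EuclideanSpace ℝ (Fin n)) M) {u : EuclideanSpace ℝ (Fin n)}
    (hu : u ∈ e.target) (w : EuclideanSpace ℝ (Fin (n + p))) :
    normalPart X (e.symm u) w
      = w - fderiv ℝ (X ∘ e.symm) u (projCoord (fderiv ℝ (X ∘ e.symm) u) w) :=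
  normalPart_eq_of_range (hX.injective_fderiv he hu) (tangentSpan_chart hX he hu) w

lemma contMDiffAt_normalPart (hX : IsSmoothImmersion X)
    (hZ : ContMDiffAt (𝓡 n) 𝓘(ℝ, EuclideanSpace ℝ (Fin (n + p))) ∞ Z q) :
    ContMDiffAt (𝓡 n) 𝓘(ℝ, EuclideanSpace ℝ (Fin (n + p))) ∞
      (fun z => normalPart X z (Z z)) q := by
  set e := chartAt (EuclideanSpace ℝ (Fin n)) q with he_def
  have he : e ∈ atlas (EuclideanSpace ℝ (Fin n)) M := chart_mem_atlas _ q
  have hq : q ∈ e.source := mem_chart_source _ q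
  have hu := e.map_source hq
  refine contMDiffAt_of_comp_chart_symm he hq ?_
  have hZ' : ContDiffAt ℝ ∞ (Z ∘ e.symm) (e q) :=
    contDiffAt_comp_chart_symm he hu (by rwa [e.left_inv hq])
  have hA := hX.contDiffAt_fderiv he hu
  refine (hZ'.sub (hA.clm_apply (contDiffAt_projCoord hA hZ'
    (hX.injective_fderiv he hu)))).congr_of_eventuallyEq ?_
  filter_upwards [e.open_target.mem_nhds hu] with v hv
  exact normalPart_chart hX he hv _

/-- The tangential divergence of a normal vector field `Z` is `-⟨H, Z⟩`. -/
lemma tangentialDivergence_of_normal (hX : IsSmoothImmersion X)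
    (hZ : MDifferentiableAt (𝓡 n) 𝓘(ℝ, EuclideanSpace ℝ (Fin (n + p))) Z q)
    (hn : ∀ᶠ z in 𝓝 q, Z z ∈ (tangentSpan X z)ᗮ) :
    tangentialDivergence X Z q = -inner ℝ (meanCurvature X q) (Z q) := by
  set e := chartAt (EuclideanSpace ℝ (Fin n)) q with he_def
  have he : e ∈ atlas (EuclideanSpace ℝ (Fin n)) M := chart_mem_atlas _ q
  have hq : q ∈ e.source := mem_chart_source _ q
  have hu := e.map_source hq
  have hqu : e.symm (e q) = q := e.left_inv hq
  have hZ' : MDifferentiableAt (𝓡 n) 𝓘(ℝ, EuclideanSpace ℝ (Fin (n + p))) Z (e.symm (e q)) := by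
    rwa [hqu]
  have hdZ := differentiableAt_comp_chart_symm he hu hZ'
  have hdA : DifferentiableAt ℝ (fderiv ℝ (X ∘ e.symm)) (e q) :=
    (hX.contDiffAt_fderiv he hu).differentiableAt (by simp)
  -- differentiate `⟨∂ⱼ X, Z⟩ = 0` in the direction `eᵢ`
  have key : ∀ i j, inner ℝ (fderiv ℝ (X ∘ e.symm) (e q) (EuclideanSpace.single j 1))
      (fderiv ℝ (Z ∘ e.symm) (e q) (EuclideanSpace.single i 1))
      = -inner ℝ (partialDeriv₂ X e (e q) i j) (Z q) := by
    intro i j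
    have h0 : (fun v => inner ℝ (fderiv ℝ (X ∘ e.symm) v (EuclideanSpace.single j 1))
        ((Z ∘ e.symm) v)) =ᶠ[𝓝 (e q)] fun _ => (0 : ℝ) := by
      have hc : Tendsto e.symm (𝓝 (e q)) (𝓝 q) := by
        have := (e.continuousAt_symm hu).tendsto
        rwa [hqu] at this
      filter_upwards [hc hn, e.open_target.mem_nhds hu] with v hv hvt
      rw [mem_preimage] at hv
      refine Submodule.inner_right_of_mem_orthogonal ?_ hv
      rw [tangentSpan_chart hX he hvt]
      exact ⟨_, rfl⟩
    have h1 := h0.fderiv_eq (𝕜 := ℝ)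
    have h2 : DifferentiableAt ℝ (fun v => fderiv ℝ (X ∘ e.symm) v
        (EuclideanSpace.single j (1 : ℝ))) (e q) := hdA.clm_apply (differentiableAt_const _)
    have h3 := fderiv_inner_apply ℝ h2 hdZ (EuclideanSpace.single i (1 : ℝ))
    rw [h1] at h3
    rw [fderiv_clm_apply hdA (differentiableAt_const _)] at h3
    simp [hqu] at h3
    rw [partialDeriv₂, eq_neg_iff_add_eq_zero]
    exact h3.symm
  have h4 : tangentialDivergence X Z q
      = tangentialTrace (fderiv ℝ (X ∘ e.symm) (e q)) (fderiv ℝ (Z ∘ e.symm) (e q)) := by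
    rw [← tangentialDivergence_chart hX he hu hZ', hqu]
  rw [h4, tangentialTrace, meanCurvature, Matrix.trace]
  simp only [sum_inner, inner_smul_left, ← Finset.sum_neg_distrib, Matrix.diag_apply,
    Matrix.mul_apply]
  refine Finset.sum_congr rfl fun i _ => Finset.sum_congr rfl fun j _ => ?_
  rw [inner_normalPart_left hn.self_of_nhds]
  simp only [crossGram, Matrix.of_apply, key i j]
  simp [gram_eq_crossGram, crossGram, ← he_def]

lemma tangentialDivergence_add
    (hZ : MDifferentiableAt (𝓡 n) 𝓘(ℝ, EuclideanSpace ℝ (Fin (n + p))) Z q)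
    (hW : MDifferentiableAt (𝓡 n) 𝓘(ℝ, EuclideanSpace ℝ (Fin (n + p))) W q) :
    tangentialDivergence X (fun z => Z z + W z) q
      = tangentialDivergence X Z q + tangentialDivergence X W q := by
  rw [tangentialDivergence, diff_add hZ hW, tangentialTrace_add]
  rfl

lemma contMDiffAt_tangentialDivergence (hX : IsSmoothImmersion X)
    (hZ : ContMDiffAt (𝓡 n) 𝓘(ℝ, EuclideanSpace ℝ (Fin (n + p))) ∞ Z q) :
    ContMDiffAt (𝓡 n) 𝓘(ℝ, ℝ) ∞ (tangentialDivergence X Z) q := by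
  have : IsManifold (𝓡 n) 1 M := IsManifold.of_le (n := ∞) (by simp)
  set e := chartAt (EuclideanSpace ℝ (Fin n)) q with he_def
  have he : e ∈ atlas (EuclideanSpace ℝ (Fin n)) M := chart_mem_atlas _ q
  have hq : q ∈ e.source := mem_chart_source _ q
  have hu := e.map_source hq
  have hqu : e.symm (e q) = q := e.left_inv hq
  refine contMDiffAt_of_comp_chart_symm he hq ?_
  have hZ' : ContDiffAt ℝ ∞ (Z ∘ e.symm) (e q) :=
    contDiffAt_comp_chart_symm he hu (by rwa [hqu])
  have hc : Tendsto e.symm (𝓝 (e q)) (𝓝 q) := by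
    have := (e.continuousAt_symm hu).tendsto
    rwa [hqu] at this
  refine (contDiffAt_tangentialTrace (hX.contDiffAt_fderiv he hu)
    (hZ'.fderiv_right (m := ∞) (by simp)) (hX.injective_fderiv he hu)).congr_of_eventuallyEq ?_
  filter_upwards [hc (contMDiffAt_iff_contMDiffAt_nhds (by simp) |>.1
      (hZ.of_le (m := 1) (by simp))),
    e.open_target.mem_nhds hu] with v hv hvt
  exact tangentialDivergence_chart hX he hvt (ContMDiffAt.mdifferentiableAt hv one_ne_zero)

end Divergence

/-! ### The induced distance, the Hopf–Rinow theorem and cutoff functions -/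

section Distance

variable {n p : ℕ} {M : Type*} [TopologicalSpace M] [ChartedSpace (EuclideanSpace ℝ (Fin n)) M]
  {e : OpenPartialHomeomorph M (EuclideanSpace ℝ (Fin n))}
  {X : M → EuclideanSpace ℝ (Fin (n + p))}

/-- The length of tangent vectors in the induced metric. -/
@[reducible] def inducedENorm (X : M → EuclideanSpace ℝ (Fin (n + p))) (q : M) :
    ENorm (TangentSpace (𝓡 n) q) :=
  ⟨fun v => ‖diff n X q v‖ₑ⟩

/-- The length of the curve `X ∘ γ` between the times `a` and `b`. -/
def inducedLength (X : M → EuclideanSpace ℝ (Fin (n + p))) (γ : ℝ → M) (a b : ℝ) : ENNReal :=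
  letI := inducedENorm X
  Manifold.pathELength (𝓡 n) γ a b

lemma inducedENorm_smulClass (X : M → EuclideanSpace ℝ (Fin (n + p))) (q : M) :
    letI := inducedENorm X
    ENormSMulClass ℝ (TangentSpace (𝓡 n) q) := by
  let := inducedENorm X
  refine ⟨fun r v => ?_⟩
  change ‖diff n X q (r • v)‖ₑ = ‖r‖ₑ * ‖diff n X q v‖ₑ
  rw [← enorm_smul]
  congr 1
  exact map_smul (diff n X q) r v

lemma derivWithin_comp_eq (hX : IsSmoothImmersion X) {γ : ℝ → M} {s : Set ℝ} {t : ℝ}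
    (hs : UniqueDiffWithinAt ℝ s t)
    (hγ : MDifferentiableWithinAt 𝓘(ℝ, ℝ) (𝓡 n) γ s t) :
    derivWithin (X ∘ γ) s t = diff n X (γ t) (mfderivWithin 𝓘(ℝ, ℝ) (𝓡 n) γ s t (1 : ℝ)) := by
  have h := mfderiv_comp_mfderivWithin (I := 𝓘(ℝ, ℝ)) (I' := 𝓡 n) t
    (hX.mdifferentiableAt (γ t)) hγ hs.uniqueMDiffWithinAt
  rw [mfderivWithin_eq_fderivWithin] at h
  rw [← fderivWithin_derivWithin, h]
  rfl

lemma inducedLength_self (X : M → EuclideanSpace ℝ (Fin (n + p))) (γ : ℝ → M) (a : ℝ) :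
    inducedLength X γ a a = 0 := by
  let := inducedENorm X
  exact Manifold.pathELength_self

lemma inducedLength_eq (hX : IsSmoothImmersion X) {γ : ℝ → M} {a b a' b' : ℝ} (ha : a' ≤ a)
    (hb : b ≤ b') (hab : a < b) (hγ : ContMDiffOn 𝓘(ℝ, ℝ) (𝓡 n) 1 γ (Icc a' b')) :
    inducedLength X γ a b = ∫⁻ t in Icc a b, ‖derivWithin (X ∘ γ) (Icc a' b') t‖ₑ := by
  let := inducedENorm X
  have hab' : a' < b' := by linarith
  rw [inducedLength, Manifold.pathELength_eq_lintegral_mfderiv_Ioo,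
    ← restrict_Ioo_eq_restrict_Icc]
  refine setLIntegral_congr_fun measurableSet_Ioo fun t ht => ?_
  have hn : Icc a' b' ∈ 𝓝 t := Icc_mem_nhds (by linarith [ht.1]) (by linarith [ht.2])
  have ht' : t ∈ Icc a' b' := mem_of_mem_nhds hn
  rw [derivWithin_comp_eq hX (uniqueDiffOn_Icc hab' t ht')
    ((hγ t ht').mdifferentiableWithinAt one_ne_zero), mfderivWithin_of_mem_nhds hn]
  rfl

lemma inducedEDist_eq_riemannianEDist (hX : IsSmoothImmersion X) (q q' : M) :
    letI := inducedENorm X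
    inducedEDist X q q' = Manifold.riemannianEDist (𝓡 n) q q' := by
  let := inducedENorm X
  have := inducedENorm_smulClass X
  refine le_antisymm (le_of_forall_gt fun r hr => ?_) ?_
  · obtain ⟨γ, h0, h1, hγ, hlen⟩ := Manifold.exists_lt_of_riemannianEDist_lt hr
    refine lt_of_le_of_lt (iInf_le_of_le γ (iInf_le_of_le hγ (iInf_le_of_le h0 (iInf_le _ h1)))) ?_
    rw [← inducedLength_eq hX le_rfl le_rfl zero_lt_one hγ]
    exact hlen
  · refine le_iInf fun γ => le_iInf fun hγ => le_iInf fun h0 => le_iInf fun h1 => ?_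
    rw [← inducedLength_eq hX le_rfl le_rfl zero_lt_one hγ]
    exact Manifold.riemannianEDist_le_pathELength hγ h0 h1 zero_le_one

lemma inducedEDist_self (hX : IsSmoothImmersion X) (q : M) : inducedEDist X q q = 0 := by
  let := inducedENorm X
  have := inducedENorm_smulClass X
  rw [inducedEDist_eq_riemannianEDist hX, Manifold.riemannianEDist_self]

lemma inducedEDist_comm (hX : IsSmoothImmersion X) (q q' : M) :
    inducedEDist X q q' = inducedEDist X q' q := by
  let := inducedENorm X
  have := inducedENorm_smulClass X
  rw [inducedEDist_eq_riemannianEDist hX, inducedEDist_eq_riemannianEDist hX,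
    Manifold.riemannianEDist_comm]

lemma inducedEDist_triangle (hX : IsSmoothImmersion X) (a b c : M) :
    inducedEDist X a c ≤ inducedEDist X a b + inducedEDist X b c := by
  let := inducedENorm X
  have := inducedENorm_smulClass X
  simp only [inducedEDist_eq_riemannianEDist hX]
  exact Manifold.riemannianEDist_triangle

lemma inducedEDist_le_inducedLength (hX : IsSmoothImmersion X) {γ : ℝ → M} {a b : ℝ}
    (hab : a ≤ b) (hγ : ContMDiffOn 𝓘(ℝ, ℝ) (𝓡 n) 1 γ (Icc a b)) :
    inducedEDist X (γ a) (γ b) ≤ inducedLength X γ a b := by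
  let := inducedENorm X
  have := inducedENorm_smulClass X
  rw [inducedEDist_eq_riemannianEDist hX]
  exact Manifold.riemannianEDist_le_pathELength hγ rfl rfl hab

lemma exists_path_of_inducedEDist_lt (hX : IsSmoothImmersion X) {q q' : M} {r : ENNReal}
    (h : inducedEDist X q q' < r) :
    ∃ γ : ℝ → M, γ 0 = q ∧ γ 1 = q' ∧ ContMDiffOn 𝓘(ℝ, ℝ) (𝓡 n) 1 γ (Icc 0 1) ∧
      inducedLength X γ 0 1 < r := by
  let := inducedENorm X
  rw [inducedEDist_eq_riemannianEDist hX] at h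
  exact Manifold.exists_lt_of_riemannianEDist_lt h

lemma contDiffOn_comp_path (hX : IsSmoothImmersion X) {γ : ℝ → M} {s : Set ℝ}
    (hγ : ContMDiffOn 𝓘(ℝ, ℝ) (𝓡 n) 1 γ s) : ContDiffOn ℝ 1 (X ∘ γ) s := by
  rw [← contMDiffOn_iff_contDiffOn]
  exact (hX.smooth.of_le (by simp)).comp_contMDiffOn hγ

/-- The immersion does not increase distances. -/
lemma enorm_sub_le_inducedEDist (hX : IsSmoothImmersion X) (q q' : M) :
    ‖X q' - X q‖ₑ ≤ inducedEDist X q q' := by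
  refine le_iInf fun γ => le_iInf fun hγ => le_iInf fun h0 => le_iInf fun h1 => ?_
  have := enorm_sub_le_lintegral_derivWithin_Icc_of_contDiffOn_Icc (contDiffOn_comp_path hX hγ)
    zero_le_one
  simpa [h0, h1] using this

lemma continuousOn_lintegral_Icc {F : Type*} [NormedAddCommGroup F] {f : ℝ → F}
    (hf : ContinuousOn f (Icc 0 1)) :
    ContinuousOn (fun t => ∫⁻ s in Icc 0 t, ‖f s‖ₑ) (Icc 0 1) := by
  have hint : IntegrableOn f (Icc 0 1) := hf.integrableOn_Icc
  have h1 : ContinuousOn (fun t => ∫ s in (0 : ℝ)..t, ‖f s‖) (Icc 0 1) := by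
    have := intervalIntegral.continuousOn_primitive_interval (a := 0) (b := 1)
      (f := fun s => ‖f s‖) (μ := volume) (by rw [uIcc_of_le zero_le_one]; exact hint.norm)
    rwa [uIcc_of_le zero_le_one] at this
  refine (ENNReal.continuous_ofReal.comp_continuousOn h1).congr fun t ht => ?_
  have h2 : IntegrableOn f (Icc 0 t) := hint.mono_set (Icc_subset_Icc le_rfl ht.2)
  simp only [Function.comp_apply]
  rw [intervalIntegral.integral_of_le ht.1, ← integral_Icc_eq_integral_Ioc,
    ofReal_integral_norm_eq_lintegral_enorm h2]

/-- The induced distance is a length distance: a point at distance less than `a + b` from `q` is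
at distance less than `b` from some point of the closed `a`-ball around `q`. -/
lemma exists_between_inducedEDist (hX : IsSmoothImmersion X) {q q' : M} {a b : ENNReal}
    (hb : 0 < b) (h : inducedEDist X q q' < a + b) :
    ∃ z, inducedEDist X q z ≤ a ∧ inducedEDist X z q' < b := by
  obtain ⟨γ, rfl, rfl, hγ, hlen⟩ := exists_path_of_inducedEDist_lt hX h
  by_cases hle : inducedLength X γ 0 1 ≤ a
  · exact ⟨γ 1, (inducedEDist_le_inducedLength hX zero_le_one hγ).trans hle,
      by rwa [inducedEDist_self hX]⟩
  have hdc : ContinuousOn (derivWithin (X ∘ γ) (Icc 0 1)) (Icc 0 1) :=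
    (contDiffOn_comp_path hX hγ).continuousOn_derivWithin (uniqueDiffOn_Icc zero_lt_one) le_rfl
  have hcont := continuousOn_lintegral_Icc hdc
  have hmem : a ∈ Icc (∫⁻ s in Icc (0 : ℝ) 0, ‖derivWithin (X ∘ γ) (Icc 0 1) s‖ₑ)
      (∫⁻ s in Icc (0 : ℝ) 1, ‖derivWithin (X ∘ γ) (Icc 0 1) s‖ₑ) := by
    constructor
    · simp
    · rw [← inducedLength_eq hX le_rfl le_rfl zero_lt_one hγ]
      exact (not_le.1 hle).le
  obtain ⟨t, ht, hta⟩ := intermediate_value_Icc zero_le_one hcont hmem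
  have hta' : inducedLength X γ 0 t = a := by
    rcases ht.1.eq_or_lt with rfl | h0
    · rw [← hta, inducedLength_self]; simp
    · rw [inducedLength_eq hX le_rfl ht.2 h0 hγ]; exact hta
  refine ⟨γ t, ?_, ?_⟩
  · rw [← hta']
    exact inducedEDist_le_inducedLength hX ht.1 (hγ.mono (Icc_subset_Icc le_rfl ht.2))
  · refine (inducedEDist_le_inducedLength hX ht.2
      (hγ.mono (Icc_subset_Icc ht.1 le_rfl))).trans_lt ?_
    have hadd : inducedLength X γ 0 t + inducedLength X γ t 1 = inducedLength X γ 0 1 := by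
      let := inducedENorm X
      exact Manifold.pathELength_add ht.1 ht.2
    rw [← hadd, hta'] at hlen
    exact lt_of_add_lt_add_left hlen

variable [IsManifold (𝓡 n) ∞ M]

lemma inducedEDist_chart_le (hX : IsSmoothImmersion X)
    (he : e ∈ atlas (EuclideanSpace ℝ (Fin n)) M) {u v : EuclideanSpace ℝ (Fin n)} {C : ℝ}
    (hseg : segment ℝ u v ⊆ e.target)
    (hC : ∀ w ∈ segment ℝ u v, ‖fderiv ℝ (X ∘ e.symm) w (v - u)‖ ≤ C) :
    inducedEDist X (e.symm u) (e.symm v) ≤ ENNReal.ofReal C := by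
  set l : ℝ → EuclideanSpace ℝ (Fin n) := fun t => u + t • (v - u) with hl
  have hlmem : ∀ t ∈ Icc (0 : ℝ) 1, l t ∈ segment ℝ u v := fun t ht => by
    rw [segment_eq_image']
    exact ⟨t, ht, rfl⟩
  have hld : ContDiff ℝ ∞ l := by
    refine contDiff_const.add (contDiff_id.smul contDiff_const)
  have hγ : ContMDiffOn 𝓘(ℝ, ℝ) (𝓡 n) 1 (e.symm ∘ l) (Icc 0 1) := by
    have h1 := (contMDiffOn_symm_of_mem_maximalAtlas (I := 𝓡 n) (n := ∞)
      (IsManifold.subset_maximalAtlas he)).of_le (m := 1) (by simp)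
    refine h1.comp (contMDiff_iff_contDiff.2 (hld.of_le (by simp))).contMDiffOn ?_
    exact fun t ht => hseg (hlmem t ht)
  have h := inducedEDist_le_inducedLength hX zero_le_one hγ
  have h0 : (e.symm ∘ l) 0 = e.symm u := by simp [hl]
  have h1 : (e.symm ∘ l) 1 = e.symm v := by simp [hl]
  rw [h0, h1, inducedLength_eq hX le_rfl le_rfl zero_lt_one hγ] at h
  refine h.trans ?_
  have hb : ∀ t ∈ Icc (0 : ℝ) 1, ‖derivWithin (X ∘ e.symm ∘ l) (Icc 0 1) t‖ₑ
      ≤ ENNReal.ofReal C := by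
    intro t ht
    have hlt : HasDerivAt l (v - u) t := by
      have := ((hasDerivAt_id t).smul_const (v - u)).const_add u
      simpa [hl] using! this
    have hx := ((hX.contDiffAt_comp_chart_symm he (hseg (hlmem t ht))).differentiableAt
      (by simp)).hasFDerivAt.comp_hasDerivAt t hlt
    have : derivWithin (X ∘ e.symm ∘ l) (Icc 0 1) t
        = fderiv ℝ (X ∘ e.symm) (l t) (v - u) :=
      hx.hasDerivWithinAt.derivWithin (uniqueDiffOn_Icc zero_lt_one t ht)
    rw [this, ← ofReal_norm]
    exact ENNReal.ofReal_le_ofReal (hC _ (hlmem t ht))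
  calc _ ≤ ∫⁻ _ in Icc (0 : ℝ) 1, ENNReal.ofReal C := setLIntegral_mono' measurableSet_Icc hb
    _ = _ := by simp

lemma exists_ball_bound_fderiv (hX : IsSmoothImmersion X)
    (he : e ∈ atlas (EuclideanSpace ℝ (Fin n)) M) {u : EuclideanSpace ℝ (Fin n)}
    (hu : u ∈ e.target) :
    ∃ r > 0, ∃ C ≥ 0, Metric.ball u r ⊆ e.target ∧
      ∀ v ∈ Metric.ball u r, ‖fderiv ℝ (X ∘ e.symm) v‖ ≤ C := by
  have hc := (hX.contDiffAt_fderiv he hu).continuousAt.norm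
  have h1 := hc.eventually_lt (g := fun _ => ‖fderiv ℝ (X ∘ e.symm) u‖ + 1) continuousAt_const
    (lt_add_one _)
  obtain ⟨r, hr, hb⟩ := Metric.mem_nhds_iff.1 (h1.and (e.open_target.mem_nhds hu))
  exact ⟨r, hr, _, by positivity, fun v hv => (hb hv).2, fun v hv => (hb hv).1.le⟩

lemma inducedEDist_chart_le_mul (hX : IsSmoothImmersion X)
    (he : e ∈ atlas (EuclideanSpace ℝ (Fin n)) M) {a u v : EuclideanSpace ℝ (Fin n)} {r C : ℝ}
    (hball : Metric.ball a r ⊆ e.target)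
    (hC : ∀ v ∈ Metric.ball a r, ‖fderiv ℝ (X ∘ e.symm) v‖ ≤ C)
    (hu : u ∈ Metric.ball a r) (hv : v ∈ Metric.ball a r) :
    inducedEDist X (e.symm u) (e.symm v) ≤ ENNReal.ofReal (C * ‖v - u‖) := by
  have hs := (convex_ball a r).segment_subset hu hv
  exact inducedEDist_chart_le hX he (hs.trans hball) fun w hw =>
    (ContinuousLinearMap.le_opNorm _ _).trans (by gcongr; exact hC w (hs hw))

lemma eventually_inducedEDist_lt (hX : IsSmoothImmersion X) (q : M) {c : ENNReal} (hc : 0 < c) :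
    ∀ᶠ z in 𝓝 q, inducedEDist X q z < c := by
  set e := chartAt (EuclideanSpace ℝ (Fin n)) q with he_def
  have he : e ∈ atlas (EuclideanSpace ℝ (Fin n)) M := chart_mem_atlas _ q
  have hq : q ∈ e.source := mem_chart_source _ q
  obtain ⟨r, hr, C, -, hb, hC⟩ := exists_ball_bound_fderiv hX he (e.map_source hq)
  have hcont : ContinuousAt (fun z => ENNReal.ofReal (C * ‖e z - e q‖)) q := by
    have := e.continuousAt hq
    exact ENNReal.continuous_ofReal.continuousAt.comp (by fun_prop)
  have h1 := hcont.eventually_lt (g := fun _ => c) continuousAt_const (by simpa using hc)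
  filter_upwards [h1, (e.continuousAt hq).preimage_mem_nhds (Metric.ball_mem_nhds _ hr),
    e.open_source.mem_nhds hq] with z hz hzb hzs
  have := inducedEDist_chart_le_mul hX he hb hC (Metric.mem_ball_self hr) hzb
  rw [e.left_inv hq, e.left_inv hzs] at this
  exact this.trans_lt hz

lemma isOpen_inducedBall (hX : IsSmoothImmersion X) (q : M) (r : ENNReal) :
    IsOpen {z | inducedEDist X q z < r} := by
  rw [isOpen_iff_mem_nhds]
  intro z hz
  filter_upwards [eventually_inducedEDist_lt hX z (tsub_pos_of_lt hz)] with w hw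
  refine (inducedEDist_triangle hX q z w).trans_lt ?_
  rw [add_comm]
  exact lt_tsub_iff_right.1 hw

lemma isClosed_inducedClosedBall (hX : IsSmoothImmersion X) (q : M) (r : ENNReal) :
    IsClosed {z | inducedEDist X q z ≤ r} := by
  rw [← isOpen_compl_iff, isOpen_iff_mem_nhds]
  intro z hz
  have hz' : r < inducedEDist X q z := not_le.1 hz
  filter_upwards [eventually_inducedEDist_lt hX z (tsub_pos_of_lt hz')] with w hw hw'
  have h1 := (inducedEDist_triangle hX q w z)
  rw [inducedEDist_comm hX w z] at h1
  have h2 := lt_tsub_iff_left.1 hw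
  exact absurd (h1.trans (add_le_add_left hw' _)) (not_le.2 h2)

/-- Small balls of the induced distance are small in the topology of `M`: a curve that leaves a
small coordinate ball around `q` has moved by a definite amount already in the ambient space. -/
lemma exists_inducedBall_subset [T2Space M] (hX : IsSmoothImmersion X) {q : M} {U : Set M}
    (hU : U ∈ 𝓝 q) : ∃ c : ENNReal, 0 < c ∧ ∀ z, inducedEDist X q z < c → z ∈ U := by
  set e := chartAt (EuclideanSpace ℝ (Fin n)) q with he_def
  have he : e ∈ atlas (EuclideanSpace ℝ (Fin n)) M := chart_mem_atlas _ q
  have hq : q ∈ e.source := mem_chart_source _ q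
  have hu := e.map_source hq
  set A := fderiv ℝ (X ∘ e.symm) (e q)
  obtain ⟨K, hK, hanti⟩ := A.toLinearMap.exists_antilipschitzWith
    (LinearMap.ker_eq_bot.2 (hX.injective_fderiv he hu))
  have hKA : ∀ v, ‖v‖ ≤ K * ‖A v‖ := fun v => hanti.le_mul_norm (map_zero A) v
  have hK' : (0 : ℝ) < K := hK
  have hd : HasFDerivAt (X ∘ e.symm) A (e q) :=
    ((hX.contDiffAt_comp_chart_symm he hu).differentiableAt (by simp)).hasFDerivAt
  have hlow : ∀ᶠ v in 𝓝 (e q), ‖v - e q‖ ≤ 2 * K * ‖X (e.symm v) - X q‖ := by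
    filter_upwards [hd.isLittleO.bound (c := (2 * (K : ℝ))⁻¹) (by positivity)] with v hv
    simp only [Function.comp_apply, e.left_inv hq] at hv
    have h1 := hKA (v - e q)
    have h2 : ‖A (v - e q)‖ ≤ ‖X (e.symm v) - X q‖ + (2 * (K : ℝ))⁻¹ * ‖v - e q‖ := by
      calc ‖A (v - e q)‖ = ‖(X (e.symm v) - X q) - (X (e.symm v) - X q - A (v - e q))‖ := by
            congr 1; abel
        _ ≤ _ := (norm_sub_le _ _).trans (by gcongr)
    have h3 := h1.trans (mul_le_mul_of_nonneg_left h2 hK'.le)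
    have h4 : (K : ℝ) * ((2 * (K : ℝ))⁻¹ * ‖v - e q‖) = ‖v - e q‖ / 2 := by field_simp
    rw [mul_add, h4] at h3
    linarith
  have hsymm : e.symm ⁻¹' U ∈ 𝓝 (e q) :=
    (e.continuousAt_symm hu).preimage_mem_nhds (by rwa [e.left_inv hq])
  obtain ⟨r, hr, hrb⟩ := Metric.nhds_basis_closedBall.mem_iff.1
    (inter_mem (inter_mem hlow hsymm) (e.open_target.mem_nhds hu))
  refine ⟨ENNReal.ofReal (r / (2 * K)), by simpa using by positivity, fun z hz => ?_⟩
  set V := e.source ∩ e ⁻¹' Metric.ball (e q) r with hV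
  have hVo : IsOpen V := e.isOpen_inter_preimage Metric.isOpen_ball
  set C := e.symm '' Metric.closedBall (e q) r with hC
  have hCc : IsClosed C := ((isCompact_closedBall _ _).image_of_continuousOn
    (e.continuousOn_symm.mono fun v hv => (hrb hv).2)).isClosed
  have hqV : q ∈ V := ⟨hq, Metric.mem_ball_self hr⟩
  suffices hzV : z ∈ V by
    have := (hrb (Metric.ball_subset_closedBall hzV.2)).1.2
    rwa [mem_preimage, e.left_inv hzV.1] at this
  by_contra hzV
  obtain ⟨γ, h0, h1, hγ, hlen⟩ := exists_path_of_inducedEDist_lt hX hz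
  have hex : ∃ t ∈ Icc (0 : ℝ) 1, γ t ∈ C ∧ γ t ∉ V := by
    by_contra hno
    push Not at hno
    have hsub : γ '' Icc 0 1 ⊆ V ∪ Cᶜ := by
      rintro _ ⟨t, ht, rfl⟩
      by_cases hcc : γ t ∈ C
      · exact Or.inl (hno t ht hcc)
      · exact Or.inr hcc
    have hdisj : Disjoint V Cᶜ := by
      rw [disjoint_compl_right_iff_subset]
      intro w hw
      exact ⟨e w, Metric.ball_subset_closedBall hw.2, e.left_inv hw.1⟩
    have hpre : IsPreconnected (γ '' Icc 0 1) := isPreconnected_Icc.image _ hγ.continuousOn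
    have hall := hpre.subset_left_of_subset_union hVo hCc.isOpen_compl hdisj hsub
      ⟨q, ⟨0, by simp, h0⟩, hqV⟩
    exact hzV (hall ⟨1, by simp, h1⟩)
  obtain ⟨t, ht, ⟨v, hv, hvt⟩, htV⟩ := hex
  have hvr : r ≤ ‖v - e q‖ := by
    by_contra hlt
    apply htV
    rw [← hvt]
    refine ⟨e.map_target (hrb hv).2, ?_⟩
    rw [mem_preimage, e.right_inv (hrb hv).2, mem_ball_iff_norm]
    exact not_le.1 hlt
  have hXv : r / (2 * K) ≤ ‖X (γ t) - X q‖ := by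
    rw [div_le_iff₀ (by positivity), ← hvt]
    have := (hrb hv).1.1
    simp only [mem_ofPred_eq] at this
    linarith
  have hlt : inducedEDist X q (γ t) < ENNReal.ofReal (r / (2 * K)) := by
    have h2 := inducedEDist_le_inducedLength hX ht.1 (hγ.mono (Icc_subset_Icc le_rfl ht.2))
    rw [h0] at h2
    refine (h2.trans ?_).trans_lt hlen
    let := inducedENorm X
    exact Manifold.pathELength_mono le_rfl ht.2
  have := (enorm_sub_le_inducedEDist hX q (γ t)).trans_lt hlt
  rw [← ofReal_norm, ENNReal.ofReal_lt_ofReal_iff (by positivity)] at this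
  linarith

/-- Lipschitz continuity of a function for the induced distance. -/
def IsInducedLipschitz (X : M → EuclideanSpace ℝ (Fin (n + p))) (L : ℝ) (η : M → ℝ) : Prop :=
  ∀ q q', ENNReal.ofReal |η q - η q'| ≤ ENNReal.ofReal L * inducedEDist X q q'

/-- The ball of radius `r` around `q` for the induced distance is contained in a compact set. -/
def HasCompactBall (X : M → EuclideanSpace ℝ (Fin (n + p))) (q : M) (r : ENNReal) : Prop :=
  ∃ K : Set M, IsCompact K ∧ ∀ z, inducedEDist X q z < r → z ∈ K

/-- The supremum of the radii of the relatively compact balls around `q`. -/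
def compactRadius (X : M → EuclideanSpace ℝ (Fin (n + p))) (q : M) : ENNReal :=
  sSup {r | HasCompactBall X q r}

lemma HasCompactBall.mono {q : M} {r r' : ENNReal} (h : HasCompactBall X q r) (hr : r' ≤ r) :
    HasCompactBall X q r' := by
  obtain ⟨K, hK, h⟩ := h
  exact ⟨K, hK, fun z hz => h z (hz.trans_le hr)⟩

lemma hasCompactBall_of_lt {q : M} {r : ENNReal} (h : r < compactRadius X q) :
    HasCompactBall X q r := by
  obtain ⟨r', hr', hlt⟩ := lt_sSup_iff.1 h
  exact HasCompactBall.mono hr' hlt.le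

lemma compactRadius_le_add (hX : IsSmoothImmersion X) (q q' : M) :
    compactRadius X q ≤ compactRadius X q' + inducedEDist X q q' := by
  refine sSup_le fun r hr => ?_
  rw [← tsub_le_iff_right]
  refine le_sSup ?_
  obtain ⟨K, hK, h⟩ := hr
  exact ⟨K, hK, fun z hz =>
    h z ((inducedEDist_triangle hX q q' z).trans_lt (lt_tsub_iff_left.1 hz))⟩

lemma compactRadius_pos [T2Space M] (hX : IsSmoothImmersion X) (q : M) :
    0 < compactRadius X q := by
  have : LocallyCompactSpace M := ChartedSpace.locallyCompactSpace (EuclideanSpace ℝ (Fin n)) M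
  obtain ⟨K, hK, hKq⟩ := exists_compact_mem_nhds q
  obtain ⟨c, hc, h⟩ := exists_inducedBall_subset hX hKq
  exact hc.trans_le (le_sSup ⟨K, hK, h⟩)

/-- Inside the largest relatively compact ball around `q`, supposed of finite radius, the
compactness radius must drop by a factor `4`: otherwise finitely many balls of a fixed radius,
centred in a compact ball almost as large, would cover a larger ball by a compact set. -/
lemma exists_compactRadius_le [T2Space M] (hX : IsSmoothImmersion X) {q : M}
    (hfin : compactRadius X q ≠ ⊤) :
    ∃ z, inducedEDist X q z ≤ compactRadius X q ∧ compactRadius X z ≤ compactRadius X q / 4 := by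
  by_contra! hno
  set ρ := compactRadius X q with hρ
  have hρ0 : 0 < ρ := compactRadius_pos hX q
  have hδ0 : 0 < ρ / 4 := ENNReal.div_pos hρ0.ne' (by simp)
  have hδfin : ρ / 4 ≠ ⊤ := (ENNReal.div_lt_top hfin (by simp)).ne
  set b := ρ / 4 / 2 with hb
  have hb0 : 0 < b := ENNReal.half_pos hδ0.ne'
  have hbfin : b ≠ ⊤ := (ENNReal.div_lt_top hδfin (by simp)).ne
  have hbρ : b ≤ ρ := ENNReal.half_le_self.trans (ENNReal.div_le_of_le_mul
    (le_mul_of_one_le_right' (by norm_num)))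
  obtain ⟨a, ha1, ha2⟩ := exists_between (ENNReal.sub_lt_self hfin hρ0.ne' hb0.ne')
  have hab : ρ < a + b := (ENNReal.sub_lt_iff_lt_right hbfin hbρ).1 ha1
  obtain ⟨a', haa', ha'⟩ := exists_between ha2
  obtain ⟨K, hK, hKa⟩ := hasCompactBall_of_lt ha'
  have hS : IsCompact {z | inducedEDist X q z ≤ a} :=
    hK.of_isClosed_subset (isClosed_inducedClosedBall hX q a) fun z hz => hKa z (hz.trans_lt haa')
  have hcover : ∃ K' : Set M, IsCompact K' ∧ ∀ z ∈ {z | inducedEDist X q z ≤ a}, ∀ w,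
      inducedEDist X z w < b → w ∈ K' := by
    refine hS.induction_on ⟨∅, isCompact_empty, by simp⟩ ?_ ?_ ?_
    · rintro s t hst ⟨K', hK', h⟩
      exact ⟨K', hK', fun z hz => h z (hst hz)⟩
    · rintro s t ⟨K₁, hK₁, h₁⟩ ⟨K₂, hK₂, h₂⟩
      refine ⟨K₁ ∪ K₂, hK₁.union hK₂, ?_⟩
      rintro z (hz | hz) w hw
      · exact Or.inl (h₁ z hz w hw)
      · exact Or.inr (h₂ z hz w hw)
    · intro z hz
      obtain ⟨K', hK', h⟩ := hasCompactBall_of_lt (hno z (le_trans hz ha2.le))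
      refine ⟨{w | inducedEDist X z w < b},
        mem_nhdsWithin_of_mem_nhds (eventually_inducedEDist_lt hX z hb0), K', hK',
        fun w hw v hv => h v ?_⟩
      refine (inducedEDist_triangle hX z w v).trans_lt ?_
      rw [← ENNReal.add_halves (ρ / 4)]
      exact ENNReal.add_lt_add hw hv
  obtain ⟨K', hK', h⟩ := hcover
  refine absurd (le_sSup (s := {r | HasCompactBall X q r}) ⟨K', hK', fun w hw => ?_⟩)
    (not_le.2 hab)
  obtain ⟨z, hz1, hz2⟩ := exists_between_inducedEDist hX hb0 hw
  exact h z hz1 w hz2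

/-- The Hopf–Rinow theorem: if `M` is complete then the balls are relatively compact. -/
lemma IsCompleteImmersion.hasCompactBall [T2Space M] (hX : IsSmoothImmersion X)
    (hc : IsCompleteImmersion X) (q : M) {r : ENNReal} (hr : r ≠ ⊤) : HasCompactBall X q r := by
  by_cases htop : compactRadius X q = ⊤
  · exact hasCompactBall_of_lt (htop ▸ hr.lt_top)
  exfalso
  -- iterating the previous lemma gives a Cauchy sequence along which the radius tends to `0`
  have hstep : ∀ z : {z // compactRadius X z ≠ ⊤}, ∃ w : {z // compactRadius X z ≠ ⊤},
      inducedEDist X z.1 w.1 ≤ compactRadius X z.1 ∧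
        compactRadius X w.1 ≤ compactRadius X z.1 / 4 := by
    rintro ⟨z, hz⟩
    obtain ⟨w, h1, h2⟩ := exists_compactRadius_le hX hz
    exact ⟨⟨w, (h2.trans_lt (ENNReal.div_lt_top hz (by simp))).ne⟩, h1, h2⟩
  choose f hf1 hf2 using hstep
  set u : ℕ → {z // compactRadius X z ≠ ⊤} := fun k => f^[k] ⟨q, htop⟩ with hu
  have hsucc : ∀ k, u (k + 1) = f (u k) := fun k => Function.iterate_succ_apply' f k _
  have hdist : ∀ m k, inducedEDist X (u k).1 (u (k + m)).1 ≤ 2 * compactRadius X (u k).1 := by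
    intro m
    induction m with
    | zero => intro k; simp [inducedEDist_self hX]
    | succ m ih =>
      intro k
      have h1 := ih (k + 1)
      have h2 : inducedEDist X (u k).1 (u (k + 1)).1 ≤ compactRadius X (u k).1 := by
        rw [hsucc]; exact hf1 _
      have h3 : compactRadius X (u (k + 1)).1 ≤ compactRadius X (u k).1 / 4 := by
        rw [hsucc]; exact hf2 _
      rw [show k + 1 + m = k + (m + 1) by ring] at h1
      refine (inducedEDist_triangle hX _ _ _).trans ((add_le_add h2 (h1.trans
        (mul_le_mul_right h3 2))).trans ?_)
      have h4 : 2 * (compactRadius X (u k).1 / 4) ≤ compactRadius X (u k).1 := by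
        calc 2 * (compactRadius X (u k).1 / 4) ≤ 4 * (compactRadius X (u k).1 / 4) := by
              gcongr; norm_num
          _ = compactRadius X (u k).1 := ENNReal.mul_div_cancel (by simp) (by simp)
      rw [two_mul (compactRadius X (u k).1)]
      exact add_le_add le_rfl h4
  have hrad : ∀ k, compactRadius X (u k).1 ≤ compactRadius X q * (4⁻¹ : ENNReal) ^ k := by
    intro k
    induction k with
    | zero => simp [hu]
    | succ k ih =>
      rw [hsucc, pow_succ, ← mul_assoc]
      refine (hf2 _).trans ?_
      rw [ENNReal.div_eq_inv_mul, mul_comm]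
      gcongr
  have hlim : Tendsto (fun k => compactRadius X (u k).1) atTop (𝓝 0) := by
    refine tendsto_of_tendsto_of_tendsto_of_le_of_le tendsto_const_nhds ?_ (fun _ => zero_le) hrad
    have := ENNReal.Tendsto.const_mul (a := compactRadius X q)
      (ENNReal.tendsto_pow_atTop_nhds_zero_of_lt_one (r := 4⁻¹)
        (ENNReal.inv_lt_one.2 (by norm_num))) (Or.inr htop)
    simpa using this
  obtain ⟨z, hz⟩ := hc (fun k => (u k).1) (by
    intro δ hδ
    have hlim4 := ENNReal.Tendsto.const_mul (a := 4) hlim (Or.inr (by simp))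
    rw [mul_zero] at hlim4
    obtain ⟨N, hN⟩ := (hlim4.eventually_lt_const hδ).exists
    refine ⟨N, fun k hk l hl => lt_of_le_of_lt ?_ hN⟩
    obtain ⟨a, rfl⟩ := Nat.exists_eq_add_of_le hk
    obtain ⟨b, rfl⟩ := Nat.exists_eq_add_of_le hl
    refine (inducedEDist_triangle hX _ (u N).1 _).trans ?_
    rw [inducedEDist_comm hX _ (u N).1]
    refine (add_le_add (hdist a N) (hdist b N)).trans_eq ?_
    rw [← add_mul]; norm_num)
  -- the radius is `1`-Lipschitz, so that it vanishes at the limit point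
  have hz0 := compactRadius_pos hX z
  have h2 : (0 : ENNReal) < compactRadius X z / 2 := ENNReal.half_pos hz0.ne'
  obtain ⟨k, hk1, hk2⟩ := ((hz.eventually (eventually_inducedEDist_lt hX z h2)).and
    (hlim.eventually_lt_const h2)).exists
  have := (compactRadius_le_add hX z (u k).1).trans_lt (ENNReal.add_lt_add hk2 hk1)
  rw [ENNReal.add_halves] at this
  exact lt_irrefl _ this

/-- On a complete `M` there are compactly supported cutoff functions with values in `[0, 1]`
which tend to `1` and whose Lipschitz constants tend to `0`. -/
lemma IsCompleteImmersion.exists_cutoff [T2Space M] [SecondCountableTopology M]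
    (hX : IsSmoothImmersion X) (hc : IsCompleteImmersion X) :
    ∃ η : ℕ → M → ℝ, (∀ k q, 0 ≤ η k q ∧ η k q ≤ 1) ∧ (∀ k, HasCompactSupport (η k)) ∧
      (∀ k : ℕ, IsInducedLipschitz X (1 / ((k : ℝ) + 1)) (η k)) ∧
      ∀ q, Tendsto (fun k => η k q) atTop (𝓝 1) := by
  rcases isEmpty_or_nonempty M with hM | hM
  · exact ⟨fun _ _ => 0, fun _ q => isEmptyElim q, fun _ => HasCompactSupport.zero,
      fun _ q => isEmptyElim q, fun q => isEmptyElim q⟩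
  set s := TopologicalSpace.denseSeq M
  set D : ℕ → M → ENNReal := fun k q => min (⨅ i ∈ Finset.range (k + 1), inducedEDist X (s i) q)
    ((k : ENNReal) + 1) with hD
  have hktop : ∀ k : ℕ, (k : ENNReal) + 1 ≠ ⊤ := fun k => by simp
  have hDtop : ∀ k q, D k q ≠ ⊤ := fun k q => ((min_le_right _ _).trans_lt (hktop k).lt_top).ne
  have hDle : ∀ k q, (D k q).toReal ≤ (k : ℝ) + 1 := fun k q => by
    have := ENNReal.toReal_mono (hktop k) (min_le_right _ _ : D k q ≤ _)
    rwa [ENNReal.toReal_add (by simp) (by simp), ENNReal.toReal_natCast, ENNReal.toReal_one] at this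
  have hDlip : ∀ k q q', D k q ≤ D k q' + inducedEDist X q q' := by
    intro k q q'
    rw [hD, ← min_add_add_right]
    refine min_le_min ?_ le_self_add
    rw [ENNReal.iInf₂_add]
    refine le_iInf₂ fun i hi => (iInf₂_le i hi).trans ?_
    rw [inducedEDist_comm hX q q']
    exact inducedEDist_triangle hX _ _ _
  have hkpos : ∀ k : ℕ, (0 : ℝ) < (k : ℝ) + 1 := fun k => by positivity
  refine ⟨fun k q => 1 - (D k q).toReal / ((k : ℝ) + 1), fun k q => ⟨?_, ?_⟩, fun k => ?_,
    fun k q q' => ?_, fun q => ?_⟩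
  · rw [sub_nonneg, div_le_one (hkpos k)]
    exact hDle k q
  · have : 0 ≤ (D k q).toReal / ((k : ℝ) + 1) := by positivity
    linarith
  · choose K hK hKs using fun i => IsCompleteImmersion.hasCompactBall hX hc (s i) (hktop k)
    refine HasCompactSupport.intro ((Finset.range (k + 1)).isCompact_biUnion fun i _ => hK i)
      fun q hq => ?_
    have hDq : D k q = (k : ENNReal) + 1 := by
      refine min_eq_right (le_iInf₂ fun i hi => not_lt.1 fun hlt => hq ?_)
      exact mem_biUnion hi (hKs i q hlt)
    simp only
    rw [hDq, ENNReal.toReal_add (by simp) (by simp), ENNReal.toReal_natCast, ENNReal.toReal_one,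
      div_self (hkpos k).ne', sub_self]
  · by_cases htop : inducedEDist X q q' = ⊤
    · rw [htop, ENNReal.mul_top (by simpa using hkpos k)]
      exact le_top
    rw [← ENNReal.ofReal_toReal htop, ← ENNReal.ofReal_mul (by positivity)]
    refine ENNReal.ofReal_le_ofReal ?_
    have h1 := ENNReal.toReal_mono (ENNReal.add_ne_top.2 ⟨hDtop k q', htop⟩) (hDlip k q q')
    have h2 := hDlip k q' q
    rw [inducedEDist_comm hX q' q] at h2
    have h2 := ENNReal.toReal_mono (ENNReal.add_ne_top.2 ⟨hDtop k q, htop⟩) h2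
    rw [ENNReal.toReal_add (hDtop _ _) htop] at h1 h2
    have h3 : (1 - (D k q).toReal / ((k : ℝ) + 1)) - (1 - (D k q').toReal / ((k : ℝ) + 1))
        = 1 / ((k : ℝ) + 1) * ((D k q').toReal - (D k q).toReal) := by ring
    rw [h3, abs_mul, abs_of_pos (by have := hkpos k; positivity)]
    have := hkpos k
    gcongr
    rw [abs_le]
    constructor <;> linarith
  · obtain ⟨i, hi⟩ : ∃ i, inducedEDist X (s i) q < 1 := by
      obtain ⟨i, hi⟩ := (TopologicalSpace.denseRange_denseSeq M).exists_mem_open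
        (isOpen_inducedBall hX q 1) ⟨q, by simp [inducedEDist_self hX]⟩
      exact ⟨i, by rw [inducedEDist_comm hX]; exact hi⟩
    have hlow : ∀ᶠ k : ℕ in atTop, 1 - 1 / ((k : ℝ) + 1) ≤ 1 - (D k q).toReal / ((k : ℝ) + 1) := by
      filter_upwards [eventually_ge_atTop i] with k hk
      have h1 : D k q ≤ 1 := ((min_le_left _ _).trans
        (iInf₂_le i (Finset.mem_range.2 (by omega)))).trans hi.le
      have h2 := ENNReal.toReal_mono (by simp) h1
      rw [ENNReal.toReal_one] at h2
      have := hkpos k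
      gcongr
    refine tendsto_of_tendsto_of_tendsto_of_le_of_le' (g := fun k : ℕ => 1 - 1 / ((k : ℝ) + 1))
      ?_ tendsto_const_nhds hlow (Eventually.of_forall fun k => ?_)
    · simpa using tendsto_const_nhds.sub (tendsto_one_div_add_atTop_nhds_zero_nat (𝕜 := ℝ))
    · have : 0 ≤ (D k q).toReal / ((k : ℝ) + 1) := by have := hkpos k; positivity
      linarith

lemma IsInducedLipschitz.continuous (hX : IsSmoothImmersion X) {L : ℝ} {η : M → ℝ}
    (h : IsInducedLipschitz X L η) : Continuous η := by
  rw [continuous_iff_continuousAt]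
  intro q
  rw [Metric.continuousAt_iff']
  intro ε hε
  have hpos : (0 : ENNReal) < ENNReal.ofReal ε / (ENNReal.ofReal L + 1) :=
    ENNReal.div_pos (by simpa using hε) (by simp)
  filter_upwards [eventually_inducedEDist_lt hX q hpos] with z hz
  rw [Real.dist_eq, abs_sub_comm, ← ENNReal.ofReal_lt_ofReal_iff hε]
  refine (h q z).trans_lt ((mul_le_mul_left (le_self_add : _ ≤ ENNReal.ofReal L + 1) _).trans_lt ?_)
  rw [mul_comm]
  exact (ENNReal.lt_div_iff_mul_lt (by simp) (by simp)).1 hz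

end Distance

/-! ### Divergence in coordinates -/

section EuclideanDivergence

variable {n : ℕ}

/-- Integration by parts of a Lipschitz function against the divergence of a vector field with
compact support. -/
lemma integral_mul_divergence {K : NNReal} {η : EuclideanSpace ℝ (Fin n) → ℝ}
    (hη : LipschitzWith K η) {b : EuclideanSpace ℝ (Fin n) → EuclideanSpace ℝ (Fin n)}
    (hb : ContDiff ℝ 1 b) (hsupp : HasCompactSupport b) :
    ∫ x, η x * ∑ k, fderiv ℝ b x (EuclideanSpace.single k 1) k = -∫ x, fderiv ℝ η x (b x) := by
  have hbk : ∀ k, ContDiff ℝ 1 (fun x => b x k) := contDiff_euclidean.1 hb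
  have hsk : ∀ k, HasCompactSupport (fun x => b x k) := fun k =>
    hsupp.comp_left (g := fun v : EuclideanSpace ℝ (Fin n) => v k) rfl
  have hfd : ∀ k x, fderiv ℝ (fun x => b x k) x (EuclideanSpace.single k 1)
      = fderiv ℝ b x (EuclideanSpace.single k 1) k := by
    intro k x
    have h1 := (EuclideanSpace.proj k : EuclideanSpace ℝ (Fin n) →L[ℝ] ℝ).hasFDerivAt.comp x
      (hb.differentiable one_ne_zero x).hasFDerivAt
    have h2 : fderiv ℝ (fun x => b x k) x = _ := h1.fderiv
    rw [h2]
    rfl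
  have hip : ∀ k, ∫ x, η x * fderiv ℝ b x (EuclideanSpace.single k 1) k
      = -∫ x, lineDeriv ℝ η x (EuclideanSpace.single k 1) * b x k := by
    intro k
    obtain ⟨D, hD⟩ := (hbk k).lipschitzWith_of_hasCompactSupport (hsk k) one_ne_zero
    rw [hη.integral_lineDeriv_mul_eq hD (hsk k), ← integral_neg]
    refine integral_congr_ae (Eventually.of_forall fun x => ?_)
    simp only
    rw [((hbk k).differentiable one_ne_zero x).lineDeriv_eq_fderiv, map_neg, hfd]
    ring
  have hint1 : ∀ k ∈ (Finset.univ : Finset (Fin n)),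
      Integrable (fun x => η x * fderiv ℝ b x (EuclideanSpace.single k 1) k) := by
    intro k _
    refine Continuous.integrable_of_hasCompactSupport ?_ ?_
    · simp only [← hfd]
      exact hη.continuous.mul (((hbk k).continuous_fderiv one_ne_zero).clm_apply continuous_const)
    · simp only [← hfd]
      exact ((hsk k).fderiv_apply ℝ _).mul_left
  have hint2 : ∀ k ∈ (Finset.univ : Finset (Fin n)),
      Integrable (fun x => lineDeriv ℝ η x (EuclideanSpace.single k 1) * b x k) := by
    intro k _
    have := ((hbk k).continuous.integrable_of_hasCompactSupport (hsk k)
      (μ := volume)).smul_of_top_left (hη.memLp_lineDeriv (μ := volume) (EuclideanSpace.single k 1))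
    exact this.congr (Eventually.of_forall fun x => mul_comm _ _)
  simp only [Finset.mul_sum]
  rw [integral_finsetSum _ hint1, Finset.sum_congr rfl fun k _ => hip k, Finset.sum_neg_distrib,
    ← integral_finsetSum _ hint2]
  congr 1
  refine integral_congr_ae ?_
  filter_upwards [hη.ae_differentiableAt] with x hx
  rw [apply_eq_sum_coord (fderiv ℝ η x) (b x)]
  refine Finset.sum_congr rfl fun k _ => ?_
  rw [hx.lineDeriv_eq_fderiv, smul_eq_mul, mul_comm]

/-- The divergence of a tangential field `W = ∑ aᵏ ∂ₖ X` in coordinates: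
`∑ ∂ₖ (√(det g) aᵏ) = √(det g) ∑ gⁱʲ ⟨∂ᵢ X, ∂ⱼ W⟩`. -/
lemma sum_fderiv_eq_tangentialTrace {F : Type*} [NormedAddCommGroup F] [InnerProductSpace ℝ F]
    {x : EuclideanSpace ℝ (Fin n) → F} {W : EuclideanSpace ℝ (Fin n) → F}
    {u : EuclideanSpace ℝ (Fin n)} (hx : ContDiffAt ℝ ∞ x u)
    (hinj : Function.Injective (fderiv ℝ x u)) (hW : ContDiffAt ℝ ∞ W u)
    (htan : ∀ᶠ v in 𝓝 u, W v = fderiv ℝ x v (projCoord (fderiv ℝ x v) (W v))) :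
    ∑ k, fderiv ℝ (fun v => √(crossGram (fderiv ℝ x v) (fderiv ℝ x v)).det •
        projCoord (fderiv ℝ x v) (W v)) u (EuclideanSpace.single k 1) k
      = √(crossGram (fderiv ℝ x u) (fderiv ℝ x u)).det *
        tangentialTrace (fderiv ℝ x u) (fderiv ℝ W u) := by
  have hA : ContDiffAt ℝ ∞ (fderiv ℝ x) u := hx.fderiv_right (by simp)
  have hAd : DifferentiableAt ℝ (fderiv ℝ x) u := hA.differentiableAt (by simp)
  have ha : DifferentiableAt ℝ (fun v => projCoord (fderiv ℝ x v) (W v)) u :=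
    (contDiffAt_projCoord hA hW hinj).differentiableAt (by simp)
  have hg : DifferentiableAt ℝ (fun v => √(crossGram (fderiv ℝ x v) (fderiv ℝ x v)).det) u :=
    (contDiffAt_sqrt_det_crossGram hA hinj).differentiableAt (by simp)
  set a := projCoord (fderiv ℝ x u) (W u) with ha_def
  -- symmetry of the second derivative turns `∑ aᵏ ∂ⱼ ∂ₖ X` into the derivative of `dX` along `a`
  have hsymm : (fderiv ℝ (fderiv ℝ x) u).flip a = fderiv ℝ (fderiv ℝ x) u a := by
    ext v
    exact (hx.isSymmSndFDerivAt (by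
      simpa using WithTop.coe_le_coe.2 (le_top : (2 : ℕ∞) ≤ ⊤))) v a
  have hdW : fderiv ℝ W u = fderiv ℝ x u ∘L fderiv ℝ (fun v => projCoord (fderiv ℝ x v) (W v)) u
      + fderiv ℝ (fderiv ℝ x) u a := by
    rw [Filter.EventuallyEq.fderiv_eq htan, fderiv_clm_apply hAd ha, hsymm]
  have hjac : fderiv ℝ (fun v => √(crossGram (fderiv ℝ x v) (fderiv ℝ x v)).det) u a
      = √(crossGram (fderiv ℝ x u) (fderiv ℝ x u)).det *
        tangentialTrace (fderiv ℝ x u) (fderiv ℝ (fderiv ℝ x) u a) := by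
    have hl : HasDerivAt (fun t : ℝ => u + t • a) a 0 := by
      simpa using! ((hasDerivAt_id (0 : ℝ)).smul_const a).const_add u
    have hu0 : u + (0 : ℝ) • a = u := by simp
    have h1 : HasDerivAt (fun t : ℝ => fderiv ℝ x (u + t • a)) (fderiv ℝ (fderiv ℝ x) u a) 0 :=
      HasFDerivAt.comp_hasDerivAt (f := fun t : ℝ => u + t • a) 0
        (by rw [hu0]; exact hAd.hasFDerivAt) hl
    have h2 := hasDerivAt_sqrt_det_crossGram h1 (by rwa [hu0])
    have h3 : HasDerivAt (fun t : ℝ => √(crossGram (fderiv ℝ x (u + t • a))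
        (fderiv ℝ x (u + t • a))).det) _ 0 :=
      HasFDerivAt.comp_hasDerivAt (f := fun t : ℝ => u + t • a)
        (l := fun v => √(crossGram (fderiv ℝ x v) (fderiv ℝ x v)).det) 0
        (by rw [hu0]; exact hg.hasFDerivAt) hl
    rw [h3.unique h2, hu0]
  rw [fderiv_fun_smul hg ha, hdW, tangentialTrace_add, tangentialTrace_self_comp hinj, mul_add,
    ← hjac, apply_eq_sum_coord _ a, Finset.mul_sum, ← Finset.sum_add_distrib]
  refine Finset.sum_congr rfl fun k _ => ?_
  simp [mul_comm, ← ha_def]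

end EuclideanDivergence

/-! ### The divergence theorem in a small chart ball -/

section DivergenceTheorem

variable {n p : ℕ} {M : Type*} [TopologicalSpace M] [ChartedSpace (EuclideanSpace ℝ (Fin n)) M]
  {e : OpenPartialHomeomorph M (EuclideanSpace ℝ (Fin n))}
  {X W : M → EuclideanSpace ℝ (Fin (n + p))} {q : M} {L : ℝ} {η : M → ℝ}

lemma projCoord_zero {F : Type*} [NormedAddCommGroup F] [InnerProductSpace ℝ F]
    (A : EuclideanSpace ℝ (Fin n) →L[ℝ] F) : projCoord A 0 = 0 := by
  simp [projCoord, ← Pi.zero_def]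

lemma tangentialDivergence_eq_zero_of_notMem_tsupport (h : q ∉ tsupport W) :
    tangentialDivergence X W q = 0 := by
  have h1 : W =ᶠ[𝓝 q] fun _ => 0 := notMem_tsupport_iff_eventuallyEq.1 h
  rw [tangentialDivergence, diff_congr h1]
  have : diff n (fun _ : M => (0 : EuclideanSpace ℝ (Fin (n + p)))) q = 0 := mfderiv_const
  rw [this, tangentialTrace_zero]

variable [IsManifold (𝓡 n) ∞ M]

lemma continuous_tangentialDivergence (hX : IsSmoothImmersion X)
    (hW : ContMDiff (𝓡 n) 𝓘(ℝ, EuclideanSpace ℝ (Fin (n + p))) ∞ W) :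
    Continuous (tangentialDivergence X W) :=
  continuous_iff_continuousAt.2 fun q => (contMDiffAt_tangentialDivergence hX (hW q)).continuousAt

/-- The derivative of a function which is Lipschitz for the induced distance, read in a chart, is
bounded by the induced norm. -/
lemma abs_fderiv_le_of_isInducedLipschitz (hX : IsSmoothImmersion X)
    (he : e ∈ atlas (EuclideanSpace ℝ (Fin n)) M) (hL : 0 ≤ L) (hη : IsInducedLipschitz X L η)
    {g : EuclideanSpace ℝ (Fin n) → ℝ} {u : EuclideanSpace ℝ (Fin n)} (hu : u ∈ e.target)
    (hg : g =ᶠ[𝓝 u] η ∘ e.symm) (hd : DifferentiableAt ℝ g u) (w : EuclideanSpace ℝ (Fin n)) :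
    |fderiv ℝ g u w| ≤ L * ‖fderiv ℝ (X ∘ e.symm) u w‖ := by
  refine le_of_forall_pos_le_add fun ε hε => ?_
  obtain ⟨δ, hδ, hδL⟩ : ∃ δ > 0, L * δ ≤ ε :=
    ⟨ε / (L + 1), by positivity, by
      rw [mul_div_assoc', div_le_iff₀ (by positivity)]
      nlinarith⟩
  suffices h : ‖fderiv ℝ g u w‖ ≤ L * (‖fderiv ℝ (X ∘ e.symm) u w‖ + δ) by
    rw [Real.norm_eq_abs] at h
    linarith
  have hl : HasDerivAt (fun t : ℝ => u + t • w) w 0 := by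
    simpa using! ((hasDerivAt_id (0 : ℝ)).smul_const w).const_add u
  have hu0 : u + (0 : ℝ) • w = u := by simp
  have hder : HasDerivAt (fun t : ℝ => g (u + t • w)) (fderiv ℝ g u w) 0 :=
    HasFDerivAt.comp_hasDerivAt (f := fun t : ℝ => u + t • w) (l := g) 0
      (by rw [hu0]; exact hd.hasFDerivAt) hl
  have hcont : ContinuousAt (fun v => ‖fderiv ℝ (X ∘ e.symm) v w‖) u :=
    ((hX.contDiffAt_fderiv he hu).continuousAt.clm_apply continuousAt_const).norm
  have hev := hcont.eventually_lt (g := fun _ => ‖fderiv ℝ (X ∘ e.symm) u w‖ + δ)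
    continuousAt_const (by linarith)
  obtain ⟨r, hr, hb⟩ := Metric.mem_nhds_iff.1 ((hev.and (e.open_target.mem_nhds hu)).and hg)
  refine hder.le_of_lip' (by positivity) ?_
  have htend : Tendsto (fun t : ℝ => u + t • w) (𝓝 0) (𝓝 u) := by
    have := hl.continuousAt.tendsto
    rwa [hu0] at this
  filter_upwards [htend (Metric.ball_mem_nhds u hr)] with t ht
  have hub := Metric.mem_ball_self (x := u) hr
  have hseg := (convex_ball u r).segment_subset hub ht
  have hgu : g u = η (e.symm u) := (hb hub).2
  have hgt : g (u + t • w) = η (e.symm (u + t • w)) := (hb ht).2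
  simp only [hu0, sub_zero]
  rw [hgu, hgt, norm_sub_rev]
  have h1 := hη (e.symm u) (e.symm (u + t • w))
  have h2 := inducedEDist_chart_le hX he (C := |t| * (‖fderiv ℝ (X ∘ e.symm) u w‖ + δ))
    (fun v hv => (hb (hseg hv)).1.2) (fun v hv => by
      rw [add_sub_cancel_left, map_smul, norm_smul, Real.norm_eq_abs]
      gcongr
      exact (hb (hseg hv)).1.1.le)
  have h3 := h1.trans (mul_le_mul_right h2 _)
  rw [← ENNReal.ofReal_mul hL, ENNReal.ofReal_le_ofReal_iff (by positivity)] at h3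
  rw [Real.norm_eq_abs, Real.norm_eq_abs]
  linarith

variable [MeasurableSpace M] [BorelSpace M]

/-- Integration by parts for a tangential field supported in a coordinate ball, against a function
`η` which is only Lipschitz: Rademacher's theorem bounds the almost everywhere defined derivative
of `η` by the induced norm. -/
lemma abs_integral_mul_tangentialDivergence_le_of_ball [T2Space M] (hX : IsSmoothImmersion X)
    (he : e ∈ atlas (EuclideanSpace ℝ (Fin n)) M) {c : EuclideanSpace ℝ (Fin n)} {r C : ℝ}
    (hC0 : 0 ≤ C) (hball : Metric.ball c r ⊆ e.target)
    (hC : ∀ v ∈ Metric.ball c r, ‖fderiv ℝ (X ∘ e.symm) v‖ ≤ C)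
    (hW : ContMDiff (𝓡 n) 𝓘(ℝ, EuclideanSpace ℝ (Fin (n + p))) ∞ W)
    (hWt : ∀ q, W q ∈ tangentSpan X q) (hWc : HasCompactSupport W)
    (hWs : tsupport W ⊆ e.source ∩ e ⁻¹' Metric.ball c r)
    (hL : 0 ≤ L) (hη : IsInducedLipschitz X L η) :
    |∫ q, η q * tangentialDivergence X W q ∂(volumeMeasure X)|
      ≤ L * ∫ q, ‖W q‖ ∂(volumeMeasure X) := by
  set B := Metric.ball c r with hB
  set A := fderiv ℝ (X ∘ e.symm) with hA
  set K := e '' tsupport W with hK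
  have hKc : IsCompact K := hWc.isCompact.image_of_continuousOn
    (e.continuousOn.mono fun q hq => (hWs hq).1)
  have hKB : K ⊆ B := by
    rintro _ ⟨q, hq, rfl⟩
    exact (hWs hq).2
  have hnotK : ∀ u ∈ e.target, u ∉ K → e.symm u ∉ tsupport W := fun u hu huK h =>
    huK ⟨e.symm u, h, e.right_inv hu⟩
  -- the density `√(det g) aᵏ` of the field
  set b : EuclideanSpace ℝ (Fin n) → EuclideanSpace ℝ (Fin n) :=
    B.indicator fun v => volumeDensity X e v • projCoord (A v) (W (e.symm v)) with hb
  have hb0 : ∀ u ∉ K, b u = 0 := by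
    intro u hu
    by_cases huB : u ∈ B
    · rw [hb, indicator_of_mem huB, image_eq_zero_of_notMem_tsupport (hnotK u (hball huB) hu),
        projCoord_zero, smul_zero]
    · rw [hb, indicator_of_notMem huB]
  have hbK : ∀ u ∉ K, b =ᶠ[𝓝 u] fun _ => 0 := fun u hu => by
    filter_upwards [hKc.isClosed.isOpen_compl.mem_nhds hu] with v hv using hb0 v hv
  have hbB : ∀ u ∈ B, b =ᶠ[𝓝 u]
      fun v => volumeDensity X e v • projCoord (A v) (W (e.symm v)) := fun u hu => by
    filter_upwards [Metric.isOpen_ball.mem_nhds hu] with v hv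
    rw [hb, indicator_of_mem hv]
  have hWe : ∀ u ∈ e.target, ContDiffAt ℝ ∞ (W ∘ e.symm) u := fun u hu =>
    contDiffAt_comp_chart_symm he hu (hW _)
  have hAe : ∀ u ∈ e.target, ContDiffAt ℝ ∞ A u := fun u hu => hX.contDiffAt_fderiv he hu
  have hbsmooth : ContDiff ℝ ∞ b := by
    rw [contDiff_iff_contDiffAt]
    intro u
    by_cases hu : u ∈ B
    · exact ((contDiffAt_volumeDensity hX he (hball hu)).smul (contDiffAt_projCoord
        (hAe u (hball hu)) (hWe u (hball hu)) (hX.injective_fderiv he (hball hu)))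
        ).congr_of_eventuallyEq (hbB u hu)
    · exact contDiffAt_const.congr_of_eventuallyEq (hbK u fun h => hu (hKB h))
  have hbc : HasCompactSupport b := HasCompactSupport.intro hKc hb0
  have htan : ∀ u ∈ e.target, W (e.symm u) = A u (projCoord (A u) (W (e.symm u))) := by
    intro u hu
    have := hWt (e.symm u)
    rw [tangentSpan_chart hX he hu] at this
    obtain ⟨a, ha⟩ := this
    rw [← ha]
    exact congrArg (A u) (projCoord_apply_self (hX.injective_fderiv he hu) a).symm
  -- the divergence in coordinates
  have hdiv : ∀ u ∈ e.target, volumeDensity X e u * tangentialDivergence X W (e.symm u)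
      = ∑ k, fderiv ℝ b u (EuclideanSpace.single k 1) k := by
    intro u hu
    by_cases huB : u ∈ B
    · rw [(hbB u huB).fderiv_eq, tangentialDivergence_chart hX he hu
        ((hW _).mdifferentiableAt (by simp))]
      refine (sum_fderiv_eq_tangentialTrace (hX.contDiffAt_comp_chart_symm he hu)
        (hX.injective_fderiv he hu) (hWe u hu) ?_).symm
      filter_upwards [e.open_target.mem_nhds hu] with v hv using htan v hv
    · have huK : u ∉ K := fun h => huB (hKB h)
      rw [tangentialDivergence_eq_zero_of_notMem_tsupport (hnotK u hu huK), (hbK u huK).fderiv_eq]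
      simp
  -- a global Lipschitz function which agrees with `η` on the ball
  have hlip : LipschitzOnWith (L * C).toNNReal (η ∘ e.symm) B := by
    refine LipschitzOnWith.of_dist_le_mul fun u hu v hv => ?_
    have h1 := (hη (e.symm u) (e.symm v)).trans
      (mul_le_mul_right (inducedEDist_chart_le_mul hX he hball hC hu hv) _)
    rw [← ENNReal.ofReal_mul hL, ENNReal.ofReal_le_ofReal_iff (by positivity)] at h1
    rw [Real.dist_eq, dist_comm, dist_eq_norm, Real.coe_toNNReal _ (by positivity), mul_assoc]
    exact h1
  obtain ⟨g, hg, hgB⟩ := hlip.extend_real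
  have hηc : Continuous η := hη.continuous hX
  have hint : ∫ q, η q * tangentialDivergence X W q ∂(volumeMeasure X)
      = -∫ u, fderiv ℝ g u (b u) := by
    rw [integral_volumeMeasure_chart hX he (f := fun q => η q * tangentialDivergence X W q)
      (hηc.mul (continuous_tangentialDivergence hX hW)).measurable (fun q hq => by
        rw [tangentialDivergence_eq_zero_of_notMem_tsupport fun h => hq (hWs h).1, mul_zero]),
      ← integral_mul_divergence hg (hbsmooth.of_le (by simp)) hbc,
      ← setIntegral_eq_integral_of_forall_compl_eq_zero (s := e.target)
        (f := fun x => g x * ∑ k, fderiv ℝ b x (EuclideanSpace.single k 1) k)]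
    · refine setIntegral_congr_fun e.open_target.measurableSet fun u hu => ?_
      simp only
      rw [← hdiv u hu]
      by_cases huB : u ∈ B
      · rw [← hgB huB, Function.comp_apply]; ring
      · rw [tangentialDivergence_eq_zero_of_notMem_tsupport
          (hnotK u hu fun h => huB (hKB h))]
        ring
    · intro u hu
      rw [(hbK u fun h => hu (hball (hKB h))).fderiv_eq]
      simp
  have hnorm : ∫ q, ‖W q‖ ∂(volumeMeasure X)
      = ∫ u, B.indicator (fun u => volumeDensity X e u * ‖W (e.symm u)‖) u := by
    rw [integral_volumeMeasure_chart hX he hW.continuous.norm.measurable (fun q hq => by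
        rw [image_eq_zero_of_notMem_tsupport fun h => hq (hWs h).1, norm_zero]),
      integral_indicator Metric.isOpen_ball.measurableSet]
    refine (setIntegral_eq_of_subset_of_forall_sdiff_eq_zero e.open_target.measurableSet hball
      fun u hu => ?_)
    rw [image_eq_zero_of_notMem_tsupport (hnotK u hu.1 fun h => hu.2 (hKB h)), norm_zero, mul_zero]
  have hbound_int : Integrable
      (B.indicator (fun u => volumeDensity X e u * ‖W (e.symm u)‖)) := by
    rw [← integrableOn_iff_integrable_of_support_subset (s := K)]
    · refine ContinuousOn.integrableOn_compact hKc (ContinuousOn.congr (f := fun u =>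
        volumeDensity X e u * ‖W (e.symm u)‖) ?_ fun u hu => indicator_of_mem (hKB hu) _)
      exact ((continuousOn_volumeDensity hX he).mono (hKB.trans hball)).mul
        (hW.continuous.comp_continuousOn (e.continuousOn_symm.mono (hKB.trans hball))).norm
    · intro u hu
      by_contra huK
      refine hu ?_
      by_cases huB : u ∈ B
      · rw [indicator_of_mem huB, image_eq_zero_of_notMem_tsupport (hnotK u (hball huB) huK),
          norm_zero, mul_zero]
      · rw [indicator_of_notMem huB]
  rw [hint, hnorm, abs_neg, ← integral_const_mul, ← Real.norm_eq_abs]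
  refine norm_integral_le_of_norm_le (hbound_int.const_mul L) ?_
  filter_upwards [hg.ae_differentiableAt] with u hu
  by_cases huB : u ∈ B
  · have hgu : g =ᶠ[𝓝 u] η ∘ e.symm := by
      filter_upwards [Metric.isOpen_ball.mem_nhds huB] with v hv using (hgB hv).symm
    rw [indicator_of_mem huB]
    refine (abs_fderiv_le_of_isInducedLipschitz hX he hL hη (hball huB) hgu hu (b u)).trans ?_
    rw [hb, indicator_of_mem huB, map_smul, ← hA, ← htan u (hball huB), norm_smul,
      Real.norm_of_nonneg (volumeDensity_nonneg _)]
  · rw [indicator_of_notMem huB, hb, indicator_of_notMem huB]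
    simp

end DivergenceTheorem

/-! ### The divergence theorem on a complete submanifold -/

section GlobalDivergenceTheorem

variable {n p : ℕ} {M : Type*} [TopologicalSpace M] [ChartedSpace (EuclideanSpace ℝ (Fin n)) M]
  {X W : M → EuclideanSpace ℝ (Fin (n + p))} {q : M} {L : ℝ} {η : M → ℝ}
  [IsManifold (𝓡 n) ∞ M]

lemma tangentialDivergence_sum {ι : Type*} {s : Finset ι}
    {V : ι → M → EuclideanSpace ℝ (Fin (n + p))}
    (hV : ∀ i, ContMDiff (𝓡 n) 𝓘(ℝ, EuclideanSpace ℝ (Fin (n + p))) ∞ (V i)) :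
    tangentialDivergence X (fun z => ∑ i ∈ s, V i z) q
      = ∑ i ∈ s, tangentialDivergence X (V i) q := by
  classical
  have hsum : ∀ t : Finset ι, ContMDiff (𝓡 n) 𝓘(ℝ, EuclideanSpace ℝ (Fin (n + p))) ∞
      (fun z => ∑ i ∈ t, V i z) := fun t => ContMDiff.sum fun i _ => hV i
  induction s using Finset.induction_on with
  | empty =>
    simp only [Finset.sum_empty]
    have : diff n (fun _ : M => (0 : EuclideanSpace ℝ (Fin (n + p)))) q = 0 := mfderiv_const
    rw [tangentialDivergence, this, tangentialTrace_zero]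
  | insert i t hi ih =>
    simp only [Finset.sum_insert hi]
    rw [tangentialDivergence_add ((hV i q).mdifferentiableAt (by simp))
      ((hsum t q).mdifferentiableAt (by simp)), ih]

lemma hasCompactSupport_tangentialDivergence [T2Space M] (hW : HasCompactSupport W) :
    HasCompactSupport (tangentialDivergence X W) :=
  HasCompactSupport.intro hW.isCompact fun _ hq =>
    tangentialDivergence_eq_zero_of_notMem_tsupport hq

variable [MeasurableSpace M] [BorelSpace M] [T2Space M] [SecondCountableTopology M]

/-- The divergence theorem for compactly supported tangential fields, tested against a function
`η` which is only Lipschitz. -/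
lemma abs_integral_mul_tangentialDivergence_le (hX : IsSmoothImmersion X)
    (hW : ContMDiff (𝓡 n) 𝓘(ℝ, EuclideanSpace ℝ (Fin (n + p))) ∞ W)
    (hWt : ∀ q, W q ∈ tangentSpan X q) (hWc : HasCompactSupport W)
    (hL : 0 ≤ L) (hη : IsInducedLipschitz X L η) :
    |∫ q, η q * tangentialDivergence X W q ∂(volumeMeasure X)|
      ≤ L * ∫ q, ‖W q‖ ∂(volumeMeasure X) := by
  have := isLocallyFiniteMeasure_volumeMeasure hX
  have : LocallyCompactSpace M := ChartedSpace.locallyCompactSpace (EuclideanSpace ℝ (Fin n)) M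
  choose r hr C hC0 hball hC using fun q : M => exists_ball_bound_fderiv hX
    (chart_mem_atlas (EuclideanSpace ℝ (Fin n)) q)
    ((chartAt (EuclideanSpace ℝ (Fin n)) q).map_source (mem_chart_source _ q))
  obtain ⟨f, hf⟩ := SmoothPartitionOfUnity.exists_isSubordinate (𝓡 n) (isClosed_tsupport W)
    (fun q : M => (chartAt (EuclideanSpace ℝ (Fin n)) q).source ∩
      chartAt (EuclideanSpace ℝ (Fin n)) q ⁻¹'
        Metric.ball (chartAt (EuclideanSpace ℝ (Fin n)) q q) (r q))
    (fun q => (chartAt (EuclideanSpace ℝ (Fin n)) q).isOpen_inter_preimage Metric.isOpen_ball)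
    (fun q _ => mem_iUnion.2 ⟨q, mem_chart_source _ q, Metric.mem_ball_self (hr q)⟩)
  have hfin := f.locallyFinite.finite_nonempty_inter_compact hWc.isCompact
  set V : M → M → EuclideanSpace ℝ (Fin (n + p)) := fun i z => f i z • W z with hV
  have hVs : ∀ i, ContMDiff (𝓡 n) 𝓘(ℝ, EuclideanSpace ℝ (Fin (n + p))) ∞ (V i) :=
    fun i => (f i).contMDiff.smul hW
  have hVc : ∀ i, HasCompactSupport (V i) := fun i =>
    HasCompactSupport.intro hWc.isCompact fun z hz => by
      simp only [hV, image_eq_zero_of_notMem_tsupport hz, smul_zero]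
  have hVt : ∀ i, tsupport (V i) ⊆ tsupport (f i) := fun i =>
    closure_mono fun z hz => by
      simp only [hV, Function.mem_support, ne_eq, smul_eq_zero, not_or] at hz
      exact hz.1
  have hone : ∀ z ∈ tsupport W, ∑ i ∈ hfin.toFinset, f i z = 1 := by
    intro z hz
    rw [← f.sum_eq_one hz]
    refine (finsum_eq_sum_of_support_subset _ fun i hi => ?_).symm
    simp only [Finite.coe_toFinset, mem_ofPred_eq]
    exact ⟨z, hi, hz⟩
  have hWsum : W = fun z => ∑ i ∈ hfin.toFinset, V i z := by
    funext z
    simp only [hV]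
    rw [← Finset.sum_smul]
    by_cases hz : z ∈ tsupport W
    · rw [hone z hz, one_smul]
    · rw [image_eq_zero_of_notMem_tsupport hz, smul_zero]
  have hnsum : ∀ z, ‖W z‖ = ∑ i ∈ hfin.toFinset, ‖V i z‖ := by
    intro z
    simp only [hV, norm_smul, Real.norm_of_nonneg (f.nonneg _ z)]
    rw [← Finset.sum_mul]
    by_cases hz : z ∈ tsupport W
    · rw [hone z hz, one_mul]
    · rw [image_eq_zero_of_notMem_tsupport hz, norm_zero, mul_zero]
  have hdsum : ∀ z, η z * tangentialDivergence X W z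
      = ∑ i ∈ hfin.toFinset, η z * tangentialDivergence X (V i) z := by
    intro z
    rw [← Finset.mul_sum, ← tangentialDivergence_sum hVs, ← hWsum]
  have hi1 : ∀ i ∈ hfin.toFinset, Integrable (fun z => η z * tangentialDivergence X (V i) z)
      (volumeMeasure X) := fun i _ =>
    ((hη.continuous hX).mul
      (continuous_tangentialDivergence hX (hVs i))).integrable_of_hasCompactSupport
      (hasCompactSupport_tangentialDivergence (hVc i)).mul_left
  have hi2 : ∀ i ∈ hfin.toFinset, Integrable (fun z => ‖V i z‖) (volumeMeasure X) :=
    fun i _ => (hVs i).continuous.norm.integrable_of_hasCompactSupport (hVc i).norm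
  simp only [hnsum, hdsum]
  rw [integral_finsetSum _ hi1, integral_finsetSum _ hi2, Finset.mul_sum]
  refine (Finset.abs_sum_le_sum_abs _ _).trans (Finset.sum_le_sum fun i _ => ?_)
  exact abs_integral_mul_tangentialDivergence_le_of_ball hX (chart_mem_atlas _ i) (hC0 i) (hball i)
    (hC i) (hVs i) (fun q => Submodule.smul_mem _ _ (hWt q)) (hVc i) ((hVt i).trans (hf i)) hL hη

/-- The divergence theorem on a complete `M`, for integrable tangential fields with integrable
divergence. -/
lemma integral_tangentialDivergence_eq_zero (hX : IsSmoothImmersion X)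
    (hc : IsCompleteImmersion X)
    (hW : ContMDiff (𝓡 n) 𝓘(ℝ, EuclideanSpace ℝ (Fin (n + p))) ∞ W)
    (hWt : ∀ q, W q ∈ tangentSpan X q) (hWi : Integrable W (volumeMeasure X))
    (hdi : Integrable (tangentialDivergence X W) (volumeMeasure X)) :
    ∫ q, tangentialDivergence X W q ∂(volumeMeasure X) = 0 := by
  have : LocallyCompactSpace M := ChartedSpace.locallyCompactSpace (EuclideanSpace ℝ (Fin n)) M
  obtain ⟨η, hη01, hηc, hηL, hηt⟩ := hc.exists_cutoff hX
  -- multiplying `W` by a smooth `χ` equal to `1` on the support of `η k` changes nothing but makes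
  -- the support compact
  have hbound : ∀ k : ℕ, |∫ q, η k q * tangentialDivergence X W q ∂(volumeMeasure X)|
      ≤ 1 / ((k : ℝ) + 1) * ∫ q, ‖W q‖ ∂(volumeMeasure X) := by
    intro k
    obtain ⟨T, hT, hTs⟩ := exists_compact_superset (hηc k).isCompact
    obtain ⟨χ, hχ1, hχ0, hχ⟩ := exists_contMDiffMap_one_nhds_of_subset_interior
      (n := (⊤ : ℕ∞)) (𝓡 n) (isClosed_tsupport (η k)) hTs
    have hχW : ContMDiff (𝓡 n) 𝓘(ℝ, EuclideanSpace ℝ (Fin (n + p))) ∞ (fun z => χ z • W z) :=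
      χ.contMDiff.smul hW
    have hχc : HasCompactSupport (fun z => χ z • W z) :=
      HasCompactSupport.intro hT fun z hz => by rw [hχ0 z hz, zero_smul]
    have h1 := abs_integral_mul_tangentialDivergence_le hX hχW
      (fun q => Submodule.smul_mem _ _ (hWt q)) hχc (by positivity) (hηL k)
    have h2 : ∀ z, η k z * tangentialDivergence X (fun z => χ z • W z) z
        = η k z * tangentialDivergence X W z := by
      intro z
      by_cases hz : z ∈ tsupport (η k)
      · have h3 : (fun z => χ z • W z) =ᶠ[𝓝 z] W := by
          filter_upwards [hχ1.filter_mono (nhds_le_nhdsSet hz)] with w hw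
          rw [hw, one_smul]
        rw [tangentialDivergence, diff_congr h3]
        rfl
      · rw [image_eq_zero_of_notMem_tsupport hz, zero_mul, zero_mul]
    simp only [h2] at h1
    refine h1.trans (mul_le_mul_of_nonneg_left ?_ (by positivity))
    refine integral_mono_of_nonneg (Eventually.of_forall fun z => norm_nonneg _) hWi.norm
      (Eventually.of_forall fun z => ?_)
    simp only [norm_smul, Real.norm_of_nonneg (hχ z).1]
    exact mul_le_of_le_one_left (norm_nonneg _) (hχ z).2
  have hlim : Tendsto (fun k => ∫ q, η k q * tangentialDivergence X W q ∂(volumeMeasure X)) atTop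
      (𝓝 (∫ q, tangentialDivergence X W q ∂(volumeMeasure X))) := by
    refine tendsto_integral_of_dominated_convergence (fun q => ‖tangentialDivergence X W q‖)
      (fun k => (((hηL k).continuous hX).mul
        (continuous_tangentialDivergence hX hW)).aestronglyMeasurable) hdi.norm
      (fun k => Eventually.of_forall fun q => ?_) (Eventually.of_forall fun q => ?_)
    · rw [norm_mul, Real.norm_of_nonneg (hη01 k q).1]
      exact mul_le_of_le_one_left (norm_nonneg _) (hη01 k q).2
    · simpa using (hηt q).mul_const (tangentialDivergence X W q)
  have hlim0 : Tendsto (fun k => ∫ q, η k q * tangentialDivergence X W q ∂(volumeMeasure X)) atTop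
      (𝓝 0) := by
    refine squeeze_zero_norm hbound ?_
    simpa using (tendsto_one_div_add_atTop_nhds_zero_nat (𝕜 := ℝ)).mul_const
      (∫ q, ‖W q‖ ∂(volumeMeasure X))
  exact tendsto_nhds_unique hlim hlim0

end GlobalDivergenceTheorem

/-! ### Derivatives of families of maps -/

section ParametricDerivatives

variable {n : ℕ} {F : Type*} [NormedAddCommGroup F] [InnerProductSpace ℝ F]
  {G : ℝ × EuclideanSpace ℝ (Fin n) → F} {s : ℝ} {u : EuclideanSpace ℝ (Fin n)}

lemma fderiv_slice (hG : DifferentiableAt ℝ G (s, u)) :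
    fderiv ℝ (fun v => G (s, v)) u
      = fderiv ℝ G (s, u) ∘L ContinuousLinearMap.inr ℝ ℝ (EuclideanSpace ℝ (Fin n)) :=
  (hG.hasFDerivAt.comp u (hasFDerivAt_prodMk_right s u)).fderiv

lemma hasDerivAt_slice (hG : DifferentiableAt ℝ G (s, u)) :
    HasDerivAt (fun r => G (r, u)) (fderiv ℝ G (s, u) (1, 0)) s := by
  have h := (hG.hasFDerivAt.comp s (hasFDerivAt_prodMk_left s u)).hasDerivAt
  simpa using! h

lemma contDiffAt_fderiv_slice (hG : ContDiffAt ℝ ∞ G (s, u)) :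
    ContDiffAt ℝ ∞ (fun z : ℝ × EuclideanSpace ℝ (Fin n) =>
      fderiv ℝ (fun v => G (z.1, v)) z.2) (s, u) := by
  refine ContDiffAt.fderiv (f := fun (z : ℝ × EuclideanSpace ℝ (Fin n)) v => G (z.1, v))
    (g := Prod.snd) (n := ∞) (m := ∞) ?_ contDiffAt_snd (by simp)
  exact ContDiffAt.comp (g := G) ((s, u), u) hG
    ((contDiffAt_fst.comp _ contDiffAt_fst).prodMk contDiffAt_snd)

lemma eventually_differentiableAt (hG : ContDiffAt ℝ ∞ G (s, u)) :
    ∀ᶠ z in 𝓝 (s, u), DifferentiableAt ℝ G z := by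
  filter_upwards [(hG.of_le (m := 1) (by simp)).eventually (by simp)] with z hz
  exact hz.differentiableAt one_ne_zero

lemma contDiffAt_deriv_slice (hG : ContDiffAt ℝ ∞ G (s, u)) :
    ContDiffAt ℝ ∞ (fun v => deriv (fun r => G (r, v)) s) u := by
  have hc : ContDiffAt ℝ ∞ (fun v => fderiv ℝ G (s, v) ((1 : ℝ), 0)) u := by
    have h1 : ContDiffAt ℝ ∞ (fderiv ℝ G) (s, u) := hG.fderiv_right (by simp)
    exact (ContDiffAt.comp (g := fderiv ℝ G) u h1
      (contDiffAt_const.prodMk contDiffAt_id)).clm_apply contDiffAt_const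
  refine hc.congr_of_eventuallyEq ?_
  have ht : Tendsto (fun v => (s, v)) (𝓝 u) (𝓝 (s, u)) :=
    (Continuous.prodMk continuous_const continuous_id).tendsto u
  filter_upwards [ht.eventually (eventually_differentiableAt hG)] with v hv
  exact (hasDerivAt_slice hv).deriv

/-- The derivatives in the parameter and in the space variable commute. -/
lemma hasDerivAt_fderiv_slice (hG : ContDiffAt ℝ ∞ G (s, u)) :
    HasDerivAt (fun r => fderiv ℝ (fun v => G (r, v)) u)
      (fderiv ℝ (fun v => deriv (fun r => G (r, v)) s) u) s := by
  have hd : DifferentiableAt ℝ (fderiv ℝ G) (s, u) :=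
    (hG.fderiv_right (m := ∞) (by simp)).differentiableAt (by simp)
  have hev := eventually_differentiableAt hG
  have ht : Tendsto (fun v => (s, v)) (𝓝 u) (𝓝 (s, u)) :=
    (Continuous.prodMk continuous_const continuous_id).tendsto u
  have ht' : Tendsto (fun r => (r, u)) (𝓝 s) (𝓝 (s, u)) :=
    (Continuous.prodMk continuous_id continuous_const).tendsto s
  have h1 : HasDerivAt (fun r => fderiv ℝ (fun v => G (r, v)) u)
      ((fderiv ℝ (fderiv ℝ G) (s, u) (1, 0)) ∘L
        ContinuousLinearMap.inr ℝ ℝ (EuclideanSpace ℝ (Fin n))) s := by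
    have h2 : HasDerivAt (fun r => fderiv ℝ G (r, u)) (fderiv ℝ (fderiv ℝ G) (s, u) (1, 0)) s := by
      have h := (hd.hasFDerivAt.comp s (hasFDerivAt_prodMk_left s u)).hasDerivAt
      simpa using! h
    have h3 := (((ContinuousLinearMap.compL ℝ (EuclideanSpace ℝ (Fin n))
      (ℝ × EuclideanSpace ℝ (Fin n)) F).flip
      (ContinuousLinearMap.inr ℝ ℝ (EuclideanSpace ℝ (Fin n)))).hasFDerivAt.comp_hasDerivAt s h2)
    refine HasDerivAt.congr_of_eventuallyEq h3 ?_
    filter_upwards [ht'.eventually hev] with r hr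
    exact fderiv_slice hr
  have h4 : fderiv ℝ (fun v => deriv (fun r => G (r, v)) s) u
      = fderiv ℝ (fun v => fderiv ℝ G (s, v) ((1 : ℝ), 0)) u := by
    refine Filter.EventuallyEq.fderiv_eq (𝕜 := ℝ) ?_
    filter_upwards [ht.eventually hev] with v hv
    exact (hasDerivAt_slice hv).deriv
  have h5 : HasFDerivAt (fun v => fderiv ℝ G (s, v)) (fderiv ℝ (fderiv ℝ G) (s, u) ∘L
      ContinuousLinearMap.inr ℝ ℝ (EuclideanSpace ℝ (Fin n))) u :=
    hd.hasFDerivAt.comp u (hasFDerivAt_prodMk_right s u)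
  have h6 := (h5.clm_apply (hasFDerivAt_const ((1 : ℝ), (0 : EuclideanSpace ℝ (Fin n))) u)).fderiv
  rw [h4, h6]
  convert! h1 using 1
  ext w
  have := (hG.isSymmSndFDerivAt (by simpa using ENat.LEInfty.out)) (1, 0) (0, w)
  simp [this]

end ParametricDerivatives

/-! ### The Gaussian kernel -/

section Gaussian

variable {F : Type*} [NormedAddCommGroup F] [InnerProductSpace ℝ F]

/-- The Gaussian `(4πt)^{-n/2} exp(-|x - ξ|² / (4t))`. -/
def gaussianKernel (n : ℕ) (ξ : F) (t : ℝ) (x : F) : ℝ :=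
  (4 * Real.pi * t) ^ (-(n : ℝ) / 2) * Real.exp (-‖x - ξ‖ ^ 2 / (4 * t))

variable {n : ℕ}

lemma gaussianKernel_pos {t : ℝ} (ht : 0 < t) (ξ x : F) : 0 < gaussianKernel n ξ t x := by
  unfold gaussianKernel
  positivity

lemma hasDerivAt_gaussianKernel {ξ y : ℝ → F} {τ : ℝ → ℝ} {ξ' y' : F} {τ' s : ℝ}
    (hξ : HasDerivAt ξ ξ' s) (hτ : HasDerivAt τ τ' s) (hy : HasDerivAt y y' s) (hpos : 0 < τ s) :
    HasDerivAt (fun r => gaussianKernel n (ξ r) (τ r) (y r))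
      (gaussianKernel n (ξ s) (τ s) (y s) * (-(n * τ' / (2 * τ s))
        + ‖y s - ξ s‖ ^ 2 * τ' / (4 * τ s ^ 2)
        - inner ℝ (y s - ξ s) (y' - ξ') / (2 * τ s))) s := by
  have h1 : HasDerivAt (fun r => (4 * Real.pi * τ r) ^ (-(n : ℝ) / 2)) _ s :=
    (hτ.const_mul (4 * Real.pi)).rpow_const (p := -(n : ℝ) / 2) (Or.inl (by positivity))
  have h2 := ((hy.sub hξ).norm_sq.neg.div (hτ.const_mul 4) (by positivity)).exp
  have h3 := h1.mul h2
  unfold gaussianKernel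
  refine h3.congr_deriv ?_
  have h4 : (4 * Real.pi * τ s) ^ (-(n : ℝ) / 2 - 1)
      = (4 * Real.pi * τ s) ^ (-(n : ℝ) / 2) / (4 * Real.pi * τ s) := by
    rw [Real.rpow_sub_one (by positivity)]
  rw [h4]
  simp only [Pi.div_apply, Pi.neg_apply, Pi.sub_apply]
  have := hpos.ne'
  have := Real.pi_ne_zero
  field_simp
  ring

lemma contDiffAt_gaussianKernel {P : Type*} [NormedAddCommGroup P] [NormedSpace ℝ P]
    {r : WithTop ℕ∞} {ξ y : P → F} {τ : P → ℝ} {a : P} (hξ : ContDiffAt ℝ r ξ a)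
    (hτ : ContDiffAt ℝ r τ a) (hy : ContDiffAt ℝ r y a) (hpos : 0 < τ a) :
    ContDiffAt ℝ r (fun z => gaussianKernel n (ξ z) (τ z) (y z)) a := by
  unfold gaussianKernel
  refine ContDiffAt.mul ?_ ?_
  · exact (contDiffAt_const.mul hτ).rpow_const_of_ne (by positivity)
  · exact (((hy.sub hξ).norm_sq ℝ).neg.div (contDiffAt_const.mul hτ) (by positivity)).exp

end Gaussian

/-! ### Derivative of the integrand along a variation -/

section Variation

variable {n p : ℕ} {M : Type*} [TopologicalSpace M] [ChartedSpace (EuclideanSpace ℝ (Fin n)) M]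
  {e : OpenPartialHomeomorph M (EuclideanSpace ℝ (Fin n))}
  {X Z : M → EuclideanSpace ℝ (Fin (n + p))} {q : M} [IsManifold (𝓡 n) ∞ M]
  {x₀ : EuclideanSpace ℝ (Fin (n + p))} {t₀ ε : ℝ} {Y : ℝ → M → EuclideanSpace ℝ (Fin (n + p))}
  {ξ : ℝ → EuclideanSpace ℝ (Fin (n + p))} {τ : ℝ → ℝ} {s : ℝ} {u : EuclideanSpace ℝ (Fin n)}

/-- The integrand of the functional along a variation, as a density with respect to the volume
measure of `X`. -/
def energyDensity (X : M → EuclideanSpace ℝ (Fin (n + p)))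
    (Y : ℝ → M → EuclideanSpace ℝ (Fin (n + p)))
    (ξ : ℝ → EuclideanSpace ℝ (Fin (n + p))) (τ : ℝ → ℝ) (s : ℝ) (q : M) : ℝ :=
  gaussianKernel n (ξ s) (τ s) (Y s q) * volumeRatio X (Y s) q

/-- The derivative of the integrand at the centre `x₀` and the scale `t₀`, for the variation field
`V` and the velocities `ξ'` and `τ'` of centre and scale. -/
def firstVariationDensity (X : M → EuclideanSpace ℝ (Fin (n + p)))
    (x₀ : EuclideanSpace ℝ (Fin (n + p))) (t₀ : ℝ) (V : M → EuclideanSpace ℝ (Fin (n + p)))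
    (ξ' : EuclideanSpace ℝ (Fin (n + p))) (τ' : ℝ) (q : M) : ℝ :=
  gaussianKernel n x₀ t₀ (X q) * (-(n * τ' / (2 * t₀)) + ‖X q - x₀‖ ^ 2 * τ' / (4 * t₀ ^ 2)
    - inner ℝ (X q - x₀) (V q - ξ') / (2 * t₀) + tangentialDivergence X V q)

namespace IsNormalVariation

lemma zero_mem (h : IsNormalVariation X x₀ t₀ ε Y ξ τ) : (0 : ℝ) ∈ Ioo (-ε) ε :=
  ⟨neg_lt_zero.2 h.pos, h.pos⟩

lemma contDiffAt_chart (h : IsNormalVariation X x₀ t₀ ε Y ξ τ)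
    (he : e ∈ atlas (EuclideanSpace ℝ (Fin n)) M) (hs : s ∈ Ioo (-ε) ε) (hu : u ∈ e.target) :
    ContDiffAt ℝ ∞ (fun z : ℝ × EuclideanSpace ℝ (Fin n) => Y z.1 (e.symm z.2)) (s, u) := by
  rw [← contMDiffAt_iff_contDiffAt]
  have h1 : ContMDiffAt (𝓘(ℝ, ℝ).prod (𝓡 n)) 𝓘(ℝ, EuclideanSpace ℝ (Fin (n + p))) ∞
      (fun z : ℝ × M => Y z.1 z.2) (s, e.symm u) :=
    (h.smooth _ ⟨hs, mem_univ _⟩).contMDiffAt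
      ((isOpen_Ioo.prod isOpen_univ).mem_nhds ⟨hs, mem_univ _⟩)
  have h2 : ContMDiffAt 𝓘(ℝ, ℝ × EuclideanSpace ℝ (Fin n)) (𝓡 n) ∞
      (fun z : ℝ × EuclideanSpace ℝ (Fin n) => e.symm z.2) (s, u) :=
    ContMDiffAt.comp (g := e.symm) (I' := 𝓡 n) (s, u)
      ((contMDiffOn_symm_of_mem_maximalAtlas
        (IsManifold.subset_maximalAtlas (I := 𝓡 n) (n := ∞) he)).contMDiffAt
        (e.open_target.mem_nhds hu)) contDiffAt_snd.contMDiffAt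
  exact ContMDiffAt.comp (g := fun z : ℝ × M => Y z.1 z.2) (s, u) h1
    ((contDiffAt_fst.contMDiffAt (n := ∞)).prodMk h2)

lemma contDiffAt_center (h : IsNormalVariation X x₀ t₀ ε Y ξ τ) (hs : s ∈ Ioo (-ε) ε) :
    ContDiffAt ℝ ∞ ξ s := h.smooth_center.contDiffAt (isOpen_Ioo.mem_nhds hs)

lemma contDiffAt_scale (h : IsNormalVariation X x₀ t₀ ε Y ξ τ) (hs : s ∈ Ioo (-ε) ε) :
    ContDiffAt ℝ ∞ τ s := h.smooth_scale.contDiffAt (isOpen_Ioo.mem_nhds hs)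

lemma isSmoothImmersion (h : IsNormalVariation X x₀ t₀ ε Y ξ τ) : IsSmoothImmersion X := by
  have := h.immersion 0 h.zero_mem
  rwa [h.zero] at this

lemma contMDiff_deriv (h : IsNormalVariation X x₀ t₀ ε Y ξ τ) :
    ContMDiff (𝓡 n) 𝓘(ℝ, EuclideanSpace ℝ (Fin (n + p))) ∞ (fun q => deriv (fun s => Y s q) 0) := by
  intro q
  refine contMDiffAt_of_comp_chart_symm (chart_mem_atlas (EuclideanSpace ℝ (Fin n)) q)
    (mem_chart_source _ q) ?_
  exact contDiffAt_deriv_slice (h.contDiffAt_chart (chart_mem_atlas _ q) h.zero_mem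
    (mem_chart_target _ q))

lemma hasDerivAt_point (h : IsNormalVariation X x₀ t₀ ε Y ξ τ) (q : M) :
    HasDerivAt (fun s => Y s q) (deriv (fun s => Y s q) 0) 0 := by
  have h1 := (h.contDiffAt_chart (chart_mem_atlas (EuclideanSpace ℝ (Fin n)) q) h.zero_mem
    (mem_chart_target _ q)).differentiableAt (by simp)
  have h2 := hasDerivAt_slice h1
  simp only [(chartAt (EuclideanSpace ℝ (Fin n)) q).left_inv (mem_chart_source _ q)] at h2
  exact h2.differentiableAt.hasDerivAt

/-- The first variation of the volume element is the tangential divergence of the variation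
field. -/
lemma hasDerivAt_volumeRatio (h : IsNormalVariation X x₀ t₀ ε Y ξ τ) (q : M) :
    HasDerivAt (fun s => volumeRatio X (Y s) q)
      (tangentialDivergence X (fun q => deriv (fun s => Y s q) 0) q) 0 := by
  set e := chartAt (EuclideanSpace ℝ (Fin n)) q with he_def
  have he : e ∈ atlas (EuclideanSpace ℝ (Fin n)) M := chart_mem_atlas _ q
  have hq : e.symm (e q) = q := e.left_inv (mem_chart_source _ q)
  have hu : e q ∈ e.target := mem_chart_target _ q
  have hX := h.isSmoothImmersion
  have hG := h.contDiffAt_chart he h.zero_mem hu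
  have h1 := hasDerivAt_fderiv_slice hG
  have hX0 : (fun v => Y 0 (e.symm v)) = X ∘ e.symm := by
    rw [h.zero]
    rfl
  have h2 := hasDerivAt_sqrt_det_crossGram h1 (by
    simp only [hX0]
    exact hX.injective_fderiv he hu)
  simp only [hX0] at h2
  have h3 := h2.div_const (volumeDensity X e (e q))
  have h4 := tangentialDivergence_chart hX he hu (Z := fun q => deriv (fun s => Y s q) 0)
    ((h.contMDiff_deriv _).mdifferentiableAt (by simp))
  rw [hq] at h4
  have h5 : volumeDensity X e (e q)
      = √(crossGram (fderiv ℝ (X ∘ e.symm) (e q)) (fderiv ℝ (X ∘ e.symm) (e q))).det := rfl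
  have h6 := volumeDensity_pos hX he hu
  rw [← h5, mul_div_cancel_left₀ _ h6.ne'] at h3
  rw [h4]
  refine HasDerivAt.congr_of_eventuallyEq h3 ?_
  filter_upwards [isOpen_Ioo.mem_nhds h.zero_mem] with s hs
  have h7 := volumeRatio_comp_chart_symm hX (h.immersion s hs) he hu
  rw [hq] at h7
  exact h7

/-- The first variation of the integrand. -/
lemma hasDerivAt_energyDensity (h : IsNormalVariation X x₀ t₀ ε Y ξ τ) (q : M) :
    HasDerivAt (fun s => energyDensity X Y ξ τ s q)
      (firstVariationDensity X x₀ t₀ (fun q => deriv (fun s => Y s q) 0) (deriv ξ 0) (deriv τ 0) q)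
      0 := by
  have h1 := hasDerivAt_gaussianKernel (n := n)
    ((h.contDiffAt_center h.zero_mem).differentiableAt (by simp)).hasDerivAt
    ((h.contDiffAt_scale h.zero_mem).differentiableAt (by simp)).hasDerivAt
    (h.hasDerivAt_point q) (h.scale_pos 0 h.zero_mem)
  have h2 := h1.mul (h.hasDerivAt_volumeRatio q)
  refine h2.congr_deriv ?_
  simp only [h.center_zero, h.scale_zero, h.zero, volumeRatio_self h.isSmoothImmersion,
    firstVariationDensity]
  ring

lemma contDiffAt_energyDensity (h : IsNormalVariation X x₀ t₀ ε Y ξ τ)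
    (he : e ∈ atlas (EuclideanSpace ℝ (Fin n)) M) (hs : s ∈ Ioo (-ε) ε) (hu : u ∈ e.target) :
    ContDiffAt ℝ ∞ (fun z : ℝ × EuclideanSpace ℝ (Fin n) =>
      energyDensity X Y ξ τ z.1 (e.symm z.2)) (s, u) := by
  have hX := h.isSmoothImmersion
  have hG := h.contDiffAt_chart he hs hu
  have h1 : ContDiffAt ℝ ∞ (fun z : ℝ × EuclideanSpace ℝ (Fin n) =>
      volumeDensity (Y z.1) e z.2 / volumeDensity X e z.2) (s, u) := by
    refine ContDiffAt.div ?_ ?_ (volumeDensity_pos hX he hu).ne'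
    · exact contDiffAt_sqrt_det_crossGram (contDiffAt_fderiv_slice hG)
        ((h.immersion s hs).injective_fderiv he hu)
    · exact ContDiffAt.comp (g := volumeDensity X e) (s, u) (contDiffAt_volumeDensity hX he hu)
        contDiffAt_snd
  have h2 := (contDiffAt_gaussianKernel (n := n)
    (ContDiffAt.comp (g := ξ) (s, u) (h.contDiffAt_center hs) contDiffAt_fst)
    (ContDiffAt.comp (g := τ) (s, u) (h.contDiffAt_scale hs) contDiffAt_fst) hG
    (h.scale_pos s hs)).mul h1
  refine h2.congr_of_eventuallyEq ?_
  filter_upwards [(isOpen_Ioo.prod e.open_target).mem_nhds ⟨hs, hu⟩] with z hz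
  rw [energyDensity, volumeRatio_comp_chart_symm hX (h.immersion _ hz.1) he hz.2]
  rfl

end IsNormalVariation

end Variation

/-! ### The first variation formula -/

section FirstVariation

variable {n p : ℕ} {M : Type*} [TopologicalSpace M] [ChartedSpace (EuclideanSpace ℝ (Fin n)) M]
  {X : M → EuclideanSpace ℝ (Fin (n + p))} [IsManifold (𝓡 n) ∞ M]
  {x₀ : EuclideanSpace ℝ (Fin (n + p))} {t₀ ε : ℝ} {Y : ℝ → M → EuclideanSpace ℝ (Fin (n + p))}
  {ξ : ℝ → EuclideanSpace ℝ (Fin (n + p))} {τ : ℝ → ℝ}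

lemma continuous_gaussianKernel_comp {Z : M → EuclideanSpace ℝ (Fin (n + p))} (hZ : Continuous Z)
    (x : EuclideanSpace ℝ (Fin (n + p))) (t : ℝ) :
    Continuous (fun q => gaussianKernel n x t (Z q)) := by
  unfold gaussianKernel
  fun_prop

lemma continuous_firstVariationDensity (hX : IsSmoothImmersion X)
    {V : M → EuclideanSpace ℝ (Fin (n + p))}
    (hV : ContMDiff (𝓡 n) 𝓘(ℝ, EuclideanSpace ℝ (Fin (n + p))) ∞ V)
    (ξ' : EuclideanSpace ℝ (Fin (n + p))) (τ' : ℝ) :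
    Continuous (firstVariationDensity X x₀ t₀ V ξ' τ') := by
  have h1 := hX.smooth.continuous
  have h2 := hV.continuous
  have h3 := continuous_tangentialDivergence hX hV
  have h4 := continuous_gaussianKernel_comp h1 x₀ t₀
  unfold firstVariationDensity
  fun_prop

lemma IsNormalVariation.continuous_energyDensity (h : IsNormalVariation X x₀ t₀ ε Y ξ τ) {s : ℝ}
    (hs : s ∈ Ioo (-ε) ε) : Continuous (energyDensity X Y ξ τ s) :=
  (continuous_gaussianKernel_comp (h.immersion s hs).smooth.continuous _ _).mul
    (continuous_volumeRatio h.isSmoothImmersion (h.immersion s hs))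

/-- On a compact set the integrand is Lipschitz in the parameter, uniformly in the point. -/
lemma IsNormalVariation.exists_lipschitz_of_isCompact (h : IsNormalVariation X x₀ t₀ ε Y ξ τ)
    {K : Set M} (hK : IsCompact K) :
    ∃ δ > 0, ∃ C : ℝ, 0 ≤ C ∧ ∀ q ∈ K, ∀ s ∈ Metric.ball (0 : ℝ) δ, ∀ r ∈ Metric.ball (0 : ℝ) δ,
      |energyDensity X Y ξ τ s q - energyDensity X Y ξ τ r q| ≤ C * |s - r| := by
  refine hK.induction_on (p := fun K => ∃ δ > 0, ∃ C : ℝ, 0 ≤ C ∧ ∀ q ∈ K,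
    ∀ s ∈ Metric.ball (0 : ℝ) δ, ∀ r ∈ Metric.ball (0 : ℝ) δ,
      |energyDensity X Y ξ τ s q - energyDensity X Y ξ τ r q| ≤ C * |s - r|) ?_ ?_ ?_ ?_
  · exact ⟨1, one_pos, 0, le_rfl, fun q hq => hq.elim⟩
  · rintro S T hST ⟨δ, hδ, C, hC, H⟩
    exact ⟨δ, hδ, C, hC, fun q hq => H q (hST hq)⟩
  · rintro S T ⟨δ, hδ, C, hC, H⟩ ⟨δ', hδ', C', hC', H'⟩
    refine ⟨min δ δ', lt_min hδ hδ', max C C', hC.trans (le_max_left _ _), ?_⟩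
    rintro q (hq | hq) s hs r hr
    · exact (H q hq s (Metric.ball_subset_ball (min_le_left _ _) hs) r
        (Metric.ball_subset_ball (min_le_left _ _) hr)).trans
        (mul_le_mul_of_nonneg_right (le_max_left _ _) (abs_nonneg _))
    · exact (H' q hq s (Metric.ball_subset_ball (min_le_right _ _) hs) r
        (Metric.ball_subset_ball (min_le_right _ _) hr)).trans
        (mul_le_mul_of_nonneg_right (le_max_right _ _) (abs_nonneg _))
  · intro q hq
    set e := chartAt (EuclideanSpace ℝ (Fin n)) q with he_def
    have he : e ∈ atlas (EuclideanSpace ℝ (Fin n)) M := chart_mem_atlas _ q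
    obtain ⟨C, t, ht, hC⟩ := ((h.contDiffAt_energyDensity he h.zero_mem
      (mem_chart_target _ q)).of_le (m := 1) (by simp)).exists_lipschitzOnWith
    obtain ⟨δ, hδ, hball⟩ := Metric.mem_nhds_iff.1 ht
    rw [← ball_prod_same] at hball
    refine ⟨e.source ∩ e ⁻¹' Metric.ball (e q) δ, mem_nhdsWithin_of_mem_nhds
      ((e.isOpen_inter_preimage Metric.isOpen_ball).mem_nhds
        ⟨mem_chart_source _ q, Metric.mem_ball_self hδ⟩), δ, hδ, C, C.2, ?_⟩
    intro z hz s hs r hr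
    have h1 := hC.dist_le_mul (s, e z) (hball ⟨hs, hz.2⟩) (r, e z) (hball ⟨hr, hz.2⟩)
    simp only [e.left_inv hz.1, Prod.dist_eq, dist_self, Real.dist_eq] at h1
    rwa [max_eq_left (abs_nonneg _)] at h1

variable [MeasurableSpace M] [BorelSpace M] [SecondCountableTopology M]

lemma integrable_gaussianWeight_iff (hX : IsSmoothImmersion X)
    {Z : M → EuclideanSpace ℝ (Fin (n + p))} (hZ : IsSmoothImmersion Z)
    (x : EuclideanSpace ℝ (Fin (n + p))) {t : ℝ} (ht : 0 < t) :
    Integrable (gaussianWeight Z x t) (volumeMeasure Z) ↔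
      Integrable (fun q => gaussianKernel n x t (Z q) * volumeRatio X Z q) (volumeMeasure X) := by
  rw [volumeMeasure_eq_withDensity hX hZ, integrable_withDensity_iff
    (continuous_volumeRatio hX hZ).measurable.ennreal_ofReal
    (Eventually.of_forall fun _ => ENNReal.ofReal_lt_top)]
  simp only [ENNReal.toReal_ofReal (volumeRatio_nonneg _)]
  have hc : IsUnit ((4 * Real.pi * t) ^ (-(n : ℝ) / 2)) :=
    isUnit_iff_ne_zero.2 (by positivity)
  rw [← integrable_const_mul_iff hc]
  refine iff_of_eq (congrArg (Integrable · (volumeMeasure X)) ?_)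
  funext q
  simp only [gaussianKernel, gaussianWeight, mul_assoc]

lemma functionalF_eq_integral (hX : IsSmoothImmersion X)
    {Z : M → EuclideanSpace ℝ (Fin (n + p))} (hZ : IsSmoothImmersion Z)
    (x : EuclideanSpace ℝ (Fin (n + p))) (t : ℝ) :
    functionalF Z x t
      = ∫ q, gaussianKernel n x t (Z q) * volumeRatio X Z q ∂(volumeMeasure X) := by
  rw [functionalF, volumeMeasure_eq_withDensity hX hZ, integral_withDensity_eq_integral_toReal_smul
    (continuous_volumeRatio hX hZ).measurable.ennreal_ofReal
    (Eventually.of_forall fun _ => ENNReal.ofReal_lt_top), ← integral_const_mul]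
  refine integral_congr_ae (Eventually.of_forall fun q => ?_)
  simp only [ENNReal.toReal_ofReal (volumeRatio_nonneg _), smul_eq_mul, gaussianKernel,
    gaussianWeight]
  ring

variable [T2Space M]

/-- The first variation formula. Away from a compact set only the Gaussian varies, so an integrable
Lipschitz constant for the Gaussian along the fixed immersion allows differentiation under the
integral. -/
lemma IsNormalVariation.first_variation (h : IsNormalVariation X x₀ t₀ ε Y ξ τ)
    (hw : Integrable (gaussianWeight X x₀ t₀) (volumeMeasure X)) {δ : ℝ} (hδ : 0 < δ)
    {b : M → ℝ} (hb : Integrable b (volumeMeasure X))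
    (hlip : ∀ q, ∀ s ∈ Metric.ball (0 : ℝ) δ, ∀ r ∈ Metric.ball (0 : ℝ) δ,
      |gaussianKernel n (ξ s) (τ s) (X q) - gaussianKernel n (ξ r) (τ r) (X q)| ≤ b q * |s - r|) :
    (∀ᶠ s in 𝓝 (0 : ℝ),
      Integrable (gaussianWeight (Y s) (ξ s) (τ s)) (volumeMeasure (Y s))) ∧
    Integrable (firstVariationDensity X x₀ t₀ (fun q => deriv (fun s => Y s q) 0) (deriv ξ 0)
      (deriv τ 0)) (volumeMeasure X) ∧
    HasDerivAt (fun s => functionalF (Y s) (ξ s) (τ s))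
      (∫ q, firstVariationDensity X x₀ t₀ (fun q => deriv (fun s => Y s q) 0) (deriv ξ 0)
        (deriv τ 0) q ∂(volumeMeasure X)) 0 := by
  have hX := h.isSmoothImmersion
  have hloc := isLocallyFiniteMeasure_volumeMeasure hX
  have hI : Ioo (-ε) ε ∈ 𝓝 (0 : ℝ) := isOpen_Ioo.mem_nhds h.zero_mem
  obtain ⟨K, hK, hKY⟩ := h.compact_support
  obtain ⟨δ₁, hδ₁, C, hC, hKlip⟩ := h.exists_lipschitz_of_isCompact hK
  -- the integrable Lipschitz constant of the integrand
  set B : M → ℝ := fun q => K.indicator (fun _ => C) q + |b q| with hB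
  have hBi : Integrable B (volumeMeasure X) :=
    ((integrable_indicator_iff hK.measurableSet).2
      (integrableOn_const hK.measure_lt_top.ne)).add hb.abs
  have hB0 : ∀ q, 0 ≤ B q := fun q => add_nonneg (indicator_nonneg (fun _ _ => hC) q) (abs_nonneg _)
  set S : Set ℝ := Ioo (-ε) ε ∩ Metric.ball 0 (min δ δ₁) with hS
  have hS0 : S ∈ 𝓝 (0 : ℝ) := inter_mem hI (Metric.ball_mem_nhds _ (lt_min hδ hδ₁))
  -- off `K` the immersions agree near each point, so the volume ratio is one
  have hoff : ∀ q ∉ K, ∀ s ∈ Ioo (-ε) ε,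
      energyDensity X Y ξ τ s q = gaussianKernel n (ξ s) (τ s) (X q) := by
    intro q hq s hs
    have h1 : Y s =ᶠ[𝓝 q] X := by
      filter_upwards [hK.isClosed.isOpen_compl.mem_nhds hq] with z hz using hKY s hs z hz
    have h2 : volumeRatio X (Y s) q = 1 := by
      rw [← volumeRatio_self hX q, volumeRatio, volumeRatio, diff_congr h1]
    rw [energyDensity, h2, mul_one, hKY s hs q hq]
  have hL : ∀ q, ∀ s ∈ S, ∀ r ∈ S,
      |energyDensity X Y ξ τ s q - energyDensity X Y ξ τ r q| ≤ B q * |s - r| := by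
    intro q s hs r hr
    by_cases hq : q ∈ K
    · refine (hKlip q hq s (Metric.ball_subset_ball (min_le_right _ _) hs.2) r
        (Metric.ball_subset_ball (min_le_right _ _) hr.2)).trans
        (mul_le_mul_of_nonneg_right ?_ (abs_nonneg _))
      simp [hB, hq]
    · rw [hoff q hq s hs.1, hoff q hq r hr.1]
      refine (hlip q s (Metric.ball_subset_ball (min_le_left _ _) hs.2) r
        (Metric.ball_subset_ball (min_le_left _ _) hr.2)).trans
        (mul_le_mul_of_nonneg_right ?_ (abs_nonneg _))
      simp [hB, hq, le_abs_self]
  have hE0 : Integrable (energyDensity X Y ξ τ 0) (volumeMeasure X) := by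
    have := (integrable_gaussianWeight_iff hX (h.immersion 0 h.zero_mem) (ξ 0)
      (h.scale_pos 0 h.zero_mem)).1 (by rwa [h.zero, h.center_zero, h.scale_zero])
    exact this
  have hmeas : ∀ s ∈ Ioo (-ε) ε,
      AEStronglyMeasurable (energyDensity X Y ξ τ s) (volumeMeasure X) :=
    fun s hs => (h.continuous_energyDensity hs).aestronglyMeasurable
  have hEs : ∀ s ∈ S, Integrable (energyDensity X Y ξ τ s) (volumeMeasure X) := by
    intro s hs
    have h1 : Integrable (fun q => energyDensity X Y ξ τ s q - energyDensity X Y ξ τ 0 q)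
        (volumeMeasure X) :=
      (hBi.mul_const |s - 0|).mono' ((hmeas s hs.1).sub (hmeas 0 h.zero_mem))
        (Eventually.of_forall fun q => hL q s hs 0 (mem_of_mem_nhds hS0))
    refine (h1.add hE0).congr (Eventually.of_forall fun q => ?_)
    simp
  have hD := hasDerivAt_integral_of_dominated_loc_of_lip (F := energyDensity X Y ξ τ)
    (F' := firstVariationDensity X x₀ t₀ (fun q => deriv (fun s => Y s q) 0) (deriv ξ 0)
      (deriv τ 0)) (μ := volumeMeasure X) (bound := B) hS0
    (by filter_upwards [hI] with s hs using hmeas s hs) hE0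
    (continuous_firstVariationDensity hX h.contMDiff_deriv _ _).aestronglyMeasurable
    (Eventually.of_forall fun q => LipschitzOnWith.of_dist_le_mul fun s hs r hr => by
      rw [Real.coe_nnabs, abs_of_nonneg (hB0 q)]
      exact hL q s hs r hr) hBi
    (Eventually.of_forall fun q => h.hasDerivAt_energyDensity q)
  refine ⟨?_, hD.1, hD.2.congr_of_eventuallyEq ?_⟩
  · filter_upwards [hS0] with s hs
    exact (integrable_gaussianWeight_iff hX (h.immersion s hs.1) _
      (h.scale_pos s hs.1)).2 (hEs s hs)
  · filter_upwards [hI] with s hs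
    exact functionalF_eq_integral hX (h.immersion s hs) _ _

end FirstVariation

/-! ### Lipschitz bounds for the Gaussian kernel -/

section GaussianBounds

variable {F : Type*} [NormedAddCommGroup F] [InnerProductSpace ℝ F] {n : ℕ}

lemma quadratic_mul_exp_neg_sq_le {A r : ℝ} (hA : 0 < A) (hr : 0 ≤ r) :
    (1 + r + r ^ 2 / 2) * Real.exp (-r ^ 2 / (4 * A)) ≤ Real.exp (4 * A) * Real.exp (-r) := by
  calc (1 + r + r ^ 2 / 2) * Real.exp (-r ^ 2 / (4 * A))
      ≤ Real.exp r * Real.exp (-r ^ 2 / (4 * A)) :=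
        mul_le_mul_of_nonneg_right (Real.quadratic_le_exp_of_nonneg hr) (Real.exp_nonneg _)
    _ ≤ Real.exp (4 * A) * Real.exp (-r) := by
        rw [← Real.exp_add, ← Real.exp_add, Real.exp_le_exp]
        have h : 4 * A + -r - (r + -r ^ 2 / (4 * A)) = (r - 4 * A) ^ 2 / (4 * A) := by
          field_simp
          ring
        have : 0 ≤ (r - 4 * A) ^ 2 / (4 * A) := by positivity
        linarith

lemma exp_neg_norm_sub_le {A : ℝ} {x y : F} (hy : ‖y‖ ≤ A) :
    Real.exp (-‖x - y‖) ≤ Real.exp A * Real.exp (-‖x‖) := by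
  rw [← Real.exp_add, Real.exp_le_exp]
  linarith [norm_sub_norm_le x y]

lemma continuousAt_deriv_of_contDiffAt {f : ℝ → F} {s : ℝ} (hf : ContDiffAt ℝ ∞ f s) :
    ContinuousAt (deriv f) s :=
  ((hf.fderiv_right (m := ∞) (by simp)).continuousAt).clm_apply continuousAt_const

lemma eventually_norm_le_of_continuousAt {f : ℝ → F} {s : ℝ} (hf : ContinuousAt f s) :
    ∀ᶠ r in 𝓝 s, ‖f r‖ ≤ ‖f s‖ + 1 :=
  (hf.norm.eventually_lt continuousAt_const (lt_add_one _)).mono fun _ h => h.le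

/-- The Gaussian at a fixed point is Lipschitz along a smooth motion of centre and scale, with a
constant decaying exponentially in the point. -/
lemma exists_gaussianKernel_lipschitz {ξ : ℝ → F} {τ : ℝ → ℝ} (hξ : ContDiffAt ℝ ∞ ξ 0)
    (hτ : ContDiffAt ℝ ∞ τ 0) (hpos : 0 < τ 0) :
    ∃ δ > 0, ∃ C : ℝ, ∀ x : F, ∀ s ∈ Metric.ball (0 : ℝ) δ, ∀ r ∈ Metric.ball (0 : ℝ) δ,
      |gaussianKernel n (ξ s) (τ s) x - gaussianKernel n (ξ r) (τ r) x|
        ≤ C * Real.exp (-‖x‖) * |s - r| := by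
  have hpre : ContinuousAt (fun s => (4 * Real.pi * τ s) ^ (-(n : ℝ) / 2)) 0 :=
    (continuousAt_const.mul hτ.continuousAt).rpow_const
      (Or.inl (mul_pos (by positivity) hpos).ne')
  have hξd : ∀ᶠ s in 𝓝 (0 : ℝ), DifferentiableAt ℝ ξ s :=
    ((hξ.of_le (m := 1) (by simp)).eventually (by simp)).mono
      fun s hs => hs.differentiableAt one_ne_zero
  have hτd : ∀ᶠ s in 𝓝 (0 : ℝ), DifferentiableAt ℝ τ s :=
    ((hτ.of_le (m := 1) (by simp)).eventually (by simp)).mono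
      fun s hs => hs.differentiableAt one_ne_zero
  have hlow : ∀ᶠ s in 𝓝 (0 : ℝ), τ 0 / 2 ≤ τ s :=
    (continuousAt_const.eventually_lt hτ.continuousAt (half_lt_self hpos)).mono fun _ h => h.le
  obtain ⟨δ, hδ, H⟩ := Metric.eventually_nhds_iff_ball.1
    (hξd.and (hτd.and (hlow.and ((eventually_norm_le_of_continuousAt hpre).and
      ((eventually_norm_le_of_continuousAt hξ.continuousAt).and
        ((eventually_norm_le_of_continuousAt hτ.continuousAt).and
          ((eventually_norm_le_of_continuousAt (continuousAt_deriv_of_contDiffAt hξ)).and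
            (eventually_norm_le_of_continuousAt (continuousAt_deriv_of_contDiffAt hτ)))))))))
  set a := τ 0 / 2 with ha
  set P := ‖(4 * Real.pi * τ 0) ^ (-(n : ℝ) / 2)‖ + 1 with hP
  set A := ‖ξ 0‖ + 1 with hA
  set T := ‖τ 0‖ + 1 with hT
  set A' := ‖deriv ξ 0‖ + 1 with hA'
  set T' := ‖deriv τ 0‖ + 1 with hT'
  have ha0 : 0 < a := by positivity
  have hT0 : 0 < T := by positivity
  have hA0 : 0 < A' := by positivity
  have hT0' : 0 < T' := by positivity
  set D := n * T' / (2 * a) + T' / (2 * a ^ 2) + A' / (2 * a) with hD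
  have hD0 : 0 ≤ D := by positivity
  refine ⟨δ, hδ, P * D * Real.exp (4 * T) * Real.exp A, fun x s hs r hr => ?_⟩
  have hder : ∀ s ∈ Metric.ball (0 : ℝ) δ, HasDerivWithinAt
      (fun s => gaussianKernel n (ξ s) (τ s) x)
      (gaussianKernel n (ξ s) (τ s) x * (-(n * deriv τ s / (2 * τ s))
        + ‖x - ξ s‖ ^ 2 * deriv τ s / (4 * τ s ^ 2)
        - inner ℝ (x - ξ s) (0 - deriv ξ s) / (2 * τ s))) (Metric.ball (0 : ℝ) δ) s := by
    intro s hs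
    obtain ⟨h1, h2, h3, -⟩ := H s hs
    exact (hasDerivAt_gaussianKernel h1.hasDerivAt h2.hasDerivAt (hasDerivAt_const s x)
      (ha0.trans_le h3)).hasDerivWithinAt
  have hbound : ∀ s ∈ Metric.ball (0 : ℝ) δ,
      ‖gaussianKernel n (ξ s) (τ s) x * (-(n * deriv τ s / (2 * τ s))
        + ‖x - ξ s‖ ^ 2 * deriv τ s / (4 * τ s ^ 2)
        - inner ℝ (x - ξ s) (0 - deriv ξ s) / (2 * τ s))‖
      ≤ P * D * Real.exp (4 * T) * Real.exp A * Real.exp (-‖x‖) := by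
    intro s hs
    obtain ⟨-, -, h3, h4, h5, h6, h7, h8⟩ := H s hs
    have hτs : 0 < τ s := ha0.trans_le h3
    rw [Real.norm_eq_abs] at h4 h6 h8
    set ρ := ‖x - ξ s‖ with hρ
    have hρ0 : 0 ≤ ρ := norm_nonneg _
    have hf : |-(n * deriv τ s / (2 * τ s)) + ρ ^ 2 * deriv τ s / (4 * τ s ^ 2)
        - inner ℝ (x - ξ s) (0 - deriv ξ s) / (2 * τ s)| ≤ D * (1 + ρ + ρ ^ 2 / 2) := by
      have b1 : |n * deriv τ s / (2 * τ s)| ≤ n * T' / (2 * a) := by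
        rw [abs_div, abs_mul, Nat.abs_cast, abs_of_pos (by positivity : 0 < 2 * τ s)]
        gcongr
      have b2 : |ρ ^ 2 * deriv τ s / (4 * τ s ^ 2)| ≤ ρ ^ 2 * T' / (4 * a ^ 2) := by
        rw [abs_div, abs_mul, abs_of_nonneg (sq_nonneg ρ),
          abs_of_pos (by positivity : 0 < 4 * τ s ^ 2)]
        gcongr
      have b3 : |inner ℝ (x - ξ s) (0 - deriv ξ s) / (2 * τ s)| ≤ ρ * A' / (2 * a) := by
        rw [abs_div, abs_of_pos (by positivity : 0 < 2 * τ s)]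
        gcongr
        refine (abs_real_inner_le_norm _ _).trans ?_
        rw [zero_sub, norm_neg]
        gcongr
      calc _ ≤ |n * deriv τ s / (2 * τ s)| + |ρ ^ 2 * deriv τ s / (4 * τ s ^ 2)|
            + |inner ℝ (x - ξ s) (0 - deriv ξ s) / (2 * τ s)| := by
            refine (abs_sub _ _).trans (add_le_add_left ((abs_add_le _ _).trans ?_) _)
            rw [abs_neg]
        _ ≤ n * T' / (2 * a) + ρ ^ 2 * T' / (4 * a ^ 2) + ρ * A' / (2 * a) := by gcongr
        _ ≤ D * (1 + ρ + ρ ^ 2 / 2) := by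
            have e1 : ρ ^ 2 * T' / (4 * a ^ 2) = T' / (2 * a ^ 2) * (ρ ^ 2 / 2) := by
              field_simp
              ring
            have e2 : ρ * A' / (2 * a) = A' / (2 * a) * ρ := by ring
            rw [e1, e2, hD]
            have c1 : 0 ≤ n * T' / (2 * a) := by positivity
            have c2 : 0 ≤ T' / (2 * a ^ 2) := by positivity
            have c3 : 0 ≤ A' / (2 * a) := by positivity
            nlinarith [mul_nonneg c1 hρ0, mul_nonneg c1 (sq_nonneg ρ), mul_nonneg c2 hρ0,
              mul_nonneg c3 (sq_nonneg ρ)]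
    have hk : |gaussianKernel n (ξ s) (τ s) x| ≤ P * Real.exp (-ρ ^ 2 / (4 * T)) := by
      rw [gaussianKernel, abs_mul, Real.abs_exp]
      have hτT : τ s ≤ T := (le_abs_self _).trans h6
      refine mul_le_mul h4 (Real.exp_le_exp.2 ?_) (Real.exp_nonneg _) (by positivity)
      rw [neg_div, neg_div, neg_le_neg_iff]
      gcongr
    rw [Real.norm_eq_abs, abs_mul]
    calc _ ≤ P * Real.exp (-ρ ^ 2 / (4 * T)) * (D * (1 + ρ + ρ ^ 2 / 2)) :=
          mul_le_mul hk hf (abs_nonneg _) (by positivity)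
      _ = P * D * ((1 + ρ + ρ ^ 2 / 2) * Real.exp (-ρ ^ 2 / (4 * T))) := by ring
      _ ≤ P * D * (Real.exp (4 * T) * (Real.exp A * Real.exp (-‖x‖))) := by
          refine mul_le_mul_of_nonneg_left ((quadratic_mul_exp_neg_sq_le hT0 hρ0).trans
            (mul_le_mul_of_nonneg_left (exp_neg_norm_sub_le h5) (Real.exp_nonneg _)))
            (by positivity)
      _ = _ := by ring
  have := Convex.norm_image_sub_le_of_norm_hasDerivWithin_le hder hbound (convex_ball _ _) hr hs
  simpa only [Real.norm_eq_abs] using this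

end GaussianBounds

/-! ### Integrability under polynomial volume growth -/

section PolynomialGrowth

variable {n p : ℕ} {M : Type*} [TopologicalSpace M] [ChartedSpace (EuclideanSpace ℝ (Fin n)) M]
  {X : M → EuclideanSpace ℝ (Fin (n + p))} [IsManifold (𝓡 n) ∞ M] [MeasurableSpace M] [BorelSpace M]

lemma HasPolynomialVolumeGrowth.integrable_exp_neg_norm (hX : IsSmoothImmersion X)
    (hg : HasPolynomialVolumeGrowth X) :
    Integrable (fun q => Real.exp (-‖X q‖)) (volumeMeasure X) := by
  obtain ⟨C, d, hC⟩ := hg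
  have hXc : Continuous X := hX.smooth.continuous
  refine ⟨(by fun_prop : Continuous fun q => Real.exp (-‖X q‖)).aestronglyMeasurable, ?_⟩
  obtain ⟨m, hm⟩ := exists_nat_ge d
  -- compare with a sum over the shells `k ≤ |x| < k + 1`
  have hsum : Summable fun k : ℕ => |C| * ((k : ℝ) + 1) ^ m * Real.exp (-k) := by
    have h1 := (summable_nat_add_iff 1).2 (Real.summable_pow_mul_exp_neg_nat_mul m one_pos)
    refine (h1.mul_left (|C| * Real.exp 1)).congr fun k => ?_
    have : Real.exp (-(k : ℝ)) = Real.exp 1 * Real.exp (-1 * ((k + 1 : ℕ) : ℝ)) := by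
      rw [← Real.exp_add]
      congr 1
      push_cast
      ring
    rw [this]
    push_cast
    ring
  have hpt : ∀ q, ‖Real.exp (-‖X q‖)‖ₑ ≤ ∑' k : ℕ,
      (X ⁻¹' Metric.ball 0 ((k : ℝ) + 1)).indicator
        (fun _ => ENNReal.ofReal (Real.exp (-k))) q := by
    intro q
    refine le_trans ?_ (ENNReal.le_tsum ⌊‖X q‖⌋₊)
    rw [indicator_of_mem (by
      simpa using Nat.lt_floor_add_one ‖X q‖), Real.enorm_eq_ofReal (Real.exp_nonneg _)]
    exact ENNReal.ofReal_le_ofReal (Real.exp_le_exp.2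
      (neg_le_neg (Nat.floor_le (norm_nonneg _))))
  refine (lintegral_mono hpt).trans_lt ?_
  have hms : ∀ k : ℕ, MeasurableSet (X ⁻¹' Metric.ball 0 ((k : ℝ) + 1)) :=
    fun k => (Metric.isOpen_ball.preimage hXc).measurableSet
  rw [lintegral_tsum fun k => (measurable_const.indicator (hms k)).aemeasurable]
  refine lt_of_le_of_lt (ENNReal.tsum_le_tsum fun k => ?_) hsum.tsum_ofReal_lt_top
  rw [lintegral_indicator_const (hms k), mul_comm, ENNReal.ofReal_mul (by positivity)]
  gcongr
  have hk : (1 : ℝ) ≤ (k : ℝ) + 1 := by linarith [(Nat.cast_nonneg k : (0 : ℝ) ≤ k)]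
  refine (hC _ hk).trans (ENNReal.ofReal_le_ofReal ?_)
  have h2 : ((k : ℝ) + 1) ^ d ≤ ((k : ℝ) + 1) ^ m := by
    rw [← Real.rpow_natCast]
    exact Real.rpow_le_rpow_of_exponent_le hk hm
  calc C * ((k : ℝ) + 1) ^ d ≤ |C| * ((k : ℝ) + 1) ^ d :=
        mul_le_mul_of_nonneg_right (le_abs_self _) (by positivity)
    _ ≤ |C| * ((k : ℝ) + 1) ^ m := mul_le_mul_of_nonneg_left h2 (abs_nonneg _)

/-- A field of at most linear growth, weighted by the Gaussian, is integrable. -/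
lemma integrable_gaussianWeight_smul
    (hexp : Integrable (fun q => Real.exp (-‖X q‖)) (volumeMeasure X))
    {x₀ : EuclideanSpace ℝ (Fin (n + p))} {t₀ : ℝ} (ht₀ : 0 < t₀)
    {F : Type*} [NormedAddCommGroup F] [NormedSpace ℝ F] {f : M → F}
    (hf : AEStronglyMeasurable (fun q => gaussianWeight X x₀ t₀ q • f q) (volumeMeasure X)) {B : ℝ}
    (hB : ∀ q, ‖f q‖ ≤ B * (1 + ‖X q - x₀‖)) :
    Integrable (fun q => gaussianWeight X x₀ t₀ q • f q) (volumeMeasure X) := by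
  refine (hexp.const_mul (|B| * (Real.exp (4 * t₀) * Real.exp ‖x₀‖))).mono' hf
    (Eventually.of_forall fun q => ?_)
  rw [norm_smul, gaussianWeight, Real.norm_eq_abs, Real.abs_exp]
  set ρ := ‖X q - x₀‖
  have hρ : 0 ≤ ρ := norm_nonneg _
  calc Real.exp (-ρ ^ 2 / (4 * t₀)) * ‖f q‖
      ≤ Real.exp (-ρ ^ 2 / (4 * t₀)) * (|B| * (1 + ρ + ρ ^ 2 / 2)) := by
        refine mul_le_mul_of_nonneg_left ((hB q).trans ?_) (Real.exp_nonneg _)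
        exact mul_le_mul (le_abs_self _) (by nlinarith [sq_nonneg ρ]) (by positivity)
          (abs_nonneg _)
    _ = |B| * ((1 + ρ + ρ ^ 2 / 2) * Real.exp (-ρ ^ 2 / (4 * t₀))) := by ring
    _ ≤ |B| * (Real.exp (4 * t₀) * (Real.exp ‖x₀‖ * Real.exp (-‖X q‖))) := by
        refine mul_le_mul_of_nonneg_left ((quadratic_mul_exp_neg_sq_le ht₀ hρ).trans
          (mul_le_mul_of_nonneg_left (exp_neg_norm_sub_le le_rfl) (Real.exp_nonneg _)))
          (abs_nonneg _)
    _ = _ := by ring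

end PolynomialGrowth

/-! ### Self-shrinkers are critical points -/

section ShrinkersAreCritical

variable {n p : ℕ} {M : Type*} [TopologicalSpace M] [ChartedSpace (EuclideanSpace ℝ (Fin n)) M]
  {X Z : M → EuclideanSpace ℝ (Fin (n + p))} {q : M} [IsManifold (𝓡 n) ∞ M]
  {x₀ : EuclideanSpace ℝ (Fin (n + p))} {t₀ : ℝ}

/-- On a self-shrinker, `div Z = ⟨x - x₀, Z⟩ / (2t₀)` for every normal field `Z`. -/
lemma IsSelfShrinker.tangentialDivergence_of_normal (hS : IsSelfShrinker X x₀ t₀)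
    (hX : IsSmoothImmersion X)
    (hZ : MDifferentiableAt (𝓡 n) 𝓘(ℝ, EuclideanSpace ℝ (Fin (n + p))) Z q)
    (hn : ∀ z, Z z ∈ (tangentSpan X z)ᗮ) :
    tangentialDivergence X Z q = inner ℝ (X q - x₀) (Z q) / (2 * t₀) := by
  rw [SelfShrinker.tangentialDivergence_of_normal hX hZ (Eventually.of_forall hn), hS q,
    inner_neg_left, neg_neg, inner_smul_left, inner_normalPart_left (hn q)]
  simp only [map_inv₀, conj_trivial]
  ring

/-- The field `exp(-|x - x₀|² / (4t₀)) (α (x - x₀) + y)` along `X`. -/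
def weightedField (X : M → EuclideanSpace ℝ (Fin (n + p))) (x₀ : EuclideanSpace ℝ (Fin (n + p)))
    (t₀ α : ℝ) (y : EuclideanSpace ℝ (Fin (n + p))) (q : M) : EuclideanSpace ℝ (Fin (n + p)) :=
  gaussianWeight X x₀ t₀ q • (α • (X q - x₀) + y)

lemma contMDiff_gaussianWeight (hX : IsSmoothImmersion X) :
    ContMDiff (𝓡 n) 𝓘(ℝ, ℝ) ∞ (gaussianWeight X x₀ t₀) := by
  have h : ContDiff ℝ ∞ (fun x : EuclideanSpace ℝ (Fin (n + p)) =>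
      Real.exp (-‖x - x₀‖ ^ 2 / (4 * t₀))) :=
    (((contDiff_id.sub contDiff_const).norm_sq ℝ).neg.div_const _).exp
  exact h.contMDiff.comp hX.smooth

lemma contMDiff_linearField (hX : IsSmoothImmersion X) (α : ℝ)
    (y : EuclideanSpace ℝ (Fin (n + p))) :
    ContMDiff (𝓡 n) 𝓘(ℝ, EuclideanSpace ℝ (Fin (n + p))) ∞ (fun q => α • (X q - x₀) + y) := by
  have h : ContDiff ℝ ∞ (fun x : EuclideanSpace ℝ (Fin (n + p)) => α • (x - x₀) + y) := by fun_prop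
  exact h.contMDiff.comp hX.smooth

lemma contMDiff_weightedField (hX : IsSmoothImmersion X) (α : ℝ)
    (y : EuclideanSpace ℝ (Fin (n + p))) :
    ContMDiff (𝓡 n) 𝓘(ℝ, EuclideanSpace ℝ (Fin (n + p))) ∞ (weightedField X x₀ t₀ α y) :=
  (contMDiff_gaussianWeight hX).smul (contMDiff_linearField hX α y)

lemma diff_gaussianWeight_apply (hX : IsSmoothImmersion X) (v : EuclideanSpace ℝ (Fin n)) :
    diff n (gaussianWeight X x₀ t₀) q v
      = -(gaussianWeight X x₀ t₀ q * inner ℝ (X q - x₀) (diff n X q v) / (2 * t₀)) := by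
  have h : HasFDerivAt (fun x : EuclideanSpace ℝ (Fin (n + p)) =>
      Real.exp (-‖x - x₀‖ ^ 2 / (4 * t₀))) _ (X q) :=
    (((((hasFDerivAt_id (X q)).sub_const x₀).norm_sq).neg.mul_const (4 * t₀)⁻¹)).exp
  have h1 := diff_comp (n := n) (hX.mdifferentiableAt q) h.differentiableAt
  rw [h.fderiv] at h1
  have h2 : diff n (gaussianWeight X x₀ t₀) q = _ := h1
  rw [h2]
  simp [gaussianWeight, inner_sub_left]
  ring_nf

lemma diff_linearField (hX : IsSmoothImmersion X) (α : ℝ) (y : EuclideanSpace ℝ (Fin (n + p))) :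
    diff n (fun q => α • (X q - x₀) + y) q = α • diff n X q := by
  have h : HasFDerivAt (fun x : EuclideanSpace ℝ (Fin (n + p)) => α • (x - x₀) + y) _ (X q) :=
    (((hasFDerivAt_id (𝕜 := ℝ) (X q)).sub_const x₀).const_smul α).add_const y
  rw [diff_comp (n := n) (hX.mdifferentiableAt q) h.differentiableAt, h.fderiv]
  ext v
  simp

/-- The divergence of the tangential part of the weighted field on a self-shrinker. -/
lemma IsSelfShrinker.tangentialDivergence_weightedField (hS : IsSelfShrinker X x₀ t₀)
    (hX : IsSmoothImmersion X) (α : ℝ) (y : EuclideanSpace ℝ (Fin (n + p))) :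
    tangentialDivergence X (fun z => weightedField X x₀ t₀ α y z
        - normalPart X z (weightedField X x₀ t₀ α y z)) q
      = gaussianWeight X x₀ t₀ q *
        (α * n - inner ℝ (X q - x₀) (α • (X q - x₀) + y) / (2 * t₀)) := by
  have hZ := contMDiff_weightedField (x₀ := x₀) (t₀ := t₀) hX α y
  have hN : ContMDiff (𝓡 n) 𝓘(ℝ, EuclideanSpace ℝ (Fin (n + p))) ∞
      (fun z => normalPart X z (weightedField X x₀ t₀ α y z)) :=
    fun z => contMDiffAt_normalPart hX (hZ z)
  have hW : ContMDiff (𝓡 n) 𝓘(ℝ, EuclideanSpace ℝ (Fin (n + p))) ∞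
      (fun z => weightedField X x₀ t₀ α y z
        - normalPart X z (weightedField X x₀ t₀ α y z)) := hZ.sub hN
  have hadd := tangentialDivergence_add (X := X) (q := q) ((hW q).mdifferentiableAt (by simp))
    ((hN q).mdifferentiableAt (by simp))
  simp only [sub_add_cancel] at hadd
  rw [hS.tangentialDivergence_of_normal hX ((hN q).mdifferentiableAt (by simp))
    (fun z => normalPart_mem _)] at hadd
  set ζ := α • (X q - x₀) + y with hζ
  have hZq : weightedField X x₀ t₀ α y q = gaussianWeight X x₀ t₀ q • ζ := rfl
  have hNq : normalPart X q (weightedField X x₀ t₀ α y q)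
      = gaussianWeight X x₀ t₀ q • normalPart X q ζ := by
    rw [hZq, normalPart, normalPart, map_smul]
  -- by the product rule only the tangential part of `ζ` meets the gradient of the weight
  have hdiv : tangentialDivergence X (fun z => weightedField X x₀ t₀ α y z) q
      = gaussianWeight X x₀ t₀ q * (α * n)
        - gaussianWeight X x₀ t₀ q * inner ℝ (X q - x₀) (ζ - normalPart X q ζ) / (2 * t₀) := by
    have h1 : diff n (fun z => weightedField X x₀ t₀ α y z) q
        = gaussianWeight X x₀ t₀ q • (α • diff n X q)
          + (diff n (gaussianWeight X x₀ t₀) q).smulRight ζ := by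
      rw [← diff_linearField (x₀ := x₀) hX α y]
      exact diff_smul ((contMDiff_gaussianWeight hX q).mdifferentiableAt (by simp))
        ((contMDiff_linearField hX α y q).mdifferentiableAt (by simp))
    rw [tangentialDivergence, h1, tangentialTrace_add, tangentialTrace_smul, tangentialTrace_smul,
      tangentialTrace_self (hX.injective_diff q), tangentialTrace_smulRight,
      diff_gaussianWeight_apply hX, normalPart_eq hX, sub_sub_cancel]
    ring
  rw [hdiv, hNq, inner_smul_right, inner_sub_right] at hadd
  linarith [hadd, show gaussianWeight X x₀ t₀ q *
      (α * n - inner ℝ (X q - x₀) ζ / (2 * t₀)) = gaussianWeight X x₀ t₀ q * (α * n)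
        - gaussianWeight X x₀ t₀ q * (inner ℝ (X q - x₀) ζ
          - inner ℝ (X q - x₀) (normalPart X q ζ)) / (2 * t₀)
        - gaussianWeight X x₀ t₀ q * inner ℝ (X q - x₀) (normalPart X q ζ) / (2 * t₀) by ring]

variable [MeasurableSpace M] [BorelSpace M] [SecondCountableTopology M] [T2Space M]

/-- A complete self-shrinker with polynomial volume growth is critical: normal variations do not
contribute, and moving the centre and the scale contributes the integral of a divergence. -/
lemma IsSelfShrinker.isCriticalPoint (hS : IsSelfShrinker X x₀ t₀) (hX : IsSmoothImmersion X)
    (ht₀ : 0 < t₀) (hc : IsCompleteImmersion X) (hg : HasPolynomialVolumeGrowth X) :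
    IsCriticalPoint X x₀ t₀ := by
  intro ε Y ξ τ h
  have hexp := hg.integrable_exp_neg_norm hX
  have hXc : Continuous X := hX.smooth.continuous
  have hwc : Continuous (gaussianWeight X x₀ t₀) := (contMDiff_gaussianWeight hX).continuous
  have hw : Integrable (gaussianWeight X x₀ t₀) (volumeMeasure X) := by
    have := integrable_gaussianWeight_smul (x₀ := x₀) (f := fun _ : M => (1 : ℝ)) (B := 1) hexp ht₀
      (by simpa using hwc.aestronglyMeasurable) (fun q => by simp)
    simpa using this
  obtain ⟨δ, hδ, C, hC⟩ := exists_gaussianKernel_lipschitz (n := n)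
    (h.contDiffAt_center h.zero_mem) (h.contDiffAt_scale h.zero_mem) (h.scale_pos 0 h.zero_mem)
  obtain ⟨h1, h2, h3⟩ := h.first_variation hw hδ (hexp.const_mul C) fun q => hC (X q)
  refine ⟨h1, ?_⟩
  set α := -(deriv τ 0 / (2 * t₀)) with hα
  set y := -deriv ξ 0 with hy
  set c := (4 * Real.pi * t₀) ^ (-(n : ℝ) / 2) with hc_def
  have hc0 : c ≠ 0 := by positivity
  set W := fun z => weightedField X x₀ t₀ α y z
    - normalPart X z (weightedField X x₀ t₀ α y z) with hW_def
  have hD : firstVariationDensity X x₀ t₀ (fun q => deriv (fun s => Y s q) 0) (deriv ξ 0)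
      (deriv τ 0) = fun q => c * tangentialDivergence X W q := by
    funext q
    -- the terms with the variation field cancel by the shrinker equation
    rw [hS.tangentialDivergence_weightedField hX, firstVariationDensity,
      hS.tangentialDivergence_of_normal hX ((h.contMDiff_deriv q).mdifferentiableAt (by simp))
        h.normal, inner_sub_right, inner_add_right, inner_smul_right, real_inner_self_eq_norm_sq,
      hy, inner_neg_right, hα, gaussianKernel, gaussianWeight, ← hc_def]
    field_simp
    ring
  have hZ := contMDiff_weightedField (x₀ := x₀) (t₀ := t₀) hX α y
  have hWs : ContMDiff (𝓡 n) 𝓘(ℝ, EuclideanSpace ℝ (Fin (n + p))) ∞ W :=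
    hZ.sub fun z => contMDiffAt_normalPart hX (hZ z)
  have hZi : Integrable (weightedField X x₀ t₀ α y) (volumeMeasure X) := by
    refine integrable_gaussianWeight_smul (B := |α| + ‖y‖) hexp ht₀
      hZ.continuous.aestronglyMeasurable fun q => ?_
    refine (norm_add_le _ _).trans ?_
    rw [norm_smul, Real.norm_eq_abs]
    nlinarith [abs_nonneg α, norm_nonneg y, norm_nonneg (X q - x₀),
      mul_nonneg (norm_nonneg y) (norm_nonneg (X q - x₀))]
  have hWi : Integrable W (volumeMeasure X) :=
    hZi.norm.mono' hWs.continuous.aestronglyMeasurable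
      (Eventually.of_forall fun q => norm_sub_normalPart_le _)
  rw [hD] at h2 h3
  have hdi : Integrable (tangentialDivergence X W) (volumeMeasure X) :=
    (integrable_const_mul_iff (isUnit_iff_ne_zero.2 hc0) _).1 h2
  rwa [integral_const_mul, integral_tangentialDivergence_eq_zero hX hc hWs
    (fun q => sub_normalPart_mem _) hWi hdi, mul_zero] at h3

end ShrinkersAreCritical

/-! ### Critical points are self-shrinkers -/

section CriticalPointsAreShrinkers

variable {n p : ℕ} {M : Type*} [TopologicalSpace M] [ChartedSpace (EuclideanSpace ℝ (Fin n)) M]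
  {X V : M → EuclideanSpace ℝ (Fin (n + p))} [IsManifold (𝓡 n) ∞ M]
  {x₀ : EuclideanSpace ℝ (Fin (n + p))} {t₀ : ℝ}

lemma contMDiff_add_smul (hX : IsSmoothImmersion X)
    (hV : ContMDiff (𝓡 n) 𝓘(ℝ, EuclideanSpace ℝ (Fin (n + p))) ∞ V) (s : ℝ) :
    ContMDiff (𝓡 n) 𝓘(ℝ, EuclideanSpace ℝ (Fin (n + p))) ∞ (fun q => X q + s • V q) := by
  have hs : ContMDiff (𝓡 n) 𝓘(ℝ, ℝ) ∞ (fun _ : M => s) := contMDiff_const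
  exact hX.smooth.add (hs.smul hV)

/-- Pushing an immersion a little in the direction of a field with compact support keeps it an
immersion. -/
lemma exists_isSmoothImmersion_add_smul [T2Space M] (hX : IsSmoothImmersion X)
    (hV : ContMDiff (𝓡 n) 𝓘(ℝ, EuclideanSpace ℝ (Fin (n + p))) ∞ V) (hVc : HasCompactSupport V) :
    ∃ ε > (0 : ℝ), ∀ s ∈ Ioo (-ε) ε, IsSmoothImmersion (fun q => X q + s • V q) := by
  have hK : ∃ ε > (0 : ℝ), ∀ s ∈ Ioo (-ε) ε, ∀ q ∈ tsupport V,
      Function.Injective (diff n (fun q => X q + s • V q) q) := by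
    refine hVc.isCompact.induction_on (p := fun K => ∃ ε > (0 : ℝ), ∀ s ∈ Ioo (-ε) ε, ∀ q ∈ K,
      Function.Injective (diff n (fun q => X q + s • V q) q)) ?_ ?_ ?_ ?_
    · exact ⟨1, one_pos, fun s _ q hq => hq.elim⟩
    · rintro S T hST ⟨ε, hε, H⟩
      exact ⟨ε, hε, fun s hs q hq => H s hs q (hST hq)⟩
    · rintro S T ⟨ε, hε, H⟩ ⟨ε', hε', H'⟩
      refine ⟨min ε ε', lt_min hε hε', ?_⟩
      rintro s ⟨hs1, hs2⟩ q (hq | hq)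
      · exact H s ⟨by linarith [min_le_left ε ε'], hs2.trans_le (min_le_left _ _)⟩ q hq
      · exact H' s ⟨by linarith [min_le_right ε ε'], hs2.trans_le (min_le_right _ _)⟩ q hq
    · intro q _
      set e := chartAt (EuclideanSpace ℝ (Fin n)) q with he_def
      have he : e ∈ atlas (EuclideanSpace ℝ (Fin n)) M := chart_mem_atlas _ q
      have hu : e q ∈ e.target := mem_chart_target _ q
      have hVu : ∀ u ∈ e.target, ContDiffAt ℝ ∞ (V ∘ e.symm) u :=
        fun u hu => contDiffAt_comp_chart_symm he hu (hV _)
      set A : ℝ × EuclideanSpace ℝ (Fin n) → EuclideanSpace ℝ (Fin n) →L[ℝ]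
          EuclideanSpace ℝ (Fin (n + p)) := fun z =>
        fderiv ℝ (X ∘ e.symm) z.2 + z.1 • fderiv ℝ (V ∘ e.symm) z.2 with hA
      have hAc : ContDiffAt ℝ ∞ A (0, e q) := by
        refine ContDiffAt.add ?_ (contDiffAt_fst.smul ?_)
        · exact ContDiffAt.comp (g := fderiv ℝ (X ∘ e.symm)) (0, e q)
            (hX.contDiffAt_fderiv he hu) contDiffAt_snd
        · exact ContDiffAt.comp (g := fderiv ℝ (V ∘ e.symm)) (0, e q)
            ((hVu _ hu).fderiv_right (by simp)) contDiffAt_snd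
      have hdet : ContinuousAt (fun z => (crossGram (A z) (A z)).det) (0, e q) :=
        (contDiffAt_matrix_det fun i j => contDiffAt_crossGram hAc hAc i j).continuousAt
      have hA0 : A (0, e q) = fderiv ℝ (X ∘ e.symm) (e q) := by
        ext1 v
        simp [hA]
      have hpos : (crossGram (A (0, e q)) (A (0, e q))).det ≠ 0 := by
        rw [hA0]
        exact (crossGram_self_det_pos (hX.injective_fderiv he hu)).ne'
      obtain ⟨δ, hδ, hball⟩ := Metric.mem_nhds_iff.1 (hdet.eventually_ne hpos)
      rw [← ball_prod_same] at hball
      refine ⟨e.source ∩ e ⁻¹' Metric.ball (e q) δ, mem_nhdsWithin_of_mem_nhds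
        ((e.isOpen_inter_preimage Metric.isOpen_ball).mem_nhds
          ⟨mem_chart_source _ q, Metric.mem_ball_self hδ⟩), δ, hδ, ?_⟩
      rintro s hs z ⟨hz1, hz2⟩
      have hez : e z ∈ e.target := e.map_source hz1
      have h1 := injective_of_crossGram_self_det_ne_zero
        (hball (mk_mem_prod (show s ∈ Metric.ball (0 : ℝ) δ by
          rwa [Real.ball_eq_Ioo, zero_sub, zero_add]) hz2))
      have h2 : A (s, e z) = fderiv ℝ ((fun q => X q + s • V q) ∘ e.symm) (e z) := by
        have hd := HasFDerivAt.add
          ((hX.contDiffAt_comp_chart_symm he hez).differentiableAt (by simp)).hasFDerivAt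
          (((hVu _ hez).differentiableAt (by simp)).hasFDerivAt.const_smul s)
        exact hd.fderiv.symm
      rw [h2, diff_injective_iff he hez
        ((contMDiff_add_smul hX hV s _).mdifferentiableAt (by simp)), e.left_inv hz1] at h1
      exact h1
  obtain ⟨ε, hε, H⟩ := hK
  refine ⟨ε, hε, fun s hs => ⟨contMDiff_add_smul hX hV s, fun q => ?_⟩⟩
  by_cases hq : q ∈ tsupport V
  · exact H s hs q hq
  · have h1 : (fun q => X q + s • V q) =ᶠ[𝓝 q] X := by
      filter_upwards [notMem_tsupport_iff_eventuallyEq.1 hq] with z hz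
      rw [hz]
      simp
    have h2 := hX.injective_diff q
    rw [← diff_congr h1] at h2
    exact h2

/-- The affine variation in the direction of a normal field with compact support, with fixed
centre and scale. -/
lemma exists_isNormalVariation_add_smul [T2Space M] (hX : IsSmoothImmersion X) (ht₀ : 0 < t₀)
    (hV : ContMDiff (𝓡 n) 𝓘(ℝ, EuclideanSpace ℝ (Fin (n + p))) ∞ V) (hVc : HasCompactSupport V)
    (hVn : ∀ q, V q ∈ (tangentSpan X q)ᗮ) :
    ∃ ε, IsNormalVariation X x₀ t₀ ε (fun s q => X q + s • V q) (fun _ => x₀) (fun _ => t₀) := by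
  obtain ⟨ε, hε, H⟩ := exists_isSmoothImmersion_add_smul hX hV hVc
  have hd : ∀ q, deriv (fun s : ℝ => X q + s • V q) 0 = V q := fun q => by
    have := (((hasDerivAt_id (0 : ℝ)).smul_const (V q)).const_add (X q)).deriv
    simpa using! this
  refine ⟨ε, hε, ContMDiff.contMDiffOn ?_, H, ?_, ⟨tsupport V, hVc.isCompact, ?_⟩, ?_,
    contDiffOn_const, rfl, contDiffOn_const, rfl, fun _ _ => ht₀⟩
  · exact (hX.smooth.comp contMDiff_snd).add (contMDiff_fst.smul (hV.comp contMDiff_snd))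
  · funext q
    simp
  · intro s _ q hq
    rw [image_eq_zero_of_notMem_tsupport hq, smul_zero, add_zero]
  · intro q
    rw [hd]
    exact hVn q

variable [MeasurableSpace M] [BorelSpace M] [SecondCountableTopology M] [T2Space M]

/-- At a critical point the first variation in the direction of a normal field with compact
support vanishes. -/
lemma IsCriticalPoint.integral_normal_eq_zero (hcrit : IsCriticalPoint X x₀ t₀)
    (hX : IsSmoothImmersion X) (ht₀ : 0 < t₀)
    (hV : ContMDiff (𝓡 n) 𝓘(ℝ, EuclideanSpace ℝ (Fin (n + p))) ∞ V) (hVc : HasCompactSupport V)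
    (hVn : ∀ q, V q ∈ (tangentSpan X q)ᗮ) :
    Integrable (firstVariationDensity X x₀ t₀ V 0 0) (volumeMeasure X) ∧
    ∫ q, firstVariationDensity X x₀ t₀ V 0 0 q ∂(volumeMeasure X) = 0 := by
  obtain ⟨ε, h⟩ := exists_isNormalVariation_add_smul (x₀ := x₀) hX ht₀ hV hVc hVn
  obtain ⟨hint, hder⟩ := hcrit _ _ _ _ h
  have hw : Integrable (gaussianWeight X x₀ t₀) (volumeMeasure X) := by
    have := hint.self_of_nhds
    simpa using this
  obtain ⟨-, h2, h3⟩ := h.first_variation hw one_pos (b := fun _ => 0) (integrable_zero _ _ _)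
    (by simp)
  have hd : (fun q => deriv (fun s : ℝ => X q + s • V q) 0) = V := by
    funext q
    have := (((hasDerivAt_id (0 : ℝ)).smul_const (V q)).const_add (X q)).deriv
    simpa using! this
  rw [hd, deriv_const, deriv_const] at h2 h3
  exact ⟨h2, h3.unique hder⟩

/-- The defect `w` of the shrinker equation at a point `q₀`, extended by normal projection and cut
off near `q₀`, is a direction in which the functional would strictly decrease. -/
lemma IsCriticalPoint.isSelfShrinker (hcrit : IsCriticalPoint X x₀ t₀)
    (hX : IsSmoothImmersion X) (ht₀ : 0 < t₀) : IsSelfShrinker X x₀ t₀ := by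
  have hLC : LocallyCompactSpace M :=
    ChartedSpace.locallyCompactSpace (EuclideanSpace ℝ (Fin n)) M
  intro q₀
  by_contra hne
  set w := meanCurvature X q₀ + (2 * t₀)⁻¹ • normalPart X q₀ (X q₀ - x₀) with hw
  have hw0 : w ≠ 0 := fun h => hne (eq_neg_of_add_eq_zero_left h)
  have hwn : w ∈ (tangentSpan X q₀)ᗮ := by
    refine Submodule.add_mem _ ?_ (Submodule.smul_mem _ _ (normalPart_mem _))
    exact Submodule.sum_mem _ fun i _ => Submodule.sum_mem _ fun j _ =>
      Submodule.smul_mem _ _ (normalPart_mem _)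
  set N : M → EuclideanSpace ℝ (Fin (n + p)) := fun q => normalPart X q w with hN
  have hNs : ContMDiff (𝓡 n) 𝓘(ℝ, EuclideanSpace ℝ (Fin (n + p))) ∞ N :=
    fun q => contMDiffAt_normalPart hX contMDiffAt_const
  have hNn : ∀ q, N q ∈ (tangentSpan X q)ᗮ := fun q => normalPart_mem _
  have hNq : N q₀ = w := Submodule.starProjection_eq_self_iff.2 hwn
  -- up to the Gaussian factor, `h` is the first variation in the direction `N`, and `h q₀ = -|w|²`
  set h : M → ℝ := fun q => tangentialDivergence X N q - inner ℝ (X q - x₀) (N q) / (2 * t₀)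
    with hh
  have hhc : Continuous h := by
    have h1 := continuous_tangentialDivergence hX hNs
    have h2 := hX.smooth.continuous
    have h3 := hNs.continuous
    simp only [hh]
    fun_prop
  have hh0 : h q₀ < 0 := by
    have h1 : h q₀ = -‖w‖ ^ 2 := by
      simp only [hh]
      rw [tangentialDivergence_of_normal hX ((hNs q₀).mdifferentiableAt (by simp))
        (Eventually.of_forall hNn), hNq, ← inner_normalPart_left (w := X q₀ - x₀) hwn,
        ← real_inner_self_eq_norm_sq, hw, inner_add_left, inner_smul_left, ← hw]
      simp only [map_inv₀, conj_trivial]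
      ring
    rw [h1, neg_lt_zero]
    positivity
  obtain ⟨K, hK, hKsub, hKc⟩ := local_compact_nhds ((isOpen_Iio.preimage hhc).mem_nhds hh0)
  obtain ⟨ψ, hψ1, hψ0, hψ⟩ := exists_contMDiffMap_one_nhds_of_subset_interior
    (n := (⊤ : ℕ∞)) (𝓡 n) (isClosed_singleton (x := q₀))
    (singleton_subset_iff.2 (mem_interior_iff_mem_nhds.2 hK))
  have hψq : ψ q₀ = 1 := hψ1.self_of_nhdsSet q₀ rfl
  set V : M → EuclideanSpace ℝ (Fin (n + p)) := fun q => ψ q • N q with hV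
  have hVs : ContMDiff (𝓡 n) 𝓘(ℝ, EuclideanSpace ℝ (Fin (n + p))) ∞ V := ψ.contMDiff.smul hNs
  have hVc : HasCompactSupport V :=
    HasCompactSupport.intro hKc fun z hz => by simp only [hV, hψ0 z hz, zero_smul]
  have hVn : ∀ q, V q ∈ (tangentSpan X q)ᗮ := fun q => Submodule.smul_mem _ _ (hNn q)
  obtain ⟨hDi, hD0⟩ := hcrit.integral_normal_eq_zero hX ht₀ hVs hVc hVn
  have hDeq : ∀ q, firstVariationDensity X x₀ t₀ V 0 0 q
      = gaussianKernel n x₀ t₀ (X q) * (ψ q * h q) := by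
    intro q
    simp only [firstVariationDensity, hh]
    rw [tangentialDivergence_of_normal hX ((hVs q).mdifferentiableAt (by simp))
      (Eventually.of_forall hVn), tangentialDivergence_of_normal hX
      ((hNs q).mdifferentiableAt (by simp)) (Eventually.of_forall hNn)]
    simp only [hV, sub_zero, inner_smul_right]
    ring
  have hDc : Continuous (firstVariationDensity X x₀ t₀ V 0 0) :=
    continuous_firstVariationDensity hX hVs 0 0
  have hDle : ∀ q, 0 ≤ -firstVariationDensity X x₀ t₀ V 0 0 q := by
    intro q
    rw [hDeq, neg_nonneg]
    refine mul_nonpos_of_nonneg_of_nonpos (gaussianKernel_pos ht₀ _ _).le ?_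
    by_cases hq : q ∈ K
    · exact mul_nonpos_of_nonneg_of_nonpos (hψ q).1 (le_of_lt (hKsub hq))
    · rw [hψ0 q hq, zero_mul]
  have hae := (integral_eq_zero_iff_of_nonneg (f := fun q =>
    -firstVariationDensity X x₀ t₀ V 0 0 q) hDle hDi.neg).1 (by rw [integral_neg, hD0, neg_zero])
  refine volumeMeasure_pos_of_isOpen hX (U := {q | firstVariationDensity X x₀ t₀ V 0 0 q ≠ 0})
    (isOpen_ne_fun hDc continuous_const) ⟨q₀, ?_⟩ ?_
  · change firstVariationDensity X x₀ t₀ V 0 0 q₀ ≠ 0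
    rw [hDeq, hψq, one_mul]
    exact mul_ne_zero (gaussianKernel_pos ht₀ _ _).ne' hh0.ne
  · refine measure_mono_null (fun q hq => ?_) (ae_iff.1 hae)
    simpa using! hq

end CriticalPointsAreShrinkers

end SelfShrinker

end

theorem theorem3p7 {n p : ℕ} {M : Type*} [TopologicalSpace M] [T2Space M]
    [SecondCountableTopology M] [ChartedSpace (EuclideanSpace ℝ (Fin n)) M]
    [IsManifold (𝓡 n) ∞ M] [MeasurableSpace M] [BorelSpace M]
    (X : M → EuclideanSpace ℝ (Fin (n + p))) (hX : SelfShrinker.IsSmoothImmersion X)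
    (x₀ : EuclideanSpace ℝ (Fin (n + p))) (t₀ : ℝ) (ht₀ : 0 < t₀) :
    (SelfShrinker.IsCriticalPoint X x₀ t₀ → SelfShrinker.IsSelfShrinker X x₀ t₀) ∧
    (SelfShrinker.IsCompleteImmersion X → SelfShrinker.HasPolynomialVolumeGrowth X →
      SelfShrinker.IsSelfShrinker X x₀ t₀ → SelfShrinker.IsCriticalPoint X x₀ t₀) :=
  ⟨fun h => h.isSelfShrinker hX ht₀, fun hc hg hS => hS.isCriticalPoint hX ht₀ hc hg⟩
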